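/- Let $n\ge 0$ and let $ds^2=\sum_{i,j=1}^n h_{i\bar j}\,dz^i\otimes d\bar z^j$ be a (smooth) Kähler metric on $\mathbb{C}^n$: $H=(h_{i\bar j})$ is a smooth family of positive definite Hermitian matrices and the form $\omega=\frac{\sqrt{-1}}{2}\sum_{i,j} h_{i\bar j}\,dz^i\wedge d\bar z^j$ is closed. Write $\partial_i=\partial/\partial z^i$, $\bar\partial_j=\partial/\partial\bar z^j$, let $h^{i\bar j}$ be the elements of the inverse matrix, $\sum_j h_{k\bar j}h^{i\bar j}=\delta_{ki}$, and equip $\mathcal{A}=C^\infty(\mathbb{C}^n)$ (complex-valued smooth functions) with the Poisson bracket of $\omega$, $$\{f_1,f_2\}=\frac{2}{\sqrt{-1}}\sum_{i,j=1}^n h^{i\bar j}\bigl(\partial_i f_1\,\bar\partial_j f_2-\bar\partial_j f_1\,\partial_i f_2\bigr).$$ For multi-indices $I,J$ with $|I|,|J|\ge 1$ put $\Phi_{I\bar J}=\partial^{I'}\bar\partial^{J'}h_{i_1\bar j_1}$, where $I'=I\setminus\{i_1\}$, $J'=J\setminus\{j_1\}$ (so $\Phi_{I\bar J}=\partial^I\bar\partial^J\Phi$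 for any potential $\Phi$ with $h_{i\bar j}=\partial_i\bar\partial_j\Phi$). For $f_1,f_2\in\mathcal{A}$ and $z,y\in\mathbb{C}^n$ consider the formal power series in $\epsilon$ $$\Bigl(\sum_{J}\frac{\epsilon^{|J|}}{J!}\bar\partial^J f_1(z)\,\bar y^J\Bigr)\Bigl(\sum_{I}\frac{\epsilon^{|I|}}{I!}\partial^I f_2(z)\,y^I\Bigr)\exp\Bigl(-\sum_{|I|,|J|\ge1}\frac{\epsilon^{|I|+|J|-2}}{I!\,J!}\Phi_{I\bar J}(z)\,y^I\bar y^J\Bigr)\Bigl(\sum_{I,J}\frac{\epsilon^{|I|+|J|}}{I!\,J!}\partial^I\bar\partial^J(\det H)(z)\,y^I\bar y^J\Bigr),$$ whose coefficients are polynomials in $y,\bar y$ times the Gaussian $e^{-\sum h_{i\bar j}(z)y^i\bar y^j}$. Integrate each coefficient over $y\in\mathbb{C}^n$ with respect to $\pi^{-n}$ times Lebesgue measure. (This is the Laplace expansion at the critical point $v=z$, with $v=z+\epsilon y$ and $\epsilon^2=\hbar$, of the formal integral $\int_{\mathbb{C}^n} f_1(z,\bar v)f_2(v,\bar z)e^{\phi(z,\bar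 z;v,\bar v)/\hbar}d\mu_\hbar(v,\bar v)$, where $\phi(z,\bar z;v,\bar v)=\Phi(z,\bar v)+\Phi(v,\bar z)-\Phi(z,\bar z)-\Phi(v,\bar v)$ is the Calabi function and $d\mu_\hbar=\det H\prod_i\frac{|dv^i\wedge d\bar v^i|}{2\pi\hbar}$.) Then these integrals converge, those belonging to odd powers of $\epsilon$ vanish, and, with $\epsilon^2=\hbar$, they define a unique $\mathbb{C}[[\hbar]]$-bilinear product $\bullet:\mathcal{A}[[\hbar]]\times\mathcal{A}[[\hbar]]\to\mathcal{A}[[\hbar]]$. This product is a deformation quantization of the symplectic manifold $(\mathbb{C}^n,\omega)$: it is associative; for $f_1,f_2\in\mathcal{A}$ the coefficient of every power of $\hbar$ in $f_1\bullet f_2$ is a bidifferential operator of finite order with smooth coefficients in $f_1,f_2$; and, for all $f_1,f_2\in\mathcal{A}$, $$f_1\bullet f_2=f_1f_2+O(\hbar),\qquad f_1\bullet f_2-f_2\bullet f_1=\frac{\hbar}{2\sqrt{-1}}\{f_1,f_2\}+O(\hbar^2),$$ where $O(\hbar^k)$ means divisible by $\hbar^k$ in $\mathcal{A}[[\hbar]]$.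 Moreover $$\overline{f_1\bullet f_2}=\bar f_2\bullet\bar f_1\qquad\text{for all } f_1,f_2\in\mathcal{A}[[\hbar]],$$ where the bar is pointwise complex conjugation of functions, applied to each coefficient (with $\hbar$ real). -/

import Mathlib

open scoped ContDiff ComplexOrder

noncomputable section

namespace KahlerQuantization

/-- The algebra `𝒜 = C^∞(ℂⁿ)` of complex-valued functions on `ℂⁿ` that are smooth in the real
sense, with pointwise operations. -/
def smoothFunctions (n : ℕ) : Subalgebra ℂ ((Fin n → ℂ) → ℂ) where
  carrier := {f | ContDiff ℝ ∞ f}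
  mul_mem' {f g} hf hg := by
    simp only [Set.mem_ofPred_eq] at hf hg ⊢
    exact hf.mul hg
  add_mem' {f g} hf hg := by
    simp only [Set.mem_ofPred_eq] at hf hg ⊢
    exact hf.add hg
  algebraMap_mem' c := by
    simp only [Set.mem_ofPred_eq]
    exact contDiff_const (c := c)

theorem mem_smoothFunctions {n : ℕ} {f : (Fin n → ℂ) → ℂ} :
    f ∈ smoothFunctions n ↔ ContDiff ℝ ∞ f := Iff.rfl

/-- Elements of `𝒜 = C^∞(ℂⁿ)`; the value of `f` at `z` is `f.1 z`. -/
abbrev Obs (n : ℕ) : Type := ↥(smoothFunctions n)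

theorem contDiff_obs {n : ℕ} (f : Obs n) : ContDiff ℝ ∞ f.1 := mem_smoothFunctions.1 f.2

/-- The directional derivative of `f` in the real direction `w`, again a smooth function. -/
def dirDeriv {n : ℕ} (w : Fin n → ℂ) (f : Obs n) : Obs n :=
  ⟨fun z => fderiv ℝ f.1 z w, mem_smoothFunctions.2
    (((contDiff_obs f).fderiv_right (m := ∞) le_rfl).clm_apply contDiff_const)⟩

/-- The Wirtinger derivative `∂ᵢ = ∂/∂zⁱ = ½ (∂/∂xⁱ - √-1 ∂/∂yⁱ)`. -/
def dz {n : ℕ} (i : Fin n) (f : Obs n) : Obs n :=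
  (1 / 2 : ℂ) • (dirDeriv (Pi.single i 1) f - Complex.I • dirDeriv (Pi.single i Complex.I) f)

/-- The Wirtinger derivative `∂̄ᵢ = ∂/∂z̄ⁱ = ½ (∂/∂xⁱ + √-1 ∂/∂yⁱ)`. -/
def dzbar {n : ℕ} (i : Fin n) (f : Obs n) : Obs n :=
  (1 / 2 : ℂ) • (dirDeriv (Pi.single i 1) f + Complex.I • dirDeriv (Pi.single i Complex.I) f)

/-- Pointwise complex conjugation of a smooth function. -/
def conjObs {n : ℕ} (f : Obs n) : Obs n :=
  ⟨fun z => (starRingEnd ℂ) (f.1 z), mem_smoothFunctions.2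
    (Complex.conjCLE.contDiff.comp (contDiff_obs f))⟩

/-- Coefficientwise complex conjugation on `𝒜[[ħ]]` (the parameter `ħ` is real). -/
def conjSeries {n : ℕ} (F : PowerSeries (Obs n)) : PowerSeries (Obs n) :=
  PowerSeries.mk fun k => conjObs (PowerSeries.coeff k F)

/-- A (smooth) Kähler metric `ds² = ∑ h_{ij̄} dzⁱ ⊗ dz̄ʲ` on `ℂⁿ`: the matrix
`H = (h_{ij̄})`, with row index `i` and column index `j`, is a smooth family of positive definite
Hermitian matrices, and the form `ω = (√-1 / 2) ∑ h_{ij̄} dzⁱ ∧ dz̄ʲ` is closed.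
As `H` is Hermitian, `dω = 0` is equivalent to `∂ₖ h_{ij̄} = ∂ᵢ h_{kj̄}`. -/
structure KahlerMetric (n : ℕ) where
  h : Matrix (Fin n) (Fin n) (Obs n)
  posDef : ∀ z : Fin n → ℂ, (h.map fun f => f.1 z).PosDef
  closed : ∀ i j k : Fin n, dz k (h i j) = dz i (h k j)

/-- The determinant of the metric is an invertible element of `𝒜`, so that the inverse matrix below
is the genuine inverse. -/
theorem KahlerMetric.isUnit_det {n : ℕ} (g : KahlerMetric n) : IsUnit g.h.det := by
  have key : ∀ z, g.h.det.1 z = (g.h.map fun f => f.1 z).det := by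
    intro z
    let ev : Obs n →+* ℂ := (Pi.evalRingHom (fun _ => ℂ) z).comp (smoothFunctions n).val.toRingHom
    exact RingHom.map_det ev g.h
  have hne : ∀ z, g.h.det.1 z ≠ 0 := by
    intro z
    rw [key z]
    exact (g.posDef z).det_pos.ne'
  refine IsUnit.of_mul_eq_one ⟨fun z => (g.h.det.1 z)⁻¹, mem_smoothFunctions.2
    ((contDiff_obs g.h.det).inv hne)⟩ ?_
  ext z
  exact mul_inv_cancel₀ (hne z)

/-- The element `h^{ij̄}` of the inverse of the metric, i.e. `∑ⱼ h_{kj̄} h^{ij̄} = δ_{ki}`. -/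
def KahlerMetric.inv {n : ℕ} (g : KahlerMetric n) (i j : Fin n) : Obs n :=
  g.h⁻¹ j i

/-- The Poisson bracket of the symplectic form `ω`,
`{f₁, f₂} = (2 / √-1) ∑ h^{ij̄} (∂ᵢ f₁ ∂̄ⱼ f₂ - ∂̄ⱼ f₁ ∂ᵢ f₂)`. -/
def KahlerMetric.poisson {n : ℕ} (g : KahlerMetric n) (f₁ f₂ : Obs n) : Obs n :=
  (2 / Complex.I) •
    ∑ i, ∑ j, g.inv i j * (dz i f₁ * dzbar j f₂ - dzbar j f₁ * dz i f₂)

/-! ### The formal integral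

With `ε² = ħ` and `v = z + ε y`, the product is the formal integral
`π⁻ⁿ ∫ f₁(z, z̄ + ε ȳ) f₂(z + ε y, z̄) exp(φ(z, z̄; z + ε y, z̄ + ε ȳ) / ε²) det H(z + ε y) dy`,
where `φ` is the Calabi function and every factor is replaced by its formal expansion in `ε`. -/

/-- The operator `D_y = ∑ᵢ yⁱ ∂ᵢ` for a fixed vector `y`. By the multinomial formula
`D_y^p f / p! = ∑_{|I| = p} ∂^I f y^I / I!`. -/
def hol {n : ℕ} (y : Fin n → ℂ) (f : Obs n) : Obs n :=
  ∑ i, y i • dz i f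

/-- The operator `D̄_y = ∑ⱼ ȳʲ ∂̄ⱼ` for a fixed vector `y`. By the multinomial formula
`D̄_y^q f / q! = ∑_{|J| = q} ∂̄^J f ȳ^J / J!`. -/
def antihol {n : ℕ} (y : Fin n → ℂ) (f : Obs n) : Obs n :=
  ∑ j, (starRingEnd ℂ) (y j) • dzbar j f

/-- The formal power series `f(z + ε y, z̄)` in `ε`. -/
def holExpansion {n : ℕ} (f : Obs n) (z y : Fin n → ℂ) : PowerSeries ℂ :=
  PowerSeries.mk fun m => ((hol y)^[m] f).1 z / (m.factorial : ℂ)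

/-- The formal power series `f(z, z̄ + ε ȳ)` in `ε`. -/
def antiholExpansion {n : ℕ} (f : Obs n) (z y : Fin n → ℂ) : PowerSeries ℂ :=
  PowerSeries.mk fun m => ((antihol y)^[m] f).1 z / (m.factorial : ℂ)

/-- The full Taylor series `f(z + ε y, z̄ + ε ȳ)` in `ε`. -/
def fullExpansion {n : ℕ} (f : Obs n) (z y : Fin n → ℂ) : PowerSeries ℂ :=
  PowerSeries.mk fun m => ∑ pq ∈ Finset.HasAntidiagonal.antidiagonal m,
    ((hol y)^[pq.1] ((antihol y)^[pq.2] f)).1 z / ((pq.1.factorial : ℂ) * (pq.2.factorial : ℂ))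

/-- The function `∑ h_{ij̄} yⁱ ȳʲ` on `ℂⁿ` for a fixed vector `y`; it is `D_y D̄_y Φ` for every
local potential `Φ` of the metric. -/
def KahlerMetric.quad {n : ℕ} (g : KahlerMetric n) (y : Fin n → ℂ) : Obs n :=
  ∑ i, ∑ j, (y i * (starRingEnd ℂ) (y j)) • g.h i j

/-- The formal power series `φ(z, z̄; z + ε y, z̄ + ε ȳ) / ε²` in `ε`, where
`φ(z, z̄; v, v̄) = Φ(z, v̄) + Φ(v, z̄) - Φ(z, z̄) - Φ(v, v̄)` is the Calabi function. If `Φ` is a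
potential of the metric, `h_{ij̄} = ∂ᵢ ∂̄ⱼ Φ`, the Taylor expansion of the Calabi function is
`- ∑_{|I|, |J| ≥ 1} ∂^I ∂̄^J Φ y^I ȳ^J ε^{|I| + |J|} / (I! J!)
  = - ∑_{p, q ≥ 0} D_y^{p+1} D̄_y^{q+1} Φ ε^{p + q + 2} / ((p + 1)! (q + 1)!)`,
and `D_y^{p+1} D̄_y^{q+1} Φ = D_y^p D̄_y^q (∑ h_{ij̄} yⁱ ȳʲ)` depends on the metric only. -/
def KahlerMetric.calabiExpansion {n : ℕ} (g : KahlerMetric n) (z y : Fin n → ℂ) :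
    PowerSeries ℂ :=
  PowerSeries.mk fun m => -∑ pq ∈ Finset.HasAntidiagonal.antidiagonal m,
    ((hol y)^[pq.1] ((antihol y)^[pq.2] (g.quad y))).1 z /
      (((pq.1 + 1).factorial : ℂ) * ((pq.2 + 1).factorial : ℂ))

/-- The exponential `e^S = e^{S₀} ∑ₖ (S - S₀)ᵏ / k!` of a formal power series `S` over `ℂ` with
constant term `S₀`. -/
def formalExp (S : PowerSeries ℂ) : PowerSeries ℂ :=
  PowerSeries.C (Complex.exp (PowerSeries.constantCoeff S)) *
    PowerSeries.subst (S - PowerSeries.C (PowerSeries.constantCoeff S)) (PowerSeries.exp ℂ)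

/-- The integrand of the formal integral, as a formal power series in `ε`. Each coefficient is a
polynomial in `y, ȳ` times the Gaussian `exp(-∑ h_{ij̄}(z) yⁱ ȳʲ)`; the factor `det H` comes from the
volume form `ωⁿ`. -/
def KahlerMetric.integrand {n : ℕ} (g : KahlerMetric n) (f₁ f₂ : Obs n) (z y : Fin n → ℂ) :
    PowerSeries ℂ :=
  antiholExpansion f₁ z y * holExpansion f₂ z y * formalExp (g.calabiExpansion z y) *
    fullExpansion g.h.det z y

/-- The coefficient of `εᵐ` in the formal integral at the point `z`: the Gaussian integral over
`y ∈ ℂⁿ`, with respect to Lebesgue measure divided by `πⁿ`, of the coefficient of `εᵐ` in the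
integrand. -/
def KahlerMetric.laplaceCoeff {n : ℕ} (g : KahlerMetric n) (f₁ f₂ : Obs n) (m : ℕ)
    (z : Fin n → ℂ) : ℂ :=
  ((Real.pi : ℂ) ^ n)⁻¹ * ∫ y : Fin n → ℂ, PowerSeries.coeff m (g.integrand f₁ f₂ z y)

/-- A `ℂ[[ħ]]`-bilinear product on `𝒜[[ħ]]`. -/
abbrev FormalProduct (n : ℕ) : Type :=
  PowerSeries (Obs n) →ₗ[PowerSeries ℂ] PowerSeries (Obs n) →ₗ[PowerSeries ℂ] PowerSeries (Obs n)

/-- The coefficient of `ħᵏ` in the product of `f₁, f₂ ∈ 𝒜`. -/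
def cochain {n : ℕ} (B : FormalProduct n) (k : ℕ) (f₁ f₂ : Obs n) : Obs n :=
  PowerSeries.coeff k (B (PowerSeries.C f₁) (PowerSeries.C f₂))

/-- `B` is the non-normalized product `•` of the Kähler metric: for `f₁, f₂ ∈ 𝒜` the Gaussian
integrals that define the formal integral converge, the formal integral is a power series in
`ħ = ε²`, and this series is `B f₁ f₂`. -/
structure IsBullet {n : ℕ} (g : KahlerMetric n) (B : FormalProduct n) : Prop where
  integrable : ∀ (f₁ f₂ : Obs n) (m : ℕ) (z : Fin n → ℂ),
    MeasureTheory.Integrable fun y : Fin n → ℂ => PowerSeries.coeff m (g.integrand f₁ f₂ z y)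
  odd : ∀ (f₁ f₂ : Obs n) (k : ℕ) (z : Fin n → ℂ), g.laplaceCoeff f₁ f₂ (2 * k + 1) z = 0
  even : ∀ (f₁ f₂ : Obs n) (k : ℕ) (z : Fin n → ℂ),
    (cochain B k f₁ f₂).1 z = g.laplaceCoeff f₁ f₂ (2 * k) z

/-- The partial derivatives `∂ᵢ` (left summand) and `∂̄ᵢ` (right summand). -/
def partialDeriv {n : ℕ} : Fin n ⊕ Fin n → Obs n → Obs n
  | .inl i => dz i
  | .inr i => dzbar i

/-- The iterated partial derivative given by a list of partial derivatives. -/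
def iterPartial {n : ℕ} (w : List (Fin n ⊕ Fin n)) (f : Obs n) : Obs n :=
  w.foldr partialDeriv f

/-- `C` is a bidifferential operator (of finite order, with smooth coefficients). -/
def IsBidifferential {n : ℕ} (C : Obs n → Obs n → Obs n) : Prop :=
  ∃ (s : Finset (List (Fin n ⊕ Fin n) × List (Fin n ⊕ Fin n)))
    (a : List (Fin n ⊕ Fin n) × List (Fin n ⊕ Fin n) → Obs n),
    ∀ f₁ f₂ : Obs n, C f₁ f₂ = ∑ w ∈ s, a w * iterPartial w.1 f₁ * iterPartial w.2 f₂

/-- A `ℂ[[ħ]]`-bilinear product on `𝒜[[ħ]]` is a deformation quantization of the symplectic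
manifold `(ℂⁿ, ω)` if it is associative, its coefficients are bidifferential operators, it deforms
the pointwise product, and the correspondence principle
`f₁ • f₂ - f₂ • f₁ = (ħ / 2√-1) {f₁, f₂} + O(ħ²)` holds. Here `X = ħ`, and `O(ħᵏ)` means
divisible by `ħᵏ`. -/
structure IsDeformationQuantization {n : ℕ} (g : KahlerMetric n) (B : FormalProduct n) :
    Prop where
  assoc : ∀ F₁ F₂ F₃ : PowerSeries (Obs n), B (B F₁ F₂) F₃ = B F₁ (B F₂ F₃)
  bidifferential : ∀ k : ℕ, IsBidifferential (cochain B k)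
  classical : ∀ f₁ f₂ : Obs n,
    (PowerSeries.X : PowerSeries (Obs n)) ∣
      B (PowerSeries.C f₁) (PowerSeries.C f₂) - PowerSeries.C (f₁ * f₂)
  correspondence : ∀ f₁ f₂ : Obs n,
    (PowerSeries.X : PowerSeries (Obs n)) ^ 2 ∣
      B (PowerSeries.C f₁) (PowerSeries.C f₂) - B (PowerSeries.C f₂) (PowerSeries.C f₁) -
        PowerSeries.X * PowerSeries.C ((1 / (2 * Complex.I)) • g.poisson f₁ f₂)

end KahlerQuantization

end

/-! Very little analysis is needed. The integral of a polynomial in `y, ȳ` against the Gaussian of a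
positive definite `H` converges, it satisfies integration by parts (`gaussianIntegral_pderiv`), and
the Gaussian itself has integral `πⁿ / det H`. These facts determine the functional algebraically:
by `gaussian_mem` and `gaussian_eq`, integration by parts reduces every moment to the value at `1`.
Consequently the moments are smooth in `z`, and differentiation under the integral sign becomes
Jacobi's formula for `det H` (`derivation_gaussian`). The structure `FormalKahler` records what
remains, and the formal integral becomes a purely algebraic operation on power series in `ε`.

Associativity. Translations in `z` and `z̄` are the formal shifts `exp (ε D)`. Shifting an inner
integral moves the shift under the integral sign and changes the Gaussian weight (`tau_twisted`), so
`(f₁ • f₂) • f₃` and `f₁ • (f₂ • f₃)` are both iterated Gaussian integrals over an inner variable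
`a` and an outer variable `b`. In the integrand of the right bracketing substitute `a ↦ b - a`, `ā ↦
b̄`, `b ↦ a`, `b̄ ↦ b̄ + ā`, with `a` and `ā` treated as independent. This preserves `h(a, ā) + h(b,
b̄)`, hence the iterated functional (`G₂_fubiniSubst`), and turns the right integrand into the left
one (`map_integrandRight`). The exponents match because the Calabi function is a cocycle in each
displacement (`calabi_add_left`, `calabi_add_right`). That property is derived from closedness of
the form through `jop_add`, without choosing a potential.

The symmetries are those of the integrand. Reversing `y` and `ε` together leaves it unchanged, so
odd coefficients integrate to zero; conjugation exchanges its two function arguments.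

For the correspondence principle, the coefficient of `ε²` is `f₁ f₂` times a fixed function plus `∑
h^{ij̄} ∂ᵢ f₂ ∂̄ⱼ f₁` (`coeff_two_formalIntegral`). Terms with a single derivative vanish by
closedness together with differentiation of the normalization `G (det) = 1`. The first summand is
symmetric and cancels in the commutator; it need not be zero, since the product is not normalized.

Finally, a biadditive operation that commutes with the formal parameter is determined by constants
(`ext_of_X_mul`, `IsFormalProduct.ext_C`). This yields uniqueness, bilinearity and the passage of
all identities from `𝒜` to `𝒜[[ħ]]`. -/

set_option linter.unusedSectionVars false

noncomputable section
namespace KahlerQuantization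

open PowerSeries Finset

/-! ### Formal differential equations, exponentials and shifts in `ε`. -/

section Series

variable {R S : Type*} [CommRing R] [Algebra ℂ R] [CommRing S] [Algebra ℂ S]

/-- Coefficientwise application of a linear map to a power series. -/
def coeffMap (T : R →ₗ[ℂ] S) : PowerSeries R →ₗ[ℂ] PowerSeries S where
  toFun F := PowerSeries.mk fun m => T (coeff m F)
  map_add' F G := by ext; simp
  map_smul' c F := by ext; simp

@[simp] theorem coeff_coeffMap (T : R →ₗ[ℂ] S) (F : PowerSeries R) (m : ℕ) :
    coeff m (coeffMap T F) = T (coeff m F) := by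
  simp [coeffMap]

theorem coeffMap_C (T : R →ₗ[ℂ] S) (a : R) : coeffMap T (C a) = C (T a) := by
  ext m; simp only [coeff_coeffMap, coeff_C]; split_ifs <;> simp

theorem coeffMap_X_mul (T : R →ₗ[ℂ] S) (F : PowerSeries R) :
    coeffMap T (X * F) = X * coeffMap T F := by
  ext m; cases m <;> simp [coeff_succ_X_mul]

theorem coeffMap_derivative (T : R →ₗ[ℂ] S) (F : PowerSeries R) :
    coeffMap T (d⁄dX R F) = d⁄dX S (coeffMap T F) := by
  ext m
  have h : coeff (m + 1) F * ((m : R) + 1) = ((m : ℂ) + 1) • coeff (m + 1) F := by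
    rw [Algebra.smul_def, mul_comm]; simp
  simp only [coeff_coeffMap, coeff_derivative, h, map_smul]
  rw [Algebra.smul_def, mul_comm]; simp

theorem coeffMap_mul_of_derivation (D : Derivation ℂ R R) (F G : PowerSeries R) :
    coeffMap (D : R →ₗ[ℂ] R) (F * G) =
      coeffMap (D : R →ₗ[ℂ] R) F * G + F * coeffMap (D : R →ₗ[ℂ] R) G := by
  ext m
  simp only [coeff_coeffMap, coeff_mul, map_sum, map_add, Derivation.coeFn_coe, Derivation.leibniz,
    smul_eq_mul, ← sum_add_distrib]
  exact sum_congr rfl fun x _ => by ring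

/-- Additive maps that commute with `X` and agree on constants are equal. -/
theorem ext_of_X_mul {M : Type*} [CommRing M] {A : Type*} [CommRing A]
    {Θ₁ Θ₂ : PowerSeries A →+ PowerSeries M}
    (h₁ : ∀ F, Θ₁ (X * F) = X * Θ₁ F) (h₂ : ∀ F, Θ₂ (X * F) = X * Θ₂ F)
    (h : ∀ a, Θ₁ (C a) = Θ₂ (C a)) : Θ₁ = Θ₂ := by
  -- Writing `F = X * F' + C a`, coefficient `m + 1` of the image involves only coefficient `m` of
  -- the image of `F'`. Hence no continuity assumption is needed.
  have key : ∀ (m : ℕ) (F : PowerSeries A), coeff m (Θ₁ F) = coeff m (Θ₂ F) := by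
    intro m
    induction m with
    | zero =>
      intro F
      rw [eq_X_mul_shift_add_const F, map_add Θ₁, map_add Θ₂, h₁, h₂, h]
      simp
    | succ m ih =>
      intro F
      rw [eq_X_mul_shift_add_const F, map_add Θ₁, map_add Θ₂, h₁, h₂, h]
      simp only [map_add, coeff_succ_X_mul, ih]
  ext F m
  exact key m F

theorem eq_zero_of_natCast_succ_mul {a : R} (m : ℕ) (h : a * ((m : R) + 1) = 0) : a = 0 := by
  have h1 : ((m : ℂ) + 1) • a = 0 := by
    rw [Algebra.smul_def, mul_comm]; simpa using h
  exact (smul_eq_zero_iff_right (Nat.cast_add_one_ne_zero m)).1 h1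

/-- Uniqueness for formal differential equations. -/
theorem eq_zero_of_derivative {F : PowerSeries R} (h0 : coeff 0 F = 0)
    (h : ∀ m, (∀ k ≤ m, coeff k F = 0) → coeff m (d⁄dX R F) = 0) : F = 0 := by
  have key : ∀ m, ∀ k ≤ m, coeff k F = 0 := by
    intro m
    induction m with
    | zero => intro k hk; obtain rfl : k = 0 := by omega
              exact h0
    | succ m ih =>
      intro k hk
      rcases Nat.lt_or_ge k (m + 1) with hk' | hk'
      · exact ih k (by omega)
      · obtain rfl : k = m + 1 := by omega
        have := h m ih
        rw [coeff_derivative] at this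
        exact eq_zero_of_natCast_succ_mul m this
  ext m
  simpa using key m m le_rfl

theorem eq_of_derivative_eq {F G : PowerSeries R} (h0 : coeff 0 F = coeff 0 G)
    (h : d⁄dX R F = d⁄dX R G) : F = G := by
  rw [← sub_eq_zero]
  exact eq_zero_of_derivative (by rw [map_sub, h0, sub_self]) fun m _ => by simp [h]

omit [Algebra ℂ R] in
theorem coeff_mul_eq_zero {F : PowerSeries R} (S : PowerSeries R) {m : ℕ}
    (h : ∀ k ≤ m, coeff k F = 0) : coeff m (S * F) = 0 := by
  rw [coeff_mul]
  refine sum_eq_zero fun p hp => ?_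
  rw [h p.2 (by have := mem_antidiagonal.1 hp; omega), mul_zero]

/-- The coefficients of the exponential of a formal power series without constant term. -/
def expCoeff (S : PowerSeries R) : ℕ → R
  | 0 => 1
  | m + 1 => ((m : ℂ) + 1)⁻¹ • ∑ i : Fin (m + 1), coeff i (d⁄dX R S) * expCoeff S (m - i)

/-- The exponential of a formal power series, normalized to have constant term `1`. -/
def fexp (S : PowerSeries R) : PowerSeries R := PowerSeries.mk (expCoeff S)

@[simp] theorem coeff_zero_fexp (S : PowerSeries R) : coeff 0 (fexp S) = 1 := by
  simp [fexp, expCoeff, -coeff_zero_eq_constantCoeff]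

theorem derivative_fexp (S : PowerSeries R) : d⁄dX R (fexp S) = d⁄dX R S * fexp S := by
  ext m
  have hm : ((m : ℂ) + 1) ≠ 0 := Nat.cast_add_one_ne_zero m
  rw [coeff_derivative, coeff_mul, Nat.sum_antidiagonal_eq_sum_range_succ_mk, fexp, coeff_mk,
    expCoeff, Finset.sum_range]
  have : ((m : R) + 1) = algebraMap ℂ R ((m : ℂ) + 1) := by simp
  rw [this, mul_comm, ← Algebra.smul_def, smul_smul, mul_inv_cancel₀ hm, one_smul]
  simp

/-- The equation `E' = S' E` with initial value `1` has a single solution. Identities for `fexp` are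
proved by checking this equation. -/
theorem eq_fexp {S E : PowerSeries R} (h0 : coeff 0 E = 1) (h : d⁄dX R E = d⁄dX R S * E) :
    E = fexp S := by
  rw [← sub_eq_zero]
  refine eq_zero_of_derivative ?_ fun m hm => ?_
  · rw [map_sub, coeff_zero_fexp, h0, sub_self]
  · rw [map_sub, h, derivative_fexp, ← mul_sub]
    exact coeff_mul_eq_zero _ hm

omit [Algebra ℂ R] in
theorem coeff_zero_mul' (F G : PowerSeries R) : coeff 0 (F * G) = coeff 0 F * coeff 0 G := by
  simp

/-- No condition on constant terms is needed: `fexp` sees its argument only through the derivative,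
so it is `exp (S - S₀)`. -/
theorem fexp_add (S T : PowerSeries R) : fexp (S + T) = fexp S * fexp T := by
  symm
  apply eq_fexp
  · rw [coeff_zero_mul', coeff_zero_fexp, coeff_zero_fexp, one_mul]
  · rw [Derivation.leibniz, derivative_fexp, derivative_fexp, map_add]
    simp only [smul_eq_mul]; ring

/-- The exponential commutes with maps of rings. -/
theorem map_fexp (φ : R →+* S) (F : PowerSeries R) :
    PowerSeries.map φ (fexp F) = fexp (PowerSeries.map φ F) := by
  have hmap : ∀ G : PowerSeries R, d⁄dX S (PowerSeries.map φ G) =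
      PowerSeries.map φ (d⁄dX R G) := by
    intro G; ext m; simp [coeff_derivative]
  apply eq_fexp
  · rw [coeff_map, coeff_zero_fexp, map_one]
  · rw [hmap, hmap, derivative_fexp, map_mul]

theorem rescale_fexp (a : R) (F : PowerSeries R) : rescale a (fexp F) = fexp (rescale a F) := by
  have hresc : ∀ G : PowerSeries R, d⁄dX R (rescale a G) = C a * rescale a (d⁄dX R G) := by
    intro G; ext m; simp only [coeff_derivative, coeff_rescale, coeff_C_mul]; ring
  apply eq_fexp
  · rw [coeff_rescale, coeff_zero_fexp, pow_zero, one_mul]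
  · rw [hresc, hresc, derivative_fexp, map_mul]; ring

/-- The exponential agrees with substitution into the exponential series. -/
theorem subst_exp_eq_fexp {T : PowerSeries ℂ} (hT : constantCoeff T = 0) :
    PowerSeries.subst T (PowerSeries.exp ℂ) = fexp T := by
  have hs : HasSubst T := HasSubst.of_constantCoeff_zero' hT
  apply eq_fexp
  · have h1 : PowerSeries.exp ℂ = X * (PowerSeries.mk fun p => coeff (p + 1) (PowerSeries.exp ℂ)) +
        C 1 := by
      have := eq_X_mul_shift_add_const (PowerSeries.exp ℂ)
      rwa [constantCoeff_exp] at this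
    rw [h1, subst_add hs, subst_mul hs, subst_X hs]
    simp [hT, ← coe_substAlgHom hs]
  · rw [derivative_subst hs, derivative_exp, mul_comm]

/-- Since `fexp F` stands for `exp (F - F₀)`, differentiating coefficients produces the factor `D F
- D F₀`. The difference of the two sides solves `E' = F' E` with initial value `0`. -/
theorem coeffMap_fexp (D : Derivation ℂ R R) {F : PowerSeries R} :
    coeffMap (D : R →ₗ[ℂ] R) (fexp F) = coeffMap (D : R →ₗ[ℂ] R) F * fexp F -
      C (coeff 0 (coeffMap (D : R →ₗ[ℂ] R) F)) * fexp F := by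
  rw [← sub_eq_zero]
  refine eq_zero_of_derivative ?_ fun m hm => ?_
  · rw [map_sub, map_sub, coeff_coeffMap, coeff_zero_mul', coeff_zero_mul', coeff_zero_fexp]
    simp
  · have h : d⁄dX R (coeffMap (D : R →ₗ[ℂ] R) (fexp F) - (coeffMap (D : R →ₗ[ℂ] R) F * fexp F -
      C (coeff 0 (coeffMap (D : R →ₗ[ℂ] R) F)) * fexp F)) =
        d⁄dX R F * (coeffMap (D : R →ₗ[ℂ] R) (fexp F) - (coeffMap (D : R →ₗ[ℂ] R) F * fexp F -
      C (coeff 0 (coeffMap (D : R →ₗ[ℂ] R) F)) * fexp F)) := by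
      rw [map_sub, map_sub, ← coeffMap_derivative, derivative_fexp, coeffMap_mul_of_derivation,
        Derivation.leibniz, Derivation.leibniz, derivative_fexp, coeffMap_derivative, derivative_C]
      simp only [smul_eq_mul]; ring
    rw [h]
    exact coeff_mul_eq_zero _ hm

/-! ### Operators on power series -/

/-- The operator `∑ₐ cₐ εᵃ Tᵃ` on power series in `ε`. -/
def opSeries (c : ℕ → ℂ) (T : R →ₗ[ℂ] R) : PowerSeries R →ₗ[ℂ] PowerSeries R where
  toFun F := PowerSeries.mk fun m => ∑ p ∈ antidiagonal m, c p.1 • (T ^ p.1) (coeff p.2 F)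
  map_add' F G := by ext; simp [sum_add_distrib]
  map_smul' a F := by
    ext m
    simp [smul_sum, smul_comm (c _) a]

theorem coeff_opSeries (c : ℕ → ℂ) (T : R →ₗ[ℂ] R) (F : PowerSeries R) (m : ℕ) :
    coeff m (opSeries c T F) = ∑ p ∈ antidiagonal m, c p.1 • (T ^ p.1) (coeff p.2 F) := by
  simp [opSeries]

theorem coeff_opSeries_C (c : ℕ → ℂ) (T : R →ₗ[ℂ] R) (a : R) (m : ℕ) :
    coeff m (opSeries c T (C a)) = c m • (T ^ m) a := by
  rw [coeff_opSeries, sum_eq_single (m, 0)]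
  · simp
  · rintro ⟨i, j⟩ hij hne
    have : j ≠ 0 := by
      rintro rfl
      exact hne (by simpa using mem_antidiagonal.1 hij)
    simp [coeff_C, this]
  · intro h; simp at h

theorem coeff_zero_opSeries (c : ℕ → ℂ) (T : R →ₗ[ℂ] R) (F : PowerSeries R) :
    coeff 0 (opSeries c T F) = c 0 • coeff 0 F := by
  simp [coeff_opSeries]

theorem opSeries_X_mul (c : ℕ → ℂ) (T : R →ₗ[ℂ] R) (F : PowerSeries R) :
    opSeries c T (X * F) = X * opSeries c T F := by
  ext m
  cases m with
  | zero => simp [coeff_opSeries]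
  | succ m =>
    rw [coeff_succ_X_mul, coeff_opSeries, coeff_opSeries,
      Finset.Nat.sum_antidiagonal_succ' (n := m)]
    simp [coeff_succ_X_mul]

/-- The common source of three facts: shifts commute with commuting operators, with substitutions of
variables, and, after twisting, with partial integration. -/
theorem coeffMap_opSeries {L : R →ₗ[ℂ] S} {T : R →ₗ[ℂ] R} {T' : S →ₗ[ℂ] S}
    (h : ∀ a, L (T a) = T' (L a)) (c : ℕ → ℂ) (F : PowerSeries R) :
    coeffMap L (opSeries c T F) = opSeries c T' (coeffMap L F) := by
  have hp : ∀ k a, L ((T ^ k) a) = (T' ^ k) (L a) := by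
    intro k
    induction k with
    | zero => simp
    | succ k ih => intro a; rw [pow_succ, pow_succ, Module.End.mul_apply, Module.End.mul_apply, ih, h]
  ext m
  simp [coeff_opSeries, hp]

theorem opSeries_comm {T T' : R →ₗ[ℂ] R} (h : Commute T T') (c c' : ℕ → ℂ) (F : PowerSeries R) :
    opSeries c T (opSeries c' T' F) = opSeries c' T' (opSeries c T F) := by
  have key : ((opSeries c T).comp (opSeries c' T')).toAddMonoidHom =
      ((opSeries c' T').comp (opSeries c T)).toAddMonoidHom := by
    refine ext_of_X_mul (fun F => ?_) (fun F => ?_) fun a => ?_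
    · simp [opSeries_X_mul]
    · simp [opSeries_X_mul]
    · ext m
      simp only [LinearMap.toAddMonoidHom_coe, LinearMap.comp_apply]
      rw [coeff_opSeries, coeff_opSeries, ← Finset.Nat.sum_antidiagonal_swap]
      refine sum_congr rfl fun p _ => ?_
      simp only [coeff_opSeries_C, Prod.fst_swap, Prod.snd_swap, map_smul]
      rw [smul_comm, ← Module.End.mul_apply, (h.pow_pow p.2 p.1).eq, Module.End.mul_apply]
  exact DFunLike.congr_fun key F

/-- The formal shift `exp (ε T)`. -/
def tau (T : R →ₗ[ℂ] R) : PowerSeries R →ₗ[ℂ] PowerSeries R :=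
  opSeries (fun a => (a.factorial : ℂ)⁻¹) T

/-- The operator `(exp (ε T) - 1) / (ε T)`. -/
def jop (T : R →ₗ[ℂ] R) : PowerSeries R →ₗ[ℂ] PowerSeries R :=
  opSeries (fun a => ((a + 1).factorial : ℂ)⁻¹) T

theorem coeff_zero_tau (T : R →ₗ[ℂ] R) (F : PowerSeries R) : coeff 0 (tau T F) = coeff 0 F := by
  simp [tau, coeff_zero_opSeries]

theorem coeff_zero_jop (T : R →ₗ[ℂ] R) (F : PowerSeries R) : coeff 0 (jop T F) = coeff 0 F := by
  simp [jop, coeff_zero_opSeries]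

theorem tau_X_mul (T : R →ₗ[ℂ] R) (F : PowerSeries R) : tau T (X * F) = X * tau T F :=
  opSeries_X_mul _ _ _

/-- The product rule for `exp (ε T) F(ε)`: the total degree `m + 1` is split into the degree of the
exponential and that of `F`. -/
theorem derivative_tau (T : R →ₗ[ℂ] R) (F : PowerSeries R) :
    d⁄dX R (tau T F) = coeffMap T (tau T F) + tau T (d⁄dX R F) := by
  ext m
  have key : ∀ p ∈ antidiagonal (m + 1),
      ((p.1.factorial : ℂ)⁻¹ • (T ^ p.1) (coeff p.2 F)) * ((m : R) + 1) =
      ((p.1 : ℂ) * (p.1.factorial : ℂ)⁻¹) • (T ^ p.1) (coeff p.2 F) +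
      ((p.2 : ℂ) * (p.1.factorial : ℂ)⁻¹) • (T ^ p.1) (coeff p.2 F) := by
    intro p hp
    have h1 : ((m : R) + 1) = algebraMap ℂ R ((p.1 : ℂ) + p.2) := by
      have h2 : ((p.1 + p.2 : ℕ) : R) = ((m + 1 : ℕ) : R) := by rw [mem_antidiagonal.1 hp]
      push_cast at h2
      simp [h2]
    rw [h1, mul_comm, ← Algebra.smul_def, smul_smul, add_mul, add_smul]
  rw [coeff_derivative, tau, coeff_opSeries, sum_mul, sum_congr rfl key, sum_add_distrib, map_add]
  congr 1
  · rw [Finset.Nat.sum_antidiagonal_succ, coeff_coeffMap, coeff_opSeries, map_sum]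
    simp only [Nat.cast_zero, zero_mul, zero_smul, zero_add, map_smul]
    refine sum_congr rfl fun p _ => ?_
    rw [pow_succ', Module.End.mul_apply]
    congr 1
    rw [Nat.factorial_succ]
    have := Nat.cast_add_one_ne_zero (R := ℂ) p.1
    have := Nat.cast_ne_zero (R := ℂ).2 p.1.factorial_ne_zero
    push_cast
    field_simp
  · rw [Finset.Nat.sum_antidiagonal_succ', coeff_opSeries]
    simp only [Nat.cast_zero, zero_mul, zero_smul, zero_add, coeff_derivative]
    refine sum_congr rfl fun p _ => ?_
    have h1 : (coeff (p.2 + 1) F) * ((p.2 : R) + 1) = ((p.2 : ℂ) + 1) • coeff (p.2 + 1) F := by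
      rw [Algebra.smul_def, mul_comm]; simp
    rw [h1, map_smul, smul_smul, mul_comm]
    push_cast
    rfl

theorem derivative_tau_C (T : R →ₗ[ℂ] R) (a : R) :
    d⁄dX R (tau T (C a)) = coeffMap T (tau T (C a)) := by
  rw [derivative_tau, derivative_C, map_zero, add_zero]

theorem eq_tau_C {T : R →ₗ[ℂ] R} {a : R} {F : PowerSeries R} (h0 : coeff 0 F = a)
    (h : d⁄dX R F = coeffMap T F) : F = tau T (C a) := by
  rw [← sub_eq_zero]
  refine eq_zero_of_derivative ?_ fun m hm => ?_
  · rw [map_sub, h0, coeff_zero_tau]; simp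
  · rw [map_sub, h, derivative_tau_C, ← map_sub, coeff_coeffMap, hm m le_rfl, map_zero]

/-- The exponential of a derivation is multiplicative. On constants the product of the two shifts
solves the equation characterizing the shift of the product; `ext_of_X_mul` then extends this in
each factor. -/
theorem tau_mul (D : Derivation ℂ R R) (F G : PowerSeries R) :
    tau (D : R →ₗ[ℂ] R) (F * G) = tau (D : R →ₗ[ℂ] R) F * tau (D : R →ₗ[ℂ] R) G := by
  have key : ∀ (a : R) (G : PowerSeries R), tau (D : R →ₗ[ℂ] R) (C a * G) =
      tau (D : R →ₗ[ℂ] R) (C a) * tau (D : R →ₗ[ℂ] R) G := by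
    intro a G
    have := ext_of_X_mul
      (Θ₁ := (tau (D : R →ₗ[ℂ] R)).toAddMonoidHom.comp (AddMonoidHom.mulLeft (C a)))
      (Θ₂ := (AddMonoidHom.mulLeft (tau (D : R →ₗ[ℂ] R) (C a))).comp
        (tau (D : R →ₗ[ℂ] R)).toAddMonoidHom)
      (fun F => by simp [mul_left_comm, tau_X_mul]) (fun F => by simp [mul_left_comm, tau_X_mul])
      (fun b => by
        simp only [AddMonoidHom.comp_apply, AddMonoidHom.coe_mulLeft, LinearMap.toAddMonoidHom_coe,
          ← map_mul]
        symm
        apply eq_tau_C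
        · rw [coeff_zero_mul', coeff_zero_tau, coeff_zero_tau]; simp
        · rw [Derivation.leibniz, derivative_tau_C, derivative_tau_C, coeffMap_mul_of_derivation]
          simp only [smul_eq_mul]; ring)
    exact DFunLike.congr_fun this G
  have := ext_of_X_mul
      (Θ₁ := (tau (D : R →ₗ[ℂ] R)).toAddMonoidHom.comp (AddMonoidHom.mulRight G))
      (Θ₂ := (AddMonoidHom.mulRight (tau (D : R →ₗ[ℂ] R) G)).comp
        (tau (D : R →ₗ[ℂ] R)).toAddMonoidHom)
      (fun F => by simp [mul_assoc, tau_X_mul]) (fun F => by simp [mul_assoc, tau_X_mul])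
      (fun b => by simp [key])
  exact DFunLike.congr_fun this F

theorem tau_fexp (D : Derivation ℂ R R) {F : PowerSeries R} (hF : coeff 0 F = 0) :
    tau (D : R →ₗ[ℂ] R) (fexp F) = fexp (tau (D : R →ₗ[ℂ] R) F) := by
  have hcomm : ∀ G, coeffMap (D : R →ₗ[ℂ] R) (tau (D : R →ₗ[ℂ] R) G) =
      tau (D : R →ₗ[ℂ] R) (coeffMap (D : R →ₗ[ℂ] R) G) :=
    fun G => coeffMap_opSeries (fun _ => rfl) _ _
  have h0 : coeff 0 (coeffMap (D : R →ₗ[ℂ] R) F) = 0 := by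
    rw [coeff_coeffMap, hF, map_zero]
  apply eq_fexp
  · rw [coeff_zero_tau, coeff_zero_fexp]
  · rw [derivative_tau, derivative_tau, hcomm, hcomm, coeffMap_fexp, h0, derivative_fexp]
    simp only [map_zero, zero_mul, sub_zero, tau_mul]
    ring

theorem tau_add {T T' : R →ₗ[ℂ] R} (h : Commute T T') (F : PowerSeries R) :
    tau (T + T') F = tau T (tau T' F) := by
  have key := ext_of_X_mul (Θ₁ := (tau (T + T')).toAddMonoidHom)
    (Θ₂ := ((tau T).comp (tau T')).toAddMonoidHom)
    (fun F => by simp [tau_X_mul]) (fun F => by simp [tau_X_mul]) (fun a => by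
      simp only [LinearMap.toAddMonoidHom_coe, LinearMap.comp_apply]
      symm
      apply eq_tau_C
      · simp [coeff_zero_tau, -coeff_zero_eq_constantCoeff]
      · have hc : coeffMap T' (tau T (tau T' (C a))) = tau T (coeffMap T' (tau T' (C a))) :=
          coeffMap_opSeries (fun b => by
            rw [← Module.End.mul_apply, ← h.eq, Module.End.mul_apply]) _ _
        rw [derivative_tau, derivative_tau_C, ← hc]
        ext m
        simp)
  exact DFunLike.congr_fun key F

/-- Thus `X * jop T (C a)` is the primitive `∫₀^ε exp (s T) a ds`, which is how `jop` is handled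
below. -/
theorem derivative_X_mul_jop (T : R →ₗ[ℂ] R) (a : R) :
    d⁄dX R (X * jop T (C a)) = tau T (C a) := by
  ext m
  rw [coeff_derivative, coeff_succ_X_mul, jop, tau, coeff_opSeries_C, coeff_opSeries_C]
  have : ((m : R) + 1) = algebraMap ℂ R ((m : ℂ) + 1) := by simp
  rw [this, mul_comm, ← Algebra.smul_def, smul_smul]
  congr 1
  rw [Nat.factorial_succ]
  have := Nat.cast_add_one_ne_zero (R := ℂ) m
  have := Nat.cast_ne_zero (R := ℂ).2 m.factorial_ne_zero
  push_cast
  field_simp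

theorem X_mul_jop_apply (T : R →ₗ[ℂ] R) (a : R) :
    X * jop T (C (T a)) = tau T (C a) - C a := by
  apply eq_of_derivative_eq
  · rw [map_sub, coeff_zero_tau]; simp
  · rw [derivative_X_mul_jop, map_sub, derivative_tau_C, derivative_C, sub_zero, ← coeffMap_C]
    exact (coeffMap_opSeries (fun _ => rfl) _ _).symm

/-- If `a = T φ` and `b = T' φ`, this is the telescoping of `exp (ε (T + T')) φ - φ`. The condition
`T b = T' a` replaces the existence of `φ`: after multiplication by `X`, both sides have the same
derivative. This is the cocycle property behind associativity. -/
theorem jop_add {T T' : R →ₗ[ℂ] R} (h : Commute T T') {a b : R} (hab : T b = T' a) :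
    jop (T + T') (C (a + b)) = jop T (C a) + tau T (jop T' (C b)) := by
  suffices X * jop (T + T') (C (a + b)) = X * (jop T (C a) + tau T (jop T' (C b))) from
    X_mul_cancel this
  apply eq_of_derivative_eq
  · simp
  · have hc : coeffMap T (tau T (X * jop T' (C b))) = tau T (tau T' (C a) - C a) := by
      rw [← X_mul_jop_apply, ← hab, ← coeffMap_C, jop,
        ← coeffMap_opSeries (L := T) (T := T') fun b => by
          rw [← Module.End.mul_apply, h.eq, Module.End.mul_apply], ← coeffMap_X_mul]
      exact coeffMap_opSeries (fun _ => rfl) _ _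
    rw [derivative_X_mul_jop, mul_add, map_add (d⁄dX R), derivative_X_mul_jop, ← tau_X_mul,
      derivative_tau, hc, derivative_X_mul_jop, map_sub, ← tau_add h, ← tau_add h, map_add, map_add]
    ring

/-- The formal shift of a twisted derivation. -/
theorem tau_twisted (D : Derivation ℂ R R) (q : R) (F : PowerSeries R) :
    tau ((D : R →ₗ[ℂ] R) - LinearMap.mulRight ℂ (D q)) F =
      tau (D : R →ₗ[ℂ] R) F * fexp (C q - tau (D : R →ₗ[ℂ] R) (C q)) := by
  set E := fexp (C q - tau (D : R →ₗ[ℂ] R) (C q)) with hE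
  have key := ext_of_X_mul
    (Θ₁ := (tau ((D : R →ₗ[ℂ] R) - LinearMap.mulRight ℂ (D q))).toAddMonoidHom)
    (Θ₂ := (AddMonoidHom.mulRight E).comp (tau (D : R →ₗ[ℂ] R)).toAddMonoidHom)
    (fun F => by simp [tau_X_mul]) (fun F => by simp [tau_X_mul, mul_assoc]) (fun a => by
      simp only [LinearMap.toAddMonoidHom_coe, AddMonoidHom.comp_apply, AddMonoidHom.coe_mulRight]
      symm
      apply eq_tau_C
      · rw [coeff_zero_mul', coeff_zero_tau, hE, coeff_zero_fexp]; simp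
      -- With `τ = tau D`, the twisted operator applied to `τ a * E` gives the terms `D q - D (τ q)`
      -- from `E` and `-D q` from the twist. What remains, `-D (τ q)`, is the `ε`-derivative of the
      -- exponent of `E`.
      · have h0 : coeff 0 (coeffMap (D : R →ₗ[ℂ] R) (C q - tau (D : R →ₗ[ℂ] R) (C q))) = 0 := by
          rw [coeff_coeffMap, map_sub, coeff_zero_tau, sub_self, map_zero]
        have h1 : ∀ G : PowerSeries R,
            coeffMap ((D : R →ₗ[ℂ] R) - LinearMap.mulRight ℂ (D q)) G =
              coeffMap (D : R →ₗ[ℂ] R) G - G * C (D q) := by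
          intro G; ext m; simp
        rw [h1, coeffMap_mul_of_derivation, Derivation.leibniz, derivative_tau_C, hE,
          coeffMap_fexp, derivative_fexp, h0, map_sub, map_sub, derivative_tau_C, coeffMap_C,
          derivative_C]
        simp only [smul_eq_mul, map_zero, Derivation.coeFn_coe]
        ring)
  exact DFunLike.congr_fun key F

end Series
end KahlerQuantization

namespace KahlerQuantization

/-! ### Polynomials in the formal variables: Gaussian functionals and directional derivations. -/

section Polynomial

open MvPolynomial

variable {κ κ' ι : Type*} {A : Type*} [CommRing A] [Algebra ℂ A]

theorem coeff_sum_monomial (D : Derivation ℂ A A) (p : MvPolynomial κ A) (m : κ →₀ ℕ) :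
    coeff m (∑ k ∈ p.support, monomial k (D (coeff k p))) = D (coeff m p) := by
  classical
  rw [coeff_sum]
  simp only [coeff_monomial, Finset.sum_ite_eq', mem_support_iff, ne_eq, ite_not]
  split_ifs with h
  · rw [h, map_zero]
  · rfl

/-- The coefficientwise extension of a linear derivation to polynomials, as a linear map. -/
def mapCoeffLin (D : Derivation ℂ A A) : MvPolynomial κ A →ₗ[ℂ] MvPolynomial κ A where
  toFun p := ∑ m ∈ p.support, monomial m (D (coeff m p))
  map_add' p q := by
    ext m; rw [coeff_add, coeff_sum_monomial, coeff_sum_monomial, coeff_sum_monomial, coeff_add,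
      map_add]
  map_smul' c p := by
    ext m; rw [RingHom.id_apply, coeff_smul, coeff_sum_monomial, coeff_sum_monomial, coeff_smul,
      Derivation.map_smul]

theorem coeff_mapCoeffLin (D : Derivation ℂ A A) (p : MvPolynomial κ A) (m : κ →₀ ℕ) :
    coeff m (mapCoeffLin D p) = D (coeff m p) := coeff_sum_monomial D p m

/-- The coefficientwise extension of a derivation to polynomials. -/
def mapCoeff (D : Derivation ℂ A A) : Derivation ℂ (MvPolynomial κ A) (MvPolynomial κ A) :=
  Derivation.mk' (mapCoeffLin D) fun p q => by
    classical
    ext m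
    rw [smul_eq_mul, smul_eq_mul, mul_comm q, coeff_add, coeff_mapCoeffLin, coeff_mul, coeff_mul,
      coeff_mul, map_sum, ← Finset.sum_add_distrib]
    refine Finset.sum_congr rfl fun x _ => ?_
    rw [coeff_mapCoeffLin, coeff_mapCoeffLin, Derivation.leibniz, smul_eq_mul, smul_eq_mul]
    ring

@[simp] theorem coeff_mapCoeff (D : Derivation ℂ A A) (p : MvPolynomial κ A) (m : κ →₀ ℕ) :
    coeff m (mapCoeff D p) = D (coeff m p) := coeff_mapCoeffLin D p m

@[simp] theorem mapCoeff_C (D : Derivation ℂ A A) (a : A) :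
    mapCoeff D (C a : MvPolynomial κ A) = C (D a) := by
  classical
  ext m; rw [coeff_mapCoeff, coeff_C, coeff_C]; split_ifs <;> simp

@[simp] theorem mapCoeff_X (D : Derivation ℂ A A) (k : κ) :
    mapCoeff D (X k : MvPolynomial κ A) = 0 := by
  classical
  ext m; rw [coeff_mapCoeff, coeff_X, coeff_zero]; split_ifs <;> simp

theorem algHom_mapCoeff {S : Type*} [CommRing S] [Algebra ℂ S] [Algebra A S]
    (φ : MvPolynomial κ A →ₐ[A] S) (D : Derivation ℂ A A) (D' : Derivation ℂ S S)
    (h : ∀ a, D' (algebraMap A S a) = algebraMap A S (D a)) (hX : ∀ k, D' (φ (X k)) = 0)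
    (p : MvPolynomial κ A) : φ (mapCoeff D p) = D' (φ p) := by
  induction p using MvPolynomial.induction_on with
  | C a => rw [mapCoeff_C, ← algebraMap_eq, AlgHom.commutes, AlgHom.commutes, h]
  | add p q hp hq => rw [map_add, map_add, hp, hq, map_add, map_add]
  | mul_X p k hp =>
    rw [Derivation.leibniz, map_mul, Derivation.leibniz, hX, mapCoeff_X, smul_zero, smul_zero,
      zero_add, zero_add, smul_eq_mul, smul_eq_mul, map_mul, hp]

theorem mapCoeff_comm {D D' : Derivation ℂ A A} (h : ∀ a, D (D' a) = D' (D a))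
    (p : MvPolynomial κ A) : mapCoeff D (mapCoeff D' p) = mapCoeff D' (mapCoeff D p) := by
  ext m; simp [h]

theorem mapCoeff_pderiv (D : Derivation ℂ A A) (k : κ) (p : MvPolynomial κ A) :
    mapCoeff D (pderiv k p) = pderiv k (mapCoeff D p) := by
  ext m
  rw [coeff_mapCoeff, coeff_pderiv, coeff_pderiv, coeff_mapCoeff, Derivation.leibniz]
  have : D ((m k : A) + 1) = 0 := by
    rw [map_add, Derivation.map_natCast, Derivation.map_one_eq_zero, add_zero]
  rw [this]; simp [mul_comm]

/-- A linear map on polynomials that satisfies the formula of integration by parts of a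
nondegenerate Gaussian takes its values in every submodule that contains its value at `1`. -/
theorem gaussian_mem {κ : Type*} [Fintype κ] {A M : Type*} [CommRing A] [AddCommGroup M]
    [Module A M] (T : MvPolynomial κ A →ₗ[A] M) (Q : MvPolynomial κ A) (c : κ → κ → A)
    (hX : ∀ k, (X k : MvPolynomial κ A) = ∑ l, C (c k l) * pderiv l Q)
    (hT : ∀ k p, T (pderiv k p) = T (p * pderiv k Q)) (N : Submodule A M) (h1 : T 1 ∈ N)
    (p : MvPolynomial κ A) : T p ∈ N := by
  classical
  have hC : ∀ (a : A) (p : MvPolynomial κ A), T (C a * p) = a • T p := fun a p => by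
    rw [← smul_eq_C_mul, map_smul]
  have key : ∀ (b : ℕ) (m : κ →₀ ℕ), m.degree ≤ b → ∀ a, T (monomial m a) ∈ N := by
    intro b
    induction b with
    | zero =>
      intro m hm a
      obtain rfl : m = 0 := (Finsupp.degree_eq_zero_iff m).1 (Nat.le_zero.1 hm)
      have : (monomial 0 a : MvPolynomial κ A) = C a * 1 := by rw [mul_one]; rfl
      rw [this, hC]
      exact N.smul_mem _ h1
    | succ b ih =>
      intro m hm a
      by_cases h0 : m = 0
      · exact ih m (by simp [h0]) a
      obtain ⟨k, hk⟩ := Finsupp.ne_iff.1 h0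
      have hle : Finsupp.single k 1 ≤ m := by
        rw [Finsupp.single_le_iff]; exact Nat.one_le_iff_ne_zero.2 hk
      obtain ⟨m', rfl⟩ := exists_add_of_le hle
      have hm' : m'.degree ≤ b := by
        rw [map_add, Finsupp.degree_single] at hm; omega
      have h2 : (monomial (Finsupp.single k 1 + m') a : MvPolynomial κ A) =
          X k * monomial m' a := by
        rw [X, monomial_mul, one_mul]
      -- A variable of the monomial is rewritten as a combination of the `pderiv l Q`; integration
      -- by parts then differentiates the remaining monomial, so the degree drops.
      rw [h2, hX, Finset.sum_mul, map_sum]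
      refine N.sum_mem fun l _ => ?_
      rw [mul_assoc, hC, mul_comm, ← hT, pderiv_monomial]
      refine N.smul_mem _ (ih _ ?_ _)
      exact (Finsupp.degree_mono (tsub_le_self)).trans hm'
  rw [p.as_sum, map_sum]
  exact N.sum_mem fun m _ => key _ m le_rfl _

/-- Apply `gaussian_mem` to `T - T'` with the zero submodule. This uniqueness replaces both the
change of variables formula and differentiation under the integral sign. -/
theorem gaussian_eq {κ : Type*} [Fintype κ] {A : Type*} [CommRing A]
    {T T' : MvPolynomial κ A →ₗ[A] A} (Q : MvPolynomial κ A) (c : κ → κ → A)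
    (hX : ∀ k, (X k : MvPolynomial κ A) = ∑ l, C (c k l) * pderiv l Q)
    (hT : ∀ k p, T (pderiv k p) = T (p * pderiv k Q))
    (hT' : ∀ k p, T' (pderiv k p) = T' (p * pderiv k Q)) (h1 : T 1 = T' 1) : T = T' := by
  ext p
  have := gaussian_mem (T - T') Q c hX (fun k p => by simp [hT, hT']) ⊥ (by simp [h1])
  exact sub_eq_zero.1 (this _)

/-! ### Derivations along vectors of formal variables -/

/-- A vector of polynomials with constant coefficients. -/
def IsConstVec (v : ι → MvPolynomial κ A) : Prop :=
  ∀ (D : Derivation ℂ A A) i, mapCoeff D (v i) = 0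

theorem isConstVec_X (f : ι → κ) : IsConstVec fun i => (X (f i) : MvPolynomial κ A) :=
  fun D i => mapCoeff_X D (f i)

theorem IsConstVec.add {v w : ι → MvPolynomial κ A} (hv : IsConstVec v) (hw : IsConstVec w) :
    IsConstVec (v + w) := fun D i => by simp [hv D i, hw D i]

theorem IsConstVec.sub {v w : ι → MvPolynomial κ A} (hv : IsConstVec v) (hw : IsConstVec w) :
    IsConstVec (v - w) := fun D i => by simp [hv D i, hw D i]

variable [Fintype ι]

/-- The derivation `∑ᵢ vⁱ dᵢ` of the polynomial ring, with the `dᵢ` acting on coefficients. -/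
def dirD (d : ι → Derivation ℂ A A) (v : ι → MvPolynomial κ A) :
    Derivation ℂ (MvPolynomial κ A) (MvPolynomial κ A) := ∑ i, v i • mapCoeff (d i)

theorem dirD_apply (d : ι → Derivation ℂ A A) (v : ι → MvPolynomial κ A) (p : MvPolynomial κ A) :
    dirD d v p = ∑ i, v i * mapCoeff (d i) p := by
  rw [dirD, ← Derivation.coeFnAddMonoidHom_apply, map_sum, Finset.sum_apply]
  rfl

theorem dirD_constVec (d : ι → Derivation ℂ A A) (v : ι → MvPolynomial κ A)
    {w : κ' → MvPolynomial κ A} (hw : IsConstVec w) (j : κ') : dirD d v (w j) = 0 := by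
  rw [dirD_apply]; exact Finset.sum_eq_zero fun i _ => by rw [hw, mul_zero]

theorem dirD_add (d : ι → Derivation ℂ A A) (v w : ι → MvPolynomial κ A) :
    (dirD d (v + w) : MvPolynomial κ A →ₗ[ℂ] MvPolynomial κ A) =
      (dirD d v : MvPolynomial κ A →ₗ[ℂ] MvPolynomial κ A) +
      (dirD d w : MvPolynomial κ A →ₗ[ℂ] MvPolynomial κ A) := by
  refine LinearMap.ext fun p => ?_
  change dirD d (v + w) p = dirD d v p + dirD d w p
  simp only [dirD_apply, Pi.add_apply, add_mul, Finset.sum_add_distrib]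

/-- Constancy of the two vectors is essential: otherwise each derivation would also hit the
components of the other vector. -/
theorem dirD_comm {d d' : ι → Derivation ℂ A A} (h : ∀ i j a, d i (d' j a) = d' j (d i a))
    {v w : ι → MvPolynomial κ A} (hv : IsConstVec v) (hw : IsConstVec w) :
    Commute (dirD d v : MvPolynomial κ A →ₗ[ℂ] MvPolynomial κ A)
      (dirD d' w : MvPolynomial κ A →ₗ[ℂ] MvPolynomial κ A) := by
  refine LinearMap.ext fun p => ?_
  change dirD d v (dirD d' w p) = dirD d' w (dirD d v p)
  rw [dirD_apply d' w p, dirD_apply d v p, map_sum, map_sum]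
  simp only [Derivation.leibniz, dirD_constVec _ _ hv, dirD_constVec _ _ hw, smul_eq_mul, mul_zero,
    add_zero, dirD_apply, Finset.mul_sum]
  rw [Finset.sum_comm]
  refine Finset.sum_congr rfl fun i _ => Finset.sum_congr rfl fun j _ => ?_
  rw [mapCoeff_comm (h i j)]
  ring

/-- Substitutions with constant coefficients intertwine derivations along vectors. -/
theorem algHom_dirD (φ : MvPolynomial κ A →ₐ[A] MvPolynomial κ' A)
    (hφ : IsConstVec fun k => φ (X k)) (d : ι → Derivation ℂ A A) (v : ι → MvPolynomial κ A)
    (p : MvPolynomial κ A) : φ (dirD d v p) = dirD d (fun i => φ (v i)) (φ p) := by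
  simp only [dirD_apply, map_sum, map_mul]
  refine Finset.sum_congr rfl fun i _ => ?_
  rw [algHom_mapCoeff φ (d i) (mapCoeff (d i)) (fun a => mapCoeff_C (d i) a) (hφ (d i))]

/-- The sesquilinear form of a matrix, evaluated on two vectors of polynomials. -/
def quadForm (h : ι → ι → A) (v w : ι → MvPolynomial κ A) : MvPolynomial κ A :=
  ∑ i, ∑ j, C (h i j) * v i * w j

omit [Algebra ℂ A] in
theorem quadForm_add_left (h : ι → ι → A) (v v' w : ι → MvPolynomial κ A) :
    quadForm h (v + v') w = quadForm h v w + quadForm h v' w := by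
  simp only [quadForm, Pi.add_apply, mul_add, add_mul, Finset.sum_add_distrib]

omit [Algebra ℂ A] in
theorem quadForm_add_right (h : ι → ι → A) (v w w' : ι → MvPolynomial κ A) :
    quadForm h v (w + w') = quadForm h v w + quadForm h v w' := by
  simp only [quadForm, Pi.add_apply, mul_add, Finset.sum_add_distrib]

omit [Algebra ℂ A] in
theorem algHom_quadForm (φ : MvPolynomial κ A →ₐ[A] MvPolynomial κ' A)
    (h : ι → ι → A) (v w : ι → MvPolynomial κ A) :
    φ (quadForm h v w) = quadForm h (fun i => φ (v i)) (fun i => φ (w i)) := by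
  simp only [quadForm, map_sum, map_mul]
  refine Finset.sum_congr rfl fun i _ => Finset.sum_congr rfl fun j _ => ?_
  rw [← algebraMap_eq, AlgHom.commutes, algebraMap_eq]

theorem mapCoeff_quadForm (D : Derivation ℂ A A) (h : ι → ι → A) {v w : ι → MvPolynomial κ A}
    (hv : IsConstVec v) (hw : IsConstVec w) :
    mapCoeff D (quadForm h v w) = quadForm (fun i j => D (h i j)) v w := by
  simp only [quadForm, map_sum, Derivation.leibniz, hv D, hw D, mapCoeff_C, smul_eq_mul]
  refine Finset.sum_congr rfl fun i _ => Finset.sum_congr rfl fun j _ => ?_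
  ring

/-- The first vector of formal variables. -/
def holVar (κ A : Type*) [CommRing A] : κ → MvPolynomial (κ ⊕ κ) A := fun i => X (Sum.inl i)

/-- The second vector of formal variables. -/
def antiVar (κ A : Type*) [CommRing A] : κ → MvPolynomial (κ ⊕ κ) A := fun i => X (Sum.inr i)

omit [Fintype ι] in
theorem isConstVec_holVar : IsConstVec (holVar ι A) := isConstVec_X _
omit [Fintype ι] in
theorem isConstVec_antiVar : IsConstVec (antiVar ι A) := isConstVec_X _

end Polynomial

/-- An algebraic model of the jets of a Kähler metric: commuting derivations `∂ᵢ`, `∂̄ᵢ` of an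
algebra, a matrix with closed associated form, its inverse, and the Gaussian functional on
polynomials in the variables `yⁱ` (left summand) and `ȳⁱ` (right summand). -/
structure FormalKahler (ι A : Type*) [Fintype ι] [DecidableEq ι] [CommRing A] [Algebra ℂ A] where
  d : ι → Derivation ℂ A A
  dbar : ι → Derivation ℂ A A
  d_comm : ∀ i j a, d i (d j a) = d j (d i a)
  dbar_comm : ∀ i j a, dbar i (dbar j a) = dbar j (dbar i a)
  d_dbar_comm : ∀ i j a, d i (dbar j a) = dbar j (d i a)
  h : ι → ι → A
  hinv : ι → ι → A
  closed : ∀ i j k, d k (h i j) = d i (h k j)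
  closed_bar : ∀ i j k, dbar k (h i j) = dbar j (h i k)
  h_mul_hinv : ∀ k i, ∑ j, h k j * hinv i j = if k = i then 1 else 0
  hinv_mul_h : ∀ k j, ∑ i, hinv i k * h i j = if k = j then 1 else 0
  det : A
  G : MvPolynomial (ι ⊕ ι) A →ₗ[A] A
  G_pderiv : ∀ k p, G (MvPolynomial.pderiv k p) =
    G (p * MvPolynomial.pderiv k (quadForm h (holVar ι A) (antiVar ι A)))
  d_G : ∀ i p, d i (G p) =
    G (mapCoeff (d i) p - p * mapCoeff (d i) (quadForm h (holVar ι A) (antiVar ι A)))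
  dbar_G : ∀ i p, dbar i (G p) =
    G (mapCoeff (dbar i) p - p * mapCoeff (dbar i) (quadForm h (holVar ι A) (antiVar ι A)))
  G_det : G (MvPolynomial.C det) = 1

end KahlerQuantization

namespace KahlerQuantization

/-! ### Integration over one of two groups of variables. -/

section PartialIntegral

open MvPolynomial

variable {κ κ' : Type*} {A : Type*} [CommRing A]

/-- The functional on polynomials in two groups of variables that applies `G` to the first group. -/
def partialInt (G : MvPolynomial κ A →ₗ[A] A) :
    MvPolynomial (κ ⊕ κ') A →ₗ[A] MvPolynomial κ' A :=
  (((basisMonomials κ (MvPolynomial κ' A)).constr (MvPolynomial κ' A)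
    fun m => C (G (monomial m 1))).restrictScalars A).comp
      (sumAlgEquiv A κ κ').toLinearEquiv.toLinearMap

/-- Polynomials in two groups of variables are sums of products. -/
theorem sum_induction {motive : MvPolynomial (κ ⊕ κ') A → Prop}
    (mul : ∀ p q, motive (rename Sum.inl p * rename Sum.inr q))
    (add : ∀ P P', motive P → motive P' → motive (P + P')) (P : MvPolynomial (κ ⊕ κ') A) :
    motive P := by
  have hzero : motive 0 := by simpa using mul 0 0
  have key : ∀ P : MvPolynomial (κ ⊕ κ') A, P ∈ AddSubmonoid.closure
      {P | ∃ p q, P = rename Sum.inl p * rename Sum.inr q} := by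
    intro P
    induction P using MvPolynomial.induction_on with
    | C a => exact AddSubmonoid.subset_closure ⟨C a, 1, by simp⟩
    | add P Q hP hQ => exact add_mem hP hQ
    | mul_X P k hP =>
      induction hP using AddSubmonoid.closure_induction with
      | mem P hP =>
        obtain ⟨p, q, rfl⟩ := hP
        apply AddSubmonoid.subset_closure
        rcases k with k | k
        · exact ⟨p * X k, q, by simp; ring⟩
        · exact ⟨p, q * X k, by simp; ring⟩
      | zero => simp
      | add P Q _ _ hP hQ => rw [add_mul]; exact add_mem hP hQ
  induction key P using AddSubmonoid.closure_induction with
  | mem P hP =>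
    obtain ⟨p, q, rfl⟩ := hP
    exact mul p q
  | zero => exact hzero
  | add P Q _ _ hP hQ => exact add P Q hP hQ

theorem partialInt_mul_rename (G : MvPolynomial κ A →ₗ[A] A) (P : MvPolynomial (κ ⊕ κ') A)
    (q : MvPolynomial κ' A) : partialInt G (P * rename Sum.inr q) = partialInt G P * q := by
  have : sumAlgEquiv A κ κ' (rename Sum.inr q) = C q :=
    DFunLike.congr_fun (sumAlgEquiv_comp_rename_inr (R := A) (S₁ := κ) (S₂ := κ')) q
  simp only [partialInt, LinearMap.comp_apply, LinearMap.restrictScalars_apply,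
    AlgEquiv.toLinearEquiv_toLinearMap, AlgEquiv.toLinearMap_apply, map_mul, this]
  rw [mul_comm, ← smul_eq_C_mul, map_smul, smul_eq_mul, mul_comm]

theorem partialInt_rename (G : MvPolynomial κ A →ₗ[A] A) (p : MvPolynomial κ A) :
    partialInt (κ' := κ') G (rename Sum.inl p) = C (G p) := by
  have : sumAlgEquiv A κ κ' (rename Sum.inl p) = map C p :=
    DFunLike.congr_fun (sumAlgEquiv_comp_rename_inl (R := A) (S₁ := κ) (S₂ := κ')) p
  simp only [partialInt, LinearMap.comp_apply, LinearMap.restrictScalars_apply,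
    AlgEquiv.toLinearEquiv_toLinearMap, AlgEquiv.toLinearMap_apply, this]
  induction p using MvPolynomial.induction_on' with
  | monomial m a =>
    have h1 : (monomial m (C a : MvPolynomial κ' A)) =
        (C a : MvPolynomial κ' A) • basisMonomials κ (MvPolynomial κ' A) m := by
      rw [coe_basisMonomials, smul_monomial, smul_eq_mul, mul_one]
    have h2 : monomial m a = a • (monomial m 1 : MvPolynomial κ A) := by
      rw [smul_monomial, smul_eq_mul, mul_one]
    rw [map_monomial, h1, map_smul, Module.Basis.constr_basis, h2, map_smul, smul_eq_mul,
      smul_eq_mul, map_mul]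
  | add p q hp hq =>
    simp only [map_add] at hp hq ⊢
    rw [hp (DFunLike.congr_fun (sumAlgEquiv_comp_rename_inl (R := A) (S₁ := κ) (S₂ := κ')) p),
      hq (DFunLike.congr_fun (sumAlgEquiv_comp_rename_inl (R := A) (S₁ := κ) (S₂ := κ')) q)]

theorem partialInt_mul (G : MvPolynomial κ A →ₗ[A] A) (p : MvPolynomial κ A)
    (q : MvPolynomial κ' A) :
    partialInt G (rename Sum.inl p * rename Sum.inr q) = C (G p) * q := by
  rw [partialInt_mul_rename, partialInt_rename]

variable [Algebra ℂ A]

theorem mapCoeff_rename (D : Derivation ℂ A A) (f : κ → κ') (p : MvPolynomial κ A) :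
    mapCoeff D (rename f p) = rename f (mapCoeff D p) :=
  (algHom_mapCoeff (rename f) D (mapCoeff D) (fun a => mapCoeff_C D a)
    (fun k => by rw [rename_X, mapCoeff_X]) p).symm

/-- On a product `p q` of polynomials in separate groups, the Leibniz rule differentiates `G p` by
the hypothesis and passes through `q`; such products span. -/
theorem mapCoeff_partialInt (G : MvPolynomial κ A →ₗ[A] A) (D : Derivation ℂ A A)
    (Q : MvPolynomial κ A) (hD : ∀ p, D (G p) = G (mapCoeff D p - p * mapCoeff D Q))
    (P : MvPolynomial (κ ⊕ κ') A) :
    mapCoeff D (partialInt G P) =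
      partialInt G (mapCoeff D P - P * mapCoeff D (rename Sum.inl Q)) := by
  induction P using sum_induction with
  | add P P' hP hP' =>
    have h1 : mapCoeff D (P + P') - (P + P') * mapCoeff D (rename Sum.inl Q) =
        (mapCoeff D P - P * mapCoeff D (rename Sum.inl Q)) +
        (mapCoeff D P' - P' * mapCoeff D (rename Sum.inl Q)) := by rw [map_add]; ring
    rw [h1, map_add, map_add, map_add, hP, hP']
  | mul p q =>
      have h1 : mapCoeff D (rename Sum.inl p * rename Sum.inr q) -
          rename Sum.inl p * rename Sum.inr q * mapCoeff D (rename Sum.inl Q) =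
          rename Sum.inl (mapCoeff D p - p * mapCoeff D Q) * rename Sum.inr q +
          rename (σ := κ) Sum.inl p * rename (σ := κ') Sum.inr (mapCoeff D q) := by
        rw [Derivation.leibniz, mapCoeff_rename, mapCoeff_rename, mapCoeff_rename, map_sub, map_mul]
        simp only [smul_eq_mul]; ring
      rw [h1, map_add, partialInt_mul, partialInt_mul, partialInt_mul, ← hD, Derivation.leibniz,
        mapCoeff_C]
      simp only [smul_eq_mul]; ring

/-- The direction involves only the second group of variables, so it can be moved under the
integral. The operator that appears there is the twisted derivation of `tau_twisted`. -/
theorem dirD_partialInt {ι : Type*} [Fintype ι] (G : MvPolynomial κ A →ₗ[A] A)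
    (d : ι → Derivation ℂ A A) (Q : MvPolynomial κ A)
    (hd : ∀ i p, d i (G p) = G (mapCoeff (d i) p - p * mapCoeff (d i) Q))
    (v : ι → MvPolynomial κ' A) (P : MvPolynomial (κ ⊕ κ') A) :
    dirD d v (partialInt G P) =
      partialInt G (dirD d (fun i => rename Sum.inr (v i)) P -
        P * dirD d (fun i => rename Sum.inr (v i)) (rename Sum.inl Q)) := by
  rw [dirD_apply, dirD_apply, dirD_apply, Finset.mul_sum, ← Finset.sum_sub_distrib, map_sum]
  refine Finset.sum_congr rfl fun i _ => ?_
  rw [mapCoeff_partialInt G (d i) Q (hd i), mul_comm, ← partialInt_mul_rename]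
  congr 1
  ring

omit [Algebra ℂ A] in
/-- The iterated functional satisfies the formula of integration by parts of the sum of the
quadratic forms. -/
theorem partialInt_pderiv (G : MvPolynomial κ A →ₗ[A] A) (Q : MvPolynomial κ A)
    (hG : ∀ k p, G (pderiv k p) = G (p * pderiv k Q)) (k : κ ⊕ κ) (P : MvPolynomial (κ ⊕ κ) A) :
    G (partialInt G (pderiv k P)) =
      G (partialInt G (P * pderiv k (rename Sum.inl Q + rename Sum.inr Q))) := by
  have hl : ∀ (j : κ) (q : MvPolynomial κ A),
      pderiv (Sum.inl j) (rename (Sum.inr : κ → κ ⊕ κ) q) = 0 := by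
    intro j q
    induction q using MvPolynomial.induction_on with
    | C a => simp
    | add p q hp hq => simp [hp, hq]
    | mul_X p i hp => simp [hp]
  have hr : ∀ (j : κ) (q : MvPolynomial κ A),
      pderiv (Sum.inr j) (rename (Sum.inl : κ → κ ⊕ κ) q) = 0 := by
    intro j q
    induction q using MvPolynomial.induction_on with
    | C a => simp
    | add p q hp hq => simp [hp, hq]
    | mul_X p i hp => simp [hp]
  induction P using sum_induction with
  | add P P' hP hP' => rw [map_add, map_add, map_add, add_mul, map_add, map_add, hP, hP']
  | mul p q =>
      rcases k with k | k
      · have h1 : rename Sum.inl p * rename Sum.inr q * rename Sum.inl (pderiv k Q) =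
            rename Sum.inl (p * pderiv k Q) * rename Sum.inr q := by rw [map_mul]; ring
        rw [Derivation.leibniz, map_add (pderiv (Sum.inl k)), hl, hl, pderiv_rename Sum.inl_injective,
          pderiv_rename Sum.inl_injective, add_zero, smul_zero, zero_add, smul_eq_mul, h1,
          mul_comm, partialInt_mul, partialInt_mul, hG]
      · have h1 : rename Sum.inl p * rename Sum.inr q * rename Sum.inr (pderiv k Q) =
            rename Sum.inl p * rename Sum.inr (q * pderiv k Q) := by rw [map_mul]; ring
        rw [Derivation.leibniz, map_add (pderiv (Sum.inr k)), hr, hr, pderiv_rename Sum.inr_injective,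
          pderiv_rename Sum.inr_injective, zero_add, smul_zero, add_zero, smul_eq_mul, h1,
          partialInt_mul, partialInt_mul, ← smul_eq_C_mul, ← smul_eq_C_mul, map_smul, map_smul, hG]

end PartialIntegral

end KahlerQuantization

namespace KahlerQuantization

/-! ### Derivatives of the quadratic form and its covariance. -/

section QuadForm

open MvPolynomial

variable {ι A : Type*} [Fintype ι] [DecidableEq ι] [CommRing A]

theorem pderiv_inl_quadForm (h : ι → ι → A) (i : ι) :
    pderiv (Sum.inl i) (quadForm h (holVar ι A) (antiVar ι A)) =
      ∑ l, C (h i l) * antiVar ι A l := by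
  simp only [quadForm, holVar, antiVar, map_sum, Derivation.leibniz, pderiv_C, pderiv_X,
    Pi.single_apply, reduceCtorEq, if_false, zero_add, add_zero, smul_eq_mul,
    Sum.inl.injEq, mul_ite, mul_one, mul_zero]
  rw [Finset.sum_comm]
  simp [mul_comm]

theorem pderiv_inr_quadForm (h : ι → ι → A) (j : ι) :
    pderiv (Sum.inr j) (quadForm h (holVar ι A) (antiVar ι A)) =
      ∑ l, C (h l j) * holVar ι A l := by
  simp only [quadForm, holVar, antiVar, map_sum, Derivation.leibniz, pderiv_C, pderiv_X,
    Pi.single_apply, reduceCtorEq, if_false, add_zero, smul_eq_mul,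
    Sum.inr.injEq, mul_ite, mul_one, mul_zero]
  simp

/-- The covariance matrix of a Gaussian. -/
def covMatrix (hinv : ι → ι → A) : ι ⊕ ι → ι ⊕ ι → A
  | .inl i, .inr j => hinv i j
  | .inr j, .inl i => hinv i j
  | _, _ => 0

theorem X_eq_sum_covMatrix {h hinv : ι → ι → A}
    (h_mul_hinv : ∀ k i, ∑ j, h k j * hinv i j = if k = i then 1 else 0)
    (hinv_mul_h : ∀ k j, ∑ i, hinv i k * h i j = if k = j then 1 else 0) (k : ι ⊕ ι) :
    (X k : MvPolynomial (ι ⊕ ι) A) =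
      ∑ l, C (covMatrix hinv k l) * pderiv l (quadForm h (holVar ι A) (antiVar ι A)) := by
  rw [Fintype.sum_sum_type]
  rcases k with k | k
  · simp only [covMatrix, map_zero, zero_mul, Finset.sum_const_zero, zero_add, pderiv_inr_quadForm,
      Finset.mul_sum]
    rw [Finset.sum_comm]
    have : ∀ i, ∑ j, C (hinv k j) * (C (h i j) * holVar ι A i) =
        if i = k then X (Sum.inl i) else 0 := by
      intro i
      have h1 := congrArg (C (σ := ι ⊕ ι)) (h_mul_hinv i k)
      rw [map_sum] at h1
      simp only [← mul_assoc, ← map_mul, ← Finset.sum_mul, mul_comm (hinv k _)]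
      rw [h1, holVar]
      split_ifs <;> simp
    simp [this]
  · simp only [covMatrix, map_zero, zero_mul, Finset.sum_const_zero, add_zero, pderiv_inl_quadForm,
      Finset.mul_sum]
    rw [Finset.sum_comm]
    have : ∀ i, ∑ j, C (hinv j k) * (C (h j i) * antiVar ι A i) =
        if k = i then X (Sum.inr i) else 0 := by
      intro i
      have h1 := congrArg (C (σ := ι ⊕ ι)) (hinv_mul_h k i)
      rw [map_sum] at h1
      simp only [← mul_assoc, ← map_mul, ← Finset.sum_mul]
      rw [h1, antiVar]
      split_ifs <;> simp
    simp [this]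

end QuadForm

/-! ### The substitution that exchanges the order of the two integrations. -/

namespace FormalKahler

open MvPolynomial

variable {ι A : Type*} [Fintype ι] [DecidableEq ι] [CommRing A] [Algebra ℂ A]
  (K : FormalKahler ι A) {κ κ' : Type*}

/-- The quadratic form of the Gaussian. -/
abbrev Q : MvPolynomial (ι ⊕ ι) A := quadForm K.h (holVar ι A) (antiVar ι A)

/-- The covariance matrix of the Gaussian. -/
abbrev cov : ι ⊕ ι → ι ⊕ ι → A := covMatrix K.hinv

theorem X_eq_cov (k : ι ⊕ ι) :
    (X k : MvPolynomial (ι ⊕ ι) A) = ∑ l, C (K.cov k l) * pderiv l K.Q :=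
  X_eq_sum_covMatrix K.h_mul_hinv K.hinv_mul_h k

theorem G_X_mul (k : ι ⊕ ι) (p : MvPolynomial (ι ⊕ ι) A) :
    K.G (X k * p) = ∑ l, K.cov k l * K.G (pderiv l p) := by
  rw [X_eq_cov, Finset.sum_mul, map_sum]
  refine Finset.sum_congr rfl fun l _ => ?_
  rw [K.G_pderiv, mul_assoc, ← smul_eq_C_mul, map_smul, smul_eq_mul, mul_comm p]

/-- The variables of the inner integral. -/
def innerHol (ι A : Type*) [CommRing A] : ι → MvPolynomial ((ι ⊕ ι) ⊕ (ι ⊕ ι)) A :=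
  fun i => X (.inl (.inl i))

/-- The conjugate variables of the inner integral. -/
def innerAnti (ι A : Type*) [CommRing A] : ι → MvPolynomial ((ι ⊕ ι) ⊕ (ι ⊕ ι)) A :=
  fun i => X (.inl (.inr i))

/-- The variables of the outer integral. -/
def outerHol (ι A : Type*) [CommRing A] : ι → MvPolynomial ((ι ⊕ ι) ⊕ (ι ⊕ ι)) A :=
  fun i => X (.inr (.inl i))

/-- The conjugate variables of the outer integral. -/
def outerAnti (ι A : Type*) [CommRing A] : ι → MvPolynomial ((ι ⊕ ι) ⊕ (ι ⊕ ι)) A :=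
  fun i => X (.inr (.inr i))

/-- The linear substitution that exchanges the order of integration. -/
def fubiniSubst (ι A : Type*) [CommRing A] :
    MvPolynomial ((ι ⊕ ι) ⊕ (ι ⊕ ι)) A →ₐ[A] MvPolynomial ((ι ⊕ ι) ⊕ (ι ⊕ ι)) A :=
  aeval fun k => match k with
    | .inl (.inl i) => outerHol ι A i - innerHol ι A i
    | .inl (.inr i) => outerAnti ι A i
    | .inr (.inl i) => innerHol ι A i
    | .inr (.inr i) => outerAnti ι A i + innerAnti ι A i

theorem fubiniSubst_innerHol (i : ι) :
    fubiniSubst ι A (innerHol ι A i) = outerHol ι A i - innerHol ι A i := by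
  simp [fubiniSubst, innerHol]

theorem fubiniSubst_innerAnti (i : ι) :
    fubiniSubst ι A (innerAnti ι A i) = outerAnti ι A i := by
  simp [fubiniSubst, innerAnti]

theorem fubiniSubst_outerHol (i : ι) :
    fubiniSubst ι A (outerHol ι A i) = innerHol ι A i := by
  simp [fubiniSubst, outerHol]

theorem fubiniSubst_outerAnti (i : ι) :
    fubiniSubst ι A (outerAnti ι A i) = outerAnti ι A i + innerAnti ι A i := by
  simp [fubiniSubst, outerAnti]

theorem isConstVec_innerHol : IsConstVec (innerHol ι A) := isConstVec_X _
theorem isConstVec_innerAnti : IsConstVec (innerAnti ι A) := isConstVec_X _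
theorem isConstVec_outerHol : IsConstVec (outerHol ι A) := isConstVec_X _
theorem isConstVec_outerAnti : IsConstVec (outerAnti ι A) := isConstVec_X _

theorem isConstVec_fubiniSubst : IsConstVec fun k => fubiniSubst ι A (X k) := by
  rintro D ((i | i) | (i | i))
  · exact (congrArg (mapCoeff D) (fubiniSubst_innerHol i)).trans
      (isConstVec_outerHol.sub isConstVec_innerHol D i)
  · exact (congrArg (mapCoeff D) (fubiniSubst_innerAnti i)).trans
      (isConstVec_outerAnti D i)
  · exact (congrArg (mapCoeff D) (fubiniSubst_outerHol i)).trans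
      (isConstVec_innerHol D i)
  · exact (congrArg (mapCoeff D) (fubiniSubst_outerAnti i)).trans
      (isConstVec_outerAnti.add isConstVec_innerAnti D i)

/-- The quadratic form of the iterated Gaussian. -/
abbrev Q₂ : MvPolynomial ((ι ⊕ ι) ⊕ (ι ⊕ ι)) A :=
  rename Sum.inl K.Q + rename Sum.inr K.Q

theorem rename_inl_Q : rename Sum.inl K.Q = quadForm K.h (innerHol ι A) (innerAnti ι A) := by
  rw [algHom_quadForm]; simp only [holVar, antiVar, rename_X]; rfl

theorem rename_inr_Q : rename Sum.inr K.Q = quadForm K.h (outerHol ι A) (outerAnti ι A) := by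
  rw [algHom_quadForm]; simp only [holVar, antiVar, rename_X]; rfl

/-- By sesquilinearity `h(b - a, b̄) + h(a, b̄ + ā) = h(b, b̄) + h(a, ā)`, with `a` inner and `b`
outer. -/
theorem fubiniSubst_Q₂ : fubiniSubst ι A K.Q₂ = K.Q₂ := by
  have h1 := quadForm_add_left K.h (outerHol ι A - innerHol ι A) (innerHol ι A) (outerAnti ι A)
  rw [sub_add_cancel] at h1
  rw [map_add, rename_inl_Q, rename_inr_Q, algHom_quadForm, algHom_quadForm]
  simp only [fubiniSubst_innerHol, fubiniSubst_innerAnti, fubiniSubst_outerHol,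
    fubiniSubst_outerAnti]
  have h2 := quadForm_add_right K.h (innerHol ι A) (outerAnti ι A) (innerAnti ι A)
  have h3 : (fun i => outerHol ι A i - innerHol ι A i) = outerHol ι A - innerHol ι A := rfl
  have h4 : (fun i => outerAnti ι A i + innerAnti ι A i) = outerAnti ι A + innerAnti ι A := rfl
  have h5 : (fun i => outerAnti ι A i) = outerAnti ι A := rfl
  have h6 : (fun i => innerHol ι A i) = innerHol ι A := rfl
  rw [h3, h4, h5, h6, h2, Q₂, rename_inl_Q, rename_inr_Q, h1]
  ring

/-- The chain rule for the substitution that exchanges the order of integration. -/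
theorem fubiniSubst_pderiv (k : (ι ⊕ ι) ⊕ (ι ⊕ ι)) :
    ∃ a : (ι ⊕ ι) ⊕ (ι ⊕ ι) → ℤ, ∀ P : MvPolynomial ((ι ⊕ ι) ⊕ (ι ⊕ ι)) A,
      fubiniSubst ι A (pderiv k P) = ∑ l, a l • pderiv l (fubiniSubst ι A P) := by
  -- Both sides are derivations along the substitution and kill constants, so only the variables
  -- need to be tested. There the condition says that `a` is a column of the inverse of the
  -- substitution matrix, which has integer entries.
  have key : ∀ a : (ι ⊕ ι) ⊕ (ι ⊕ ι) → ℤ,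
      (∀ j, ∑ l, a l • pderiv l (fubiniSubst ι A (X j)) =
        if k = j then 1 else 0) →
      ∀ P : MvPolynomial ((ι ⊕ ι) ⊕ (ι ⊕ ι)) A,
      fubiniSubst ι A (pderiv k P) = ∑ l, a l • pderiv l (fubiniSubst ι A P) := by
    intro a ha P
    induction P using MvPolynomial.induction_on with
    | C b =>
      rw [pderiv_C, map_zero, ← algebraMap_eq, AlgHom.commutes, algebraMap_eq]
      simp
    | add P P' hP hP' => simp only [map_add, hP, hP', smul_add, Finset.sum_add_distrib]
    | mul_X P j hP =>
      have h1 : fubiniSubst ι A (pderiv k (X j)) =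
          ∑ l, a l • pderiv l (fubiniSubst ι A (X j)) := by
        rw [ha, pderiv_X, Pi.single_apply]
        simp only [eq_comm]
        split_ifs <;> simp
      rw [Derivation.leibniz, map_add, smul_eq_mul, smul_eq_mul, map_mul, map_mul, hP, h1, map_mul]
      simp only [Derivation.leibniz, smul_eq_mul, smul_add, Finset.sum_add_distrib, Finset.mul_sum,
        mul_smul_comm]
  rcases k with (i | i) | (i | i)
  · refine ⟨Pi.single (.inr (.inl i)) 1, key _ ?_⟩
    rintro ((j | j) | (j | j)) <;>
    simp [fubiniSubst, innerHol, innerAnti, outerHol, outerAnti, Pi.single_apply, pderiv_X,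
      ite_smul, eq_comm]
  · refine ⟨Pi.single (.inr (.inr i)) 1 - Pi.single (.inl (.inr i)) 1, key _ ?_⟩
    rintro ((j | j) | (j | j)) <;>
    simp [fubiniSubst, innerHol, innerAnti, outerHol, outerAnti, Pi.single_apply, pderiv_X,
      sub_smul, ite_smul, eq_comm]
  · refine ⟨Pi.single (.inl (.inl i)) 1 + Pi.single (.inr (.inl i)) 1, key _ ?_⟩
    rintro ((j | j) | (j | j)) <;>
    simp [fubiniSubst, innerHol, innerAnti, outerHol, outerAnti, Pi.single_apply, pderiv_X,
      add_smul, ite_smul, eq_comm]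
  · refine ⟨Pi.single (.inl (.inr i)) 1, key _ ?_⟩
    rintro ((j | j) | (j | j)) <;>
    simp [fubiniSubst, innerHol, innerAnti, outerHol, outerAnti, Pi.single_apply, pderiv_X,
      ite_smul, eq_comm]

/-- The iterated Gaussian functional. -/
def G₂ : MvPolynomial ((ι ⊕ ι) ⊕ (ι ⊕ ι)) A →ₗ[A] A := K.G ∘ₗ partialInt K.G

theorem G₂_pderiv (k) (P : MvPolynomial ((ι ⊕ ι) ⊕ (ι ⊕ ι)) A) :
    K.G₂ (pderiv k P) = K.G₂ (P * pderiv k K.Q₂) :=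
  partialInt_pderiv K.G K.Q K.G_pderiv k P

/-- The substitution is linear and preserves `Q₂`, so the pulled back functional obeys the same
integration by parts and has the same value at `1`; `gaussian_eq` applies. The substitution treats
`y` and `ȳ` as independent, so it is not a change of the actual integration variables. -/
theorem G₂_fubiniSubst (P : MvPolynomial ((ι ⊕ ι) ⊕ (ι ⊕ ι)) A) :
    K.G₂ (fubiniSubst ι A P) = K.G₂ P := by
  have := gaussian_eq (T := K.G₂ ∘ₗ (fubiniSubst ι A).toLinearMap) (T' := K.G₂) K.Q₂
    (fun k l => match k, l with
      | .inl k, .inl l => K.cov k l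
      | .inr k, .inr l => K.cov k l
      | _, _ => 0) ?_ ?_ K.G₂_pderiv (by simp)
  · exact DFunLike.congr_fun this P
  · have hl : ∀ (j : ι ⊕ ι) (q : MvPolynomial (ι ⊕ ι) A),
        pderiv (Sum.inl j) (rename (Sum.inr : _ → (ι ⊕ ι) ⊕ (ι ⊕ ι)) q) = 0 := by
      intro j q
      induction q using MvPolynomial.induction_on with
      | C a => simp
      | add p q hp hq => simp [hp, hq]
      | mul_X p i hp => simp [hp]
    have hr : ∀ (j : ι ⊕ ι) (q : MvPolynomial (ι ⊕ ι) A),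
        pderiv (Sum.inr j) (rename (Sum.inl : _ → (ι ⊕ ι) ⊕ (ι ⊕ ι)) q) = 0 := by
      intro j q
      induction q using MvPolynomial.induction_on with
      | C a => simp
      | add p q hp hq => simp [hp, hq]
      | mul_X p i hp => simp [hp]
    rintro (k | k)
    · rw [Fintype.sum_sum_type]
      have := congrArg (rename (Sum.inl : _ → (ι ⊕ ι) ⊕ (ι ⊕ ι))) (K.X_eq_cov k)
      simp only [rename_X, map_sum, map_mul, rename_C] at this
      simp only [this, map_add, hl, pderiv_rename Sum.inl_injective]
      simp
    · rw [Fintype.sum_sum_type]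
      have := congrArg (rename (Sum.inr : _ → (ι ⊕ ι) ⊕ (ι ⊕ ι))) (K.X_eq_cov k)
      simp only [rename_X, map_sum, map_mul, rename_C] at this
      simp only [this, map_add, hr, pderiv_rename Sum.inr_injective]
      simp
  · intro k P
    obtain ⟨a, ha⟩ := fubiniSubst_pderiv (A := A) k
    simp only [LinearMap.comp_apply, AlgHom.toLinearMap_apply, map_mul, ha, fubiniSubst_Q₂,
      Finset.mul_sum, map_sum, mul_smul_comm]
    refine Finset.sum_congr rfl fun l _ => ?_
    rw [map_zsmul, map_zsmul, G₂_pderiv]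

end FormalKahler

end KahlerQuantization

namespace KahlerQuantization

/-! ### The formal integral and its associativity. -/

namespace FormalKahler

open MvPolynomial

variable {ι A : Type*} [Fintype ι] [DecidableEq ι] [CommRing A] [Algebra ℂ A]
  (K : FormalKahler ι A) {κ κ' : Type*}

/-- The formal shift of the holomorphic coordinates by the vector `v`. -/
def shift (v : ι → MvPolynomial κ A) :
    PowerSeries (MvPolynomial κ A) →ₗ[ℂ] PowerSeries (MvPolynomial κ A) :=
  tau (dirD K.d v).toLinearMap

/-- The formal shift of the antiholomorphic coordinates by the vector `w`. -/
def shiftBar (w : ι → MvPolynomial κ A) :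
    PowerSeries (MvPolynomial κ A) →ₗ[ℂ] PowerSeries (MvPolynomial κ A) :=
  tau (dirD K.dbar w).toLinearMap

/-- The expansion of the negative of the Calabi function, divided by `ε²`. -/
def calabi (v w : ι → MvPolynomial κ A) : PowerSeries (MvPolynomial κ A) :=
  jop (dirD K.d v).toLinearMap
    (jop (dirD K.dbar w).toLinearMap (PowerSeries.C (quadForm K.h v w)))

/-- The integrand of the formal integral, without the Gaussian factor. -/
def weight (v w : ι → MvPolynomial κ A) (F₁ F₂ : PowerSeries (MvPolynomial κ A)) :
    PowerSeries (MvPolynomial κ A) :=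
  K.shiftBar w F₁ * K.shift v F₂ *
    fexp (PowerSeries.C (quadForm K.h v w) - K.calabi v w) *
    K.shift v (K.shiftBar w (PowerSeries.C (C K.det)))

theorem shift_mul (v : ι → MvPolynomial κ A) (F G : PowerSeries (MvPolynomial κ A)) :
    K.shift v (F * G) = K.shift v F * K.shift v G := tau_mul _ _ _

theorem shiftBar_mul (w : ι → MvPolynomial κ A) (F G : PowerSeries (MvPolynomial κ A)) :
    K.shiftBar w (F * G) = K.shiftBar w F * K.shiftBar w G := tau_mul _ _ _

theorem coeff_zero_calabi (v w : ι → MvPolynomial κ A) :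
    PowerSeries.coeff 0 (K.calabi v w) = quadForm K.h v w := by
  rw [calabi, coeff_zero_jop, coeff_zero_jop]; simp

theorem shift_fexp (v v' w : ι → MvPolynomial κ A) :
    K.shift v' (fexp (PowerSeries.C (quadForm K.h v w) - K.calabi v w)) =
      fexp (K.shift v' (PowerSeries.C (quadForm K.h v w)) - K.shift v' (K.calabi v w)) := by
  rw [shift, tau_fexp, map_sub]
  rw [map_sub, coeff_zero_calabi]; simp

theorem shiftBar_fexp (v w w' : ι → MvPolynomial κ A) :
    K.shiftBar w' (fexp (PowerSeries.C (quadForm K.h v w) - K.calabi v w)) =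
      fexp (K.shiftBar w' (PowerSeries.C (quadForm K.h v w)) - K.shiftBar w' (K.calabi v w)) := by
  rw [shiftBar, tau_fexp, map_sub]
  rw [map_sub, coeff_zero_calabi]; simp

variable {K}

theorem shift_comm {v w : ι → MvPolynomial κ A} (hv : IsConstVec v) (hw : IsConstVec w)
    (F : PowerSeries (MvPolynomial κ A)) :
    K.shift v (K.shiftBar w F) = K.shiftBar w (K.shift v F) :=
  opSeries_comm (dirD_comm K.d_dbar_comm hv hw) _ _ _

theorem shift_add {v v' : ι → MvPolynomial κ A} (hv : IsConstVec v) (hv' : IsConstVec v')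
    (F : PowerSeries (MvPolynomial κ A)) :
    K.shift (v + v') F = K.shift v (K.shift v' F) := by
  rw [shift, dirD_add, tau_add (dirD_comm K.d_comm hv hv')]; rfl

theorem shiftBar_add {w w' : ι → MvPolynomial κ A} (hw : IsConstVec w) (hw' : IsConstVec w')
    (F : PowerSeries (MvPolynomial κ A)) :
    K.shiftBar (w + w') F = K.shiftBar w (K.shiftBar w' F) := by
  rw [shiftBar, dirD_add, tau_add (dirD_comm K.dbar_comm hw hw')]; rfl

/-- This is closedness of the form contracted with three vectors. It supplies the compatibility
hypothesis of `jop_add`. -/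
theorem dirD_d_quadForm {v v' w : ι → MvPolynomial κ A} (hv : IsConstVec v) (hv' : IsConstVec v')
    (hw : IsConstVec w) : dirD K.d v (quadForm K.h v' w) = dirD K.d v' (quadForm K.h v w) := by
  simp only [dirD_apply, mapCoeff_quadForm _ _ hv hw, mapCoeff_quadForm _ _ hv' hw]
  simp only [quadForm, Finset.mul_sum]
  rw [Finset.sum_comm]
  refine Finset.sum_congr rfl fun i _ => Finset.sum_congr rfl fun k _ =>
    Finset.sum_congr rfl fun j _ => ?_
  rw [K.closed i j k]; ring

theorem dirD_dbar_quadForm {v w w' : ι → MvPolynomial κ A} (hv : IsConstVec v)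
    (hw : IsConstVec w) (hw' : IsConstVec w') :
    dirD K.dbar w (quadForm K.h v w') = dirD K.dbar w' (quadForm K.h v w) := by
  simp only [dirD_apply, mapCoeff_quadForm _ _ hv hw, mapCoeff_quadForm _ _ hv hw']
  simp only [quadForm, Finset.mul_sum]
  have : ∀ F : ι → ι → ι → MvPolynomial κ A,
      ∑ k, ∑ i, ∑ j, F k i j = ∑ j, ∑ i, ∑ k, F k i j := fun F => by
    rw [Finset.sum_comm, Finset.sum_congr rfl fun i _ => Finset.sum_comm, Finset.sum_comm]
  rw [this]
  refine Finset.sum_congr rfl fun j _ => Finset.sum_congr rfl fun i _ =>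
    Finset.sum_congr rfl fun k _ => ?_
  rw [K.closed_bar i j k]; ring

/-- Additivity of the Calabi function in the antiholomorphic displacement. -/
theorem calabi_add_right {v w w' : ι → MvPolynomial κ A} (hv : IsConstVec v) (hw : IsConstVec w)
    (hw' : IsConstVec w') :
    K.calabi v (w + w') = K.calabi v w + K.shiftBar w (K.calabi v w') := by
  rw [calabi, quadForm_add_right, dirD_add,
    jop_add (dirD_comm K.dbar_comm hw hw') (dirD_dbar_quadForm hv hw hw'), map_add]
  congr 1
  exact opSeries_comm (dirD_comm K.d_dbar_comm hv hw) _ _ _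

/-- Additivity of the Calabi function in the holomorphic displacement. -/
theorem calabi_add_left {v v' w : ι → MvPolynomial κ A} (hv : IsConstVec v) (hv' : IsConstVec v')
    (hw : IsConstVec w) :
    K.calabi (v + v') w = K.calabi v w + K.shift v (K.calabi v' w) := by
  -- The holomorphic operator has to act first, directly on the quadratic form, before `jop_add` can
  -- be used in the holomorphic displacement.
  have hsymm : ∀ u : ι → MvPolynomial κ A, IsConstVec u → ∀ q,
      jop (dirD K.d u).toLinearMap (jop (dirD K.dbar w).toLinearMap q) =
        jop (dirD K.dbar w).toLinearMap (jop (dirD K.d u).toLinearMap q) :=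
    fun u hu q => opSeries_comm (dirD_comm K.d_dbar_comm hu hw) _ _ _
  rw [calabi, hsymm _ (hv.add hv'), quadForm_add_left, dirD_add,
    jop_add (dirD_comm K.d_comm hv hv') (dirD_d_quadForm hv hv' hw), map_add, ← hsymm _ hv,
    calabi, calabi, hsymm _ hv', shift]
  congr 1
  exact (opSeries_comm (dirD_comm K.d_dbar_comm hv hw) _ _ _).symm

variable (K)

theorem map_tau_dirD (φ : MvPolynomial κ A →ₐ[A] MvPolynomial κ' A)
    (hφ : IsConstVec fun k => φ (X k)) (c : ℕ → ℂ) (d : ι → Derivation ℂ A A)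
    (v : ι → MvPolynomial κ A) (F : PowerSeries (MvPolynomial κ A)) :
    PowerSeries.map (φ : MvPolynomial κ A →+* MvPolynomial κ' A)
        (opSeries c (dirD d v).toLinearMap F) =
      opSeries c (dirD d fun i => φ (v i)).toLinearMap
        (PowerSeries.map (φ : MvPolynomial κ A →+* MvPolynomial κ' A) F) := by
  have hmap : ∀ H, PowerSeries.map (φ : MvPolynomial κ A →+* MvPolynomial κ' A) H =
      coeffMap (φ.restrictScalars ℂ).toLinearMap H := fun H => by ext1 m; simp
  rw [hmap, hmap]
  exact coeffMap_opSeries (L := (φ.restrictScalars ℂ).toLinearMap) (algHom_dirD φ hφ d v) c F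

theorem map_fexp' (φ : MvPolynomial κ A →ₐ[A] MvPolynomial κ' A)
    (F : PowerSeries (MvPolynomial κ A)) :
    PowerSeries.map (φ : MvPolynomial κ A →+* MvPolynomial κ' A) (fexp F) =
      fexp (PowerSeries.map (φ : MvPolynomial κ A →+* MvPolynomial κ' A) F) :=
  map_fexp (φ : MvPolynomial κ A →+* MvPolynomial κ' A) F

theorem map_calabi (φ : MvPolynomial κ A →ₐ[A] MvPolynomial κ' A)
    (hφ : IsConstVec fun k => φ (X k)) (v w : ι → MvPolynomial κ A) :
    PowerSeries.map (φ : MvPolynomial κ A →+* MvPolynomial κ' A) (K.calabi v w) =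
      K.calabi (fun i => φ (v i)) fun i => φ (w i) := by
  rw [calabi, jop, map_tau_dirD φ hφ, jop, map_tau_dirD φ hφ, PowerSeries.map_C, RingHom.coe_coe,
    algHom_quadForm]
  rfl

theorem map_C_C (φ : MvPolynomial κ A →ₐ[A] MvPolynomial κ' A) (a : A) :
    PowerSeries.map (φ : MvPolynomial κ A →+* MvPolynomial κ' A) (PowerSeries.C (C a)) =
      PowerSeries.C (C a) := by
  rw [PowerSeries.map_C, RingHom.coe_coe, ← algebraMap_eq, AlgHom.commutes, algebraMap_eq]

theorem map_shift (φ : MvPolynomial κ A →ₐ[A] MvPolynomial κ' A)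
    (hφ : IsConstVec fun k => φ (X k)) (v : ι → MvPolynomial κ A)
    (F : PowerSeries (MvPolynomial κ A)) :
    PowerSeries.map (φ : MvPolynomial κ A →+* MvPolynomial κ' A) (K.shift v F) =
      K.shift (fun i => φ (v i)) (PowerSeries.map (φ : MvPolynomial κ A →+* MvPolynomial κ' A) F) :=
  map_tau_dirD φ hφ _ _ _ _

theorem map_shiftBar (φ : MvPolynomial κ A →ₐ[A] MvPolynomial κ' A)
    (hφ : IsConstVec fun k => φ (X k)) (v : ι → MvPolynomial κ A)
    (F : PowerSeries (MvPolynomial κ A)) :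
    PowerSeries.map (φ : MvPolynomial κ A →+* MvPolynomial κ' A) (K.shiftBar v F) =
      K.shiftBar (fun i => φ (v i))
        (PowerSeries.map (φ : MvPolynomial κ A →+* MvPolynomial κ' A) F) :=
  map_tau_dirD φ hφ _ _ _ _

/-- The integrand is natural in its formal variables. It can therefore be renamed into inner
variables and transported along `fubiniSubst`. -/
theorem map_weight (φ : MvPolynomial κ A →ₐ[A] MvPolynomial κ' A)
    (hφ : IsConstVec fun k => φ (X k)) (v w : ι → MvPolynomial κ A)
    (F₁ F₂ : PowerSeries (MvPolynomial κ A)) :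
    PowerSeries.map (φ : MvPolynomial κ A →+* MvPolynomial κ' A) (K.weight v w F₁ F₂) =
      K.weight (fun i => φ (v i)) (fun i => φ (w i))
        (PowerSeries.map (φ : MvPolynomial κ A →+* MvPolynomial κ' A) F₁)
        (PowerSeries.map (φ : MvPolynomial κ A →+* MvPolynomial κ' A) F₂) := by
  simp only [weight, map_mul, map_shift _ _ hφ, map_shiftBar _ _ hφ, map_fexp', map_sub,
    map_calabi _ _ hφ, map_C_C]
  rw [PowerSeries.map_C, RingHom.coe_coe, algHom_quadForm]

/-- The formal integral, as a power series in `ε`. -/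
def formalIntegral (F₁ F₂ : PowerSeries A) : PowerSeries A :=
  coeffMap (K.G.restrictScalars ℂ)
    (K.weight (holVar ι A) (antiVar ι A) (PowerSeries.map C F₁) (PowerSeries.map C F₂))

/-- The inner integral in an iterated formal integral. -/
theorem map_C_coeffMap_G (F : PowerSeries (MvPolynomial (ι ⊕ ι) A)) :
    PowerSeries.map (C : A →+* MvPolynomial (ι ⊕ ι) A) (coeffMap (K.G.restrictScalars ℂ) F) =
      coeffMap ((partialInt K.G).restrictScalars ℂ)
        (PowerSeries.map (rename Sum.inl : _ →ₐ[A] MvPolynomial ((ι ⊕ ι) ⊕ (ι ⊕ ι)) A).toRingHom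
          F) := by
  ext m
  simp [partialInt_rename]

theorem coeffMap_partialInt_mul (F : PowerSeries (MvPolynomial ((ι ⊕ ι) ⊕ (ι ⊕ ι)) A))
    (H : PowerSeries (MvPolynomial (ι ⊕ ι) A)) :
    coeffMap ((partialInt K.G).restrictScalars ℂ) F * H =
      coeffMap ((partialInt K.G).restrictScalars ℂ)
        (F * PowerSeries.map
          (rename Sum.inr : _ →ₐ[A] MvPolynomial ((ι ⊕ ι) ⊕ (ι ⊕ ι)) A).toRingHom H) := by
  ext1 m
  simp only [PowerSeries.coeff_mul, coeff_coeffMap, map_sum, PowerSeries.coeff_map,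
    LinearMap.restrictScalars_apply]
  refine Finset.sum_congr rfl fun p _ => ?_
  exact (partialInt_mul_rename K.G _ _).symm

/-- Differentiation under the formal integral sign, for a generic family of derivations. -/
theorem tau_coeffMap_partialInt (d : ι → Derivation ℂ A A)
    (hd : ∀ i p, d i (K.G p) = K.G (mapCoeff (d i) p - p * mapCoeff (d i) K.Q))
    (v : ι → MvPolynomial (ι ⊕ ι) A) (F : PowerSeries (MvPolynomial ((ι ⊕ ι) ⊕ (ι ⊕ ι)) A)) :
    tau (dirD d v).toLinearMap (coeffMap ((partialInt K.G).restrictScalars ℂ) F) =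
      coeffMap ((partialInt K.G).restrictScalars ℂ)
        (tau (dirD d fun i => rename Sum.inr (v i)).toLinearMap F *
          fexp (PowerSeries.C (rename Sum.inl K.Q) -
            tau (dirD d fun i => rename Sum.inr (v i)).toLinearMap
              (PowerSeries.C (rename Sum.inl K.Q)))) := by
  rw [← tau_twisted]
  exact (coeffMap_opSeries (fun P => (dirD_partialInt K.G d K.Q hd v P).symm) _ _).symm

/-- The integrand of the iterated formal integral `(f₁ • f₂) • f₃`. -/
def integrandLeft (f₁ f₂ f₃ : A) : PowerSeries (MvPolynomial ((ι ⊕ ι) ⊕ (ι ⊕ ι)) A) :=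
  K.shiftBar (outerAnti ι A) (K.weight (innerHol ι A) (innerAnti ι A)
      (PowerSeries.C (C f₁)) (PowerSeries.C (C f₂))) *
    fexp (PowerSeries.C (quadForm K.h (innerHol ι A) (innerAnti ι A)) -
      K.shiftBar (outerAnti ι A) (PowerSeries.C (quadForm K.h (innerHol ι A) (innerAnti ι A)))) *
    (K.shift (outerHol ι A) (PowerSeries.C (C f₃)) *
      fexp (PowerSeries.C (quadForm K.h (outerHol ι A) (outerAnti ι A)) -
        K.calabi (outerHol ι A) (outerAnti ι A)) *
      K.shift (outerHol ι A) (K.shiftBar (outerAnti ι A) (PowerSeries.C (C K.det))))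

/-- The integrand of the iterated formal integral `f₁ • (f₂ • f₃)`. -/
def integrandRight (f₁ f₂ f₃ : A) : PowerSeries (MvPolynomial ((ι ⊕ ι) ⊕ (ι ⊕ ι)) A) :=
  K.shift (outerHol ι A) (K.weight (innerHol ι A) (innerAnti ι A)
      (PowerSeries.C (C f₂)) (PowerSeries.C (C f₃))) *
    fexp (PowerSeries.C (quadForm K.h (innerHol ι A) (innerAnti ι A)) -
      K.shift (outerHol ι A) (PowerSeries.C (quadForm K.h (innerHol ι A) (innerAnti ι A)))) *
    (K.shiftBar (outerAnti ι A) (PowerSeries.C (C f₁)) *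
      fexp (PowerSeries.C (quadForm K.h (outerHol ι A) (outerAnti ι A)) -
        K.calabi (outerHol ι A) (outerAnti ι A)) *
      K.shift (outerHol ι A) (K.shiftBar (outerAnti ι A) (PowerSeries.C (C K.det))))

theorem rename_holVar_inl (i : ι) :
    (rename Sum.inl (holVar ι A i) : MvPolynomial ((ι ⊕ ι) ⊕ (ι ⊕ ι)) A) = innerHol ι A i :=
  rename_X _ _
theorem rename_antiVar_inl (i : ι) :
    (rename Sum.inl (antiVar ι A i) : MvPolynomial ((ι ⊕ ι) ⊕ (ι ⊕ ι)) A) = innerAnti ι A i :=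
  rename_X _ _
theorem rename_holVar_inr (i : ι) :
    (rename Sum.inr (holVar ι A i) : MvPolynomial ((ι ⊕ ι) ⊕ (ι ⊕ ι)) A) = outerHol ι A i :=
  rename_X _ _
theorem rename_antiVar_inr (i : ι) :
    (rename Sum.inr (antiVar ι A i) : MvPolynomial ((ι ⊕ ι) ⊕ (ι ⊕ ι)) A) = outerAnti ι A i :=
  rename_X _ _

theorem isConstVec_rename (f : κ → κ') :
    IsConstVec fun k => (rename f : MvPolynomial κ A →ₐ[A] _) (X k) := fun D k =>
  (congrArg (mapCoeff D) (rename_X f k)).trans (mapCoeff_X D _)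

theorem coeffMap_G_partialInt (F : PowerSeries (MvPolynomial ((ι ⊕ ι) ⊕ (ι ⊕ ι)) A)) :
    coeffMap (K.G.restrictScalars ℂ) (coeffMap ((partialInt K.G).restrictScalars ℂ) F) =
      coeffMap (K.G₂.restrictScalars ℂ) F := by
  ext m; simp [G₂]

/-- In the outer integral the inner product occupies the first slot, so it is shifted in `z̄` only.
`tau_coeffMap_partialInt` moves this shift under the inner integral and contributes the second
exponential factor of `integrandLeft`. -/
theorem formalIntegral_left (f₁ f₂ f₃ : A) :
    K.formalIntegral (K.formalIntegral (PowerSeries.C f₁) (PowerSeries.C f₂)) (PowerSeries.C f₃) =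
      coeffMap (K.G₂.restrictScalars ℂ) (K.integrandLeft f₁ f₂ f₃) := by
  have h1 := K.map_weight (rename Sum.inl) (isConstVec_rename (κ' := (ι ⊕ ι) ⊕ (ι ⊕ ι)) Sum.inl)
    (holVar ι A) (antiVar ι A) (PowerSeries.C (C f₁)) (PowerSeries.C (C f₂))
  rw [map_C_C, map_C_C] at h1
  simp only [rename_holVar_inl, rename_antiVar_inl] at h1
  rw [formalIntegral, formalIntegral, map_C_coeffMap_G, weight, shiftBar]
  simp only [PowerSeries.map_C]
  rw [tau_coeffMap_partialInt _ _ K.dbar_G, mul_assoc, mul_assoc, coeffMap_partialInt_mul,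
    coeffMap_G_partialInt, rename_inl_Q]
  refine congrArg _ ?_
  simp only [rename_antiVar_inr]
  rw [integrandLeft]
  refine congrArg₂ (· * ·) (congrArg₂ (· * ·) (congrArg _ h1) rfl) ?_
  · rw [map_mul, map_mul, ← mul_assoc]
    have hφ := isConstVec_rename (A := A) (κ' := (ι ⊕ ι) ⊕ (ι ⊕ ι)) (Sum.inr : ι ⊕ ι → _)
    refine congrArg₂ (· * ·) (congrArg₂ (· * ·) ?_ ?_) ?_
    · exact (K.map_shift _ hφ _ _).trans (by rw [map_C_C]; simp only [rename_holVar_inr])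
    · refine (map_fexp' (rename Sum.inr) _).trans ?_
      rw [map_sub, map_calabi _ _ hφ, PowerSeries.map_C, RingHom.coe_coe, rename_inr_Q]
      simp only [rename_holVar_inr, rename_antiVar_inr]
    · refine (K.map_shift (rename Sum.inr) hφ _ _).trans ?_
      refine (congrArg _ (K.map_shiftBar (rename Sum.inr) hφ _ _)).trans ?_
      rw [map_C_C]
      simp only [rename_holVar_inr, rename_antiVar_inr]

/-- Here the inner product occupies the second slot, so the shift that crosses the inner integral is
the holomorphic one. -/
theorem formalIntegral_right (f₁ f₂ f₃ : A) :
    K.formalIntegral (PowerSeries.C f₁) (K.formalIntegral (PowerSeries.C f₂) (PowerSeries.C f₃)) =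
      coeffMap (K.G₂.restrictScalars ℂ) (K.integrandRight f₁ f₂ f₃) := by
  have h1 := K.map_weight (rename Sum.inl) (isConstVec_rename (κ' := (ι ⊕ ι) ⊕ (ι ⊕ ι)) Sum.inl)
    (holVar ι A) (antiVar ι A) (PowerSeries.C (C f₂)) (PowerSeries.C (C f₃))
  rw [map_C_C, map_C_C] at h1
  simp only [rename_holVar_inl, rename_antiVar_inl] at h1
  rw [formalIntegral, formalIntegral, map_C_coeffMap_G, weight, mul_comm (K.shiftBar _ _),
    shift]
  simp only [PowerSeries.map_C]
  rw [tau_coeffMap_partialInt _ _ K.d_G, mul_assoc, mul_assoc, coeffMap_partialInt_mul,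
    coeffMap_G_partialInt, rename_inl_Q]
  refine congrArg _ ?_
  simp only [rename_holVar_inr]
  rw [integrandRight]
  refine congrArg₂ (· * ·) (congrArg₂ (· * ·) (congrArg _ h1) rfl) ?_
  · rw [map_mul, map_mul, ← mul_assoc]
    have hφ := isConstVec_rename (A := A) (κ' := (ι ⊕ ι) ⊕ (ι ⊕ ι)) (Sum.inr : ι ⊕ ι → _)
    refine congrArg₂ (· * ·) (congrArg₂ (· * ·) ?_ ?_) ?_
    · exact (K.map_shiftBar _ hφ _ _).trans (by rw [map_C_C]; simp only [rename_antiVar_inr])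
    · refine (map_fexp' (rename Sum.inr) _).trans ?_
      rw [map_sub, map_calabi _ _ hφ, PowerSeries.map_C, RingHom.coe_coe, rename_inr_Q]
      simp only [rename_holVar_inr, rename_antiVar_inr]
    · refine (K.map_shift (rename Sum.inr) hφ _ _).trans ?_
      refine (congrArg _ (K.map_shiftBar (rename Sum.inr) hφ _ _)).trans ?_
      rw [map_C_C]
      simp only [rename_holVar_inr, rename_antiVar_inr]

/-- The shifted quadratic forms `s` and `t` cancel within each side, and both total exponents become
`q₁ + q₂ + q₃ - k - s' - t'`. -/
theorem fexp_mul_rearrange {R : Type*} [CommRing R] [Algebra ℂ R]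
    (a₁ a₂ a₃ e e' s s' t t' q₁ q₂ q₃ k : PowerSeries R) :
    a₂ * a₃ * fexp (s - s') * e * fexp (q₁ - s) * (a₁ * fexp (q₂ + q₃ - (k + t')) * e') =
      a₁ * a₂ * fexp (t - t') * e' * fexp (q₃ - t) * (a₃ * fexp (q₂ + q₁ - (k + s')) * e) := by
  have key : fexp (s - s') * fexp (q₁ - s) * fexp (q₂ + q₃ - (k + t')) =
      fexp (t - t') * fexp (q₃ - t) * fexp (q₂ + q₁ - (k + s')) := by
    rw [← fexp_add, ← fexp_add, ← fexp_add, ← fexp_add]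
    refine congrArg fexp ?_
    ring
  linear_combination a₁ * a₂ * a₃ * e * e' * key

/-- The integrands of the two iterated formal integrals agree after a linear substitution. -/
theorem map_integrandRight (f₁ f₂ f₃ : A) :
    PowerSeries.map (fubiniSubst ι A : _ →+* _) (K.integrandRight f₁ f₂ f₃) =
      K.integrandLeft f₁ f₂ f₃ := by
  have hφ := isConstVec_fubiniSubst (ι := ι) (A := A)
  have hc := isConstVec_innerHol (ι := ι) (A := A)
  have hc' := isConstVec_innerAnti (ι := ι) (A := A)
  have hd := isConstVec_outerHol (ι := ι) (A := A)
  have hd' := isConstVec_outerAnti (ι := ι) (A := A)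
  have h3 : (fun i => outerHol ι A i - innerHol ι A i) = outerHol ι A - innerHol ι A := rfl
  have h4 : (fun i => outerAnti ι A i + innerAnti ι A i) = outerAnti ι A + innerAnti ι A := rfl
  have h5 : (fun i => outerAnti ι A i) = outerAnti ι A := rfl
  have h6 : (fun i => innerHol ι A i) = innerHol ι A := rfl
  have hQ : ∀ v w : ι → MvPolynomial ((ι ⊕ ι) ⊕ (ι ⊕ ι)) A,
      PowerSeries.map (fubiniSubst ι A : _ →+* _) (PowerSeries.C (quadForm K.h v w)) =
      PowerSeries.C (quadForm K.h (fun i => fubiniSubst ι A (v i))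
        fun i => fubiniSubst ι A (w i)) := fun v w => by
    rw [PowerSeries.map_C, RingHom.coe_coe, algHom_quadForm]
  rw [integrandRight, integrandLeft]
  simp only [map_mul, map_shift _ _ hφ, map_shiftBar _ _ hφ, map_weight _ _ hφ, map_fexp', map_sub,
    map_calabi _ _ hφ, map_C_C, hQ, fubiniSubst_innerHol, fubiniSubst_innerAnti,
    fubiniSubst_outerHol, fubiniSubst_outerAnti]
  rw [h3, h4, h5, h6]
  simp only [weight, shift_mul, shiftBar_mul, shift_fexp, shiftBar_fexp]
  -- A shift by `a` after one by `b - a` is the shift by `b`, and a shift by `b̄ + ā` splits. The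
  -- arguments of the three functions and of the two determinants now agree on both sides.
  rw [← shift_add hc (hd.sub hc), ← shift_add hc (hd.sub hc), add_sub_cancel,
    shiftBar_add hd' hc', shiftBar_add hd' hc', ← shift_comm hc hd', ← shift_comm hc hd']
  have h7 := calabi_add_left (K := K) hc (hd.sub hc) hd'
  have h8 := quadForm_add_left K.h (innerHol ι A) (outerHol ι A - innerHol ι A) (outerAnti ι A)
  rw [add_sub_cancel] at h7 h8
  -- The cocycle rules express both exponents through the common term `calabi a b̄` and the shifts
  -- of `calabi (b - a) b̄` and `calabi a ā`.
  rw [calabi_add_right hc hd' hc', quadForm_add_right, h7, h8, map_add, map_add]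
  exact fexp_mul_rearrange _ _ _ _ _ _ _ _ _ _ _ _ _

/-- Associativity of the formal integral on functions that do not depend on `ε`. -/
theorem formalIntegral_assoc (f₁ f₂ f₃ : A) :
    K.formalIntegral (K.formalIntegral (PowerSeries.C f₁) (PowerSeries.C f₂)) (PowerSeries.C f₃) =
    K.formalIntegral (PowerSeries.C f₁)
      (K.formalIntegral (PowerSeries.C f₂) (PowerSeries.C f₃)) := by
  rw [formalIntegral_left, formalIntegral_right, ← map_integrandRight]
  ext m
  rw [coeff_coeffMap, coeff_coeffMap, PowerSeries.coeff_map]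
  exact K.G₂_fubiniSubst _

end FormalKahler

end KahlerQuantization

namespace KahlerQuantization

/-! ### Gaussian integrals over `ℂⁿ`: convergence, total mass and integration by parts. -/

section Gaussian

open MvPolynomial MeasureTheory

variable {ι : Type*} [Fintype ι]

/-- The values `(y, ȳ)` of the formal variables at a point `y`. -/
def conjPair (y : ι → ℂ) : ι ⊕ ι → ℂ := Sum.elim y fun i => (starRingEnd ℂ) (y i)

theorem integrable_monomial_gaussian (a b : ℕ) :
    Integrable fun w : ℂ => w ^ a * (starRingEnd ℂ) w ^ b * Complex.exp (-((‖w‖ ^ 2 : ℝ) : ℂ)) := by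
  have h1 : Integrable fun w : ℂ => Complex.exp (-(1 / 2 : ℂ) * (‖w‖ : ℂ) ^ 2) := by
    have := GaussianFourier.integrable_cexp_neg_mul_sq_norm_add (V := ℂ) (b := 1 / 2) (by norm_num)
      0 0
    simpa using this
  -- Half of the Gaussian absorbs the polynomial. The constant comes from `x ^ N / N! ≤ exp x` at `x
  -- = t ^ 2 / 2`, combined with `t ^ N ≤ 1 + (t ^ 2) ^ N`.
  refine (h1.norm.const_mul (1 + 2 ^ (a + b) * ((a + b).factorial : ℝ))).mono' ?_ ?_
  · apply Continuous.aestronglyMeasurable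
    have := Complex.continuous_conj
    fun_prop
  · refine Filter.Eventually.of_forall fun w => ?_
    set t := ‖w‖ with ht
    have ht0 : 0 ≤ t := norm_nonneg w
    have e1 : ‖w ^ a * (starRingEnd ℂ) w ^ b * Complex.exp (-((t ^ 2 : ℝ) : ℂ))‖ =
        t ^ (a + b) * Real.exp (-t ^ 2) := by
      rw [norm_mul, norm_mul, norm_pow, norm_pow, RCLike.norm_conj, ← pow_add, Complex.norm_exp,
        Complex.neg_re, Complex.ofReal_re]
    have e2 : ‖Complex.exp (-(1 / 2 : ℂ) * (t : ℂ) ^ 2)‖ = Real.exp (-(t ^ 2 / 2)) := by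
      rw [Complex.norm_exp]
      congr 1
      have : -(1 / 2 : ℂ) * (t : ℂ) ^ 2 = ((-(t ^ 2 / 2) : ℝ) : ℂ) := by push_cast; ring
      rw [this, Complex.ofReal_re]
    rw [e1, e2]
    set N := a + b
    have h2 := Real.pow_div_factorial_le_exp (x := t ^ 2 / 2) (by positivity) N
    have h3 : t ^ N ≤ 1 + (t ^ 2) ^ N := by
      rw [← pow_mul, mul_comm, pow_mul]
      nlinarith [sq_nonneg (t ^ N - 1)]
    have h4 : (t ^ 2) ^ N = 2 ^ N * N.factorial * ((t ^ 2 / 2) ^ N / N.factorial) := by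
      have : (N.factorial : ℝ) ≠ 0 := Nat.cast_ne_zero.2 N.factorial_ne_zero
      rw [div_pow]
      field_simp
    have h5 : 1 ≤ Real.exp (t ^ 2 / 2) := Real.one_le_exp (by positivity)
    have h6 : t ^ N ≤ (1 + 2 ^ N * N.factorial) * Real.exp (t ^ 2 / 2) := by
      calc t ^ N ≤ 1 + 2 ^ N * N.factorial * ((t ^ 2 / 2) ^ N / N.factorial) := h4 ▸ h3
        _ ≤ Real.exp (t ^ 2 / 2) + 2 ^ N * N.factorial * Real.exp (t ^ 2 / 2) := by gcongr
        _ = _ := by ring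
    calc t ^ N * Real.exp (-t ^ 2)
        ≤ (1 + 2 ^ N * N.factorial) * Real.exp (t ^ 2 / 2) * Real.exp (-t ^ 2) := by gcongr
      _ = _ := by rw [mul_assoc, ← Real.exp_add]; congr 2; ring

theorem integrable_polynomial_standardGaussian (p : MvPolynomial (ι ⊕ ι) ℂ) :
    Integrable fun y : ι → ℂ =>
      eval (conjPair y) p * Complex.exp (-((∑ i, ‖y i‖ ^ 2 : ℝ) : ℂ)) := by
  induction p using MvPolynomial.induction_on' with
  | monomial m a =>
    have hm := fun i : ι => integrable_monomial_gaussian (m (Sum.inl i)) (m (Sum.inr i))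
    have := (Integrable.fintype_prod hm).const_mul a
    refine this.congr (Filter.Eventually.of_forall fun y => ?_)
    simp only [eval_monomial, Finset.prod_mul_distrib]
    rw [Finsupp.prod_fintype _ _ (fun _ => pow_zero _), Fintype.prod_sum_type, ← Complex.exp_sum]
    simp only [conjPair, Sum.elim_inl, Sum.elim_inr, Finset.sum_neg_distrib, Complex.ofReal_sum]
    ring
  | add p q hp hq =>
    refine (hp.add hq).congr (Filter.Eventually.of_forall fun y => ?_)
    simp only [Pi.add_apply, map_add, add_mul]

theorem integral_standardGaussian :
    ∫ y : ι → ℂ, Complex.exp (-((∑ i, ‖y i‖ ^ 2 : ℝ) : ℂ)) =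
      (Real.pi : ℂ) ^ Fintype.card ι := by
  have h1 : ∫ w : ℂ, Complex.exp (-((‖w‖ ^ 2 : ℝ) : ℂ)) = Real.pi := by
    have := GaussianFourier.integral_cexp_neg_mul_sq_norm (V := ℂ) (b := 1) (by norm_num)
    simpa using this
  rw [← h1, ← MeasureTheory.integral_fintype_prod_volume_eq_pow]
  refine integral_congr_ae (Filter.Eventually.of_forall fun y => ?_)
  simp only [← Complex.exp_sum, Finset.sum_neg_distrib, Complex.ofReal_sum]

variable [DecidableEq ι]

/-- Take `M` to be the transpose of the Hermitian square root of `H`; the transpose appears because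
the row index of `H` is paired with the unconjugated `y`. The determinant of the root is real, so
its squared modulus is `det H`. -/
theorem exists_linear_of_posDef {H : Matrix ι ι ℂ} (hH : H.PosDef) :
    ∃ M : Matrix ι ι ℂ, (Complex.normSq M.det : ℂ) = H.det ∧
      ∀ y : ι → ℂ, ∑ i, ∑ j, H i j * y i * (starRingEnd ℂ) (y j) =
        ((∑ i, ‖M.mulVec y i‖ ^ 2 : ℝ) : ℂ) := by
  open scoped MatrixOrder in
  have hB : CFC.sqrt H * CFC.sqrt H = H := CFC.sqrt_mul_sqrt_self H hH.posSemidef.nonneg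
  open scoped MatrixOrder in
  have hBs : (CFC.sqrt H).IsHermitian := (Matrix.nonneg_iff_posSemidef.1 (CFC.sqrt_nonneg H)).isHermitian
  open scoped MatrixOrder in
  set B := CFC.sqrt H with hBdef
  refine ⟨B.transpose, ?_, fun y => ?_⟩
  · have h1 : (starRingEnd ℂ) B.det = B.det := 
      (Matrix.det_conjTranspose B).symm.trans (congrArg Matrix.det hBs.eq)
    rw [Matrix.det_transpose, ← Complex.mul_conj, h1, ← hB, Matrix.det_mul]
  · have h2 : ∀ i j, H i j = ∑ k, B i k * (starRingEnd ℂ) (B j k) := by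
      intro i j
      conv_lhs => rw [← hB]
      rw [Matrix.mul_apply]
      refine Finset.sum_congr rfl fun k _ => ?_
      congr 1
      rw [← hBs.apply k j]; rfl
    have h3 : ∀ k, ((‖B.transpose.mulVec y k‖ ^ 2 : ℝ) : ℂ) =
        (∑ i, B i k * y i) * ∑ j, (starRingEnd ℂ) (B j k) * (starRingEnd ℂ) (y j) := by
      intro k
      have : B.transpose.mulVec y k = ∑ i, B i k * y i := rfl
      rw [this, Complex.ofReal_pow, ← Complex.mul_conj', map_sum]
      simp only [map_mul]
    rw [Complex.ofReal_sum, Finset.sum_congr rfl fun k _ => h3 k]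
    simp only [h2, Finset.sum_mul, Finset.mul_sum]
    have : ∀ F : ι → ι → ι → ℂ,
        ∑ i, ∑ j, ∑ k, F i j k = ∑ k, ∑ j, ∑ i, F i j k := fun F => by
      rw [Finset.sum_comm, Finset.sum_congr rfl fun i _ => Finset.sum_comm, Finset.sum_comm]
    rw [this]
    refine Finset.sum_congr rfl fun k _ => ?_
    refine Finset.sum_congr rfl fun i _ => Finset.sum_congr rfl fun j _ => ?_
    ring

/-- The real determinant of a complex linear map is the norm from `ℂ` to `ℝ` of its complex
determinant. -/
theorem map_mulVec_volume {M : Matrix ι ι ℂ} (hM : M.det ≠ 0) :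
    Measure.map M.mulVec volume =
      ENNReal.ofReal (Complex.normSq M.det)⁻¹ • (volume : Measure (ι → ℂ)) := by
  have hdet : LinearMap.det ((Matrix.toLin' M).restrictScalars ℝ) = Complex.normSq M.det := by
    rw [LinearMap.det_restrictScalars, LinearMap.det_toLin', Algebra.norm_complex_apply]
  have h0 : Complex.normSq M.det ≠ 0 := by simpa using hM
  have := Measure.map_linearMap_addHaar_eq_smul_addHaar (volume : Measure (ι → ℂ))
    (f := (Matrix.toLin' M).restrictScalars ℝ) (by rwa [hdet])
  rw [hdet, abs_of_nonneg (inv_nonneg.2 (Complex.normSq_nonneg _))] at this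
  exact this

theorem integrable_polynomial_gaussian {H : Matrix ι ι ℂ} (hH : H.PosDef)
    (p : MvPolynomial (ι ⊕ ι) ℂ) :
    Integrable fun y : ι → ℂ => eval (conjPair y) p *
      Complex.exp (-∑ i, ∑ j, H i j * y i * (starRingEnd ℂ) (y j)) := by
  obtain ⟨M, hMdet, hM⟩ := exists_linear_of_posDef hH
  have hM0 : M.det ≠ 0 := by
    intro h
    rw [h, map_zero, Complex.ofReal_zero] at hMdet
    exact hH.det_pos.ne hMdet
  have hunit : IsUnit M.det := isUnit_iff_ne_zero.2 hM0
  have hinv : ∀ y, M⁻¹.mulVec (M.mulVec y) = y := fun y => by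
    rw [Matrix.mulVec_mulVec, Matrix.nonsing_inv_mul _ hunit, Matrix.one_mulVec]
  have hcont : Continuous M.mulVec := continuous_const.matrix_mulVec continuous_id
  -- The polynomial `p` written in the coordinates `x = M y`; the variables `ȳ` transform with
  -- conjugated coefficients.
  let p' : MvPolynomial (ι ⊕ ι) ℂ := aeval (Sum.elim
    (fun i => ∑ j, C (M⁻¹ i j) * X (Sum.inl j))
    fun i => ∑ j, C ((starRingEnd ℂ) (M⁻¹ i j)) * X (Sum.inr j)) p
  have hp' : ∀ x, eval (conjPair x) p' = eval (conjPair (M⁻¹.mulVec x)) p := by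
    intro x
    have : ∀ k, eval (conjPair x) (Sum.elim
      (fun i => ∑ j, C (M⁻¹ i j) * X (Sum.inl j))
      (fun i => ∑ j, C ((starRingEnd ℂ) (M⁻¹ i j)) * X (Sum.inr j)) k :
        MvPolynomial (ι ⊕ ι) ℂ) = conjPair (M⁻¹.mulVec x) k := by
      rintro (k | k) <;> simp [conjPair, Matrix.mulVec, dotProduct]
    simp only [p']
    induction p using MvPolynomial.induction_on with
    | C a => simp
    | add p q hp hq => rw [map_add, map_add, map_add, hp, hq]
    | mul_X p k hp => rw [map_mul, map_mul, map_mul, hp, aeval_X, this, eval_X]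
  have h1 : Integrable (fun x : ι → ℂ =>
      eval (conjPair x) p' * Complex.exp (-((∑ i, ‖x i‖ ^ 2 : ℝ) : ℂ)))
      (Measure.map M.mulVec volume) := by
    rw [map_mulVec_volume hM0]
    exact (integrable_polynomial_standardGaussian p').smul_measure ENNReal.ofReal_ne_top
  have h2 := h1.comp_aemeasurable hcont.aemeasurable
  refine h2.congr (Filter.Eventually.of_forall fun y => ?_)
  simp only [Function.comp_apply, hp', hinv, hM]

theorem integral_gaussian_posDef {H : Matrix ι ι ℂ} (hH : H.PosDef) :
    ∫ y : ι → ℂ, Complex.exp (-∑ i, ∑ j, H i j * y i * (starRingEnd ℂ) (y j)) =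
      (Real.pi : ℂ) ^ Fintype.card ι * H.det⁻¹ := by
  obtain ⟨M, hMdet, hM⟩ := exists_linear_of_posDef hH
  have hM0 : M.det ≠ 0 := by
    intro h
    rw [h, map_zero, Complex.ofReal_zero] at hMdet
    exact hH.det_pos.ne hMdet
  have hcont : Continuous M.mulVec := continuous_const.matrix_mulVec continuous_id
  have h1 := integral_map (μ := (volume : Measure (ι → ℂ))) hcont.aemeasurable
    (f := fun x : ι → ℂ => Complex.exp (-((∑ i, ‖x i‖ ^ 2 : ℝ) : ℂ)))
    (Continuous.aestronglyMeasurable (by fun_prop))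
  rw [map_mulVec_volume hM0, integral_smul_measure, integral_standardGaussian] at h1
  simp only [hM]
  rw [← h1, ENNReal.toReal_ofReal (inv_nonneg.2 (Complex.normSq_nonneg _)), ← hMdet,
    Complex.real_smul, mul_comm, Complex.ofReal_inv]

theorem hasDerivAt_eval_conjPair (p : MvPolynomial (ι ⊕ ι) ℂ) (y w : ι → ℂ) :
    HasDerivAt (fun t : ℝ => eval (conjPair (y + t • w)) p)
      (∑ k, conjPair w k * eval (conjPair y) (pderiv k p)) 0 := by
  have hX : ∀ k, HasDerivAt (fun t : ℝ => conjPair (y + t • w) k) (conjPair w k) 0 := by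
    have h1 : ∀ k, (fun t : ℝ => conjPair (y + t • w) k) =
        fun t : ℝ => conjPair y k + (t : ℂ) * conjPair w k := by
      rintro (k | k) <;> funext t <;> simp [conjPair]
    intro k
    rw [h1]
    simpa using ((Complex.ofRealCLM.hasDerivAt (x := 0)).mul_const (conjPair w k)).const_add
      (conjPair y k)
  induction p using MvPolynomial.induction_on with
  | C a => simpa using hasDerivAt_const (0 : ℝ) a
  | add p q hp hq =>
    simpa only [map_add, mul_add, Finset.sum_add_distrib] using hp.fun_add hq
  | mul_X p k hp =>
    have h2 := hp.fun_mul (hX k)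
    simp only [zero_smul, add_zero] at h2
    have h3 : (∑ l, conjPair w l * eval (conjPair y) (pderiv l (p * X k))) =
        (∑ l, conjPair w l * eval (conjPair y) (pderiv l p)) * conjPair y k +
          eval (conjPair y) p * conjPair w k := by
      simp only [Derivation.leibniz, pderiv_X, Pi.single_apply, smul_eq_mul, map_add, map_mul,
        eval_X, mul_add, Finset.sum_add_distrib, mul_ite, mul_one, mul_zero, apply_ite (eval _),
        map_zero, Finset.sum_mul]
      rw [add_comm]
      congr 1
      · exact Finset.sum_congr rfl fun l _ => by ring
      · simp [mul_comm]
    rw [h3]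
    simpa only [map_mul, eval_X] using h2

/-- The integral of a polynomial against the Gaussian of a Hermitian matrix. -/
def gaussianIntegral (H : Matrix ι ι ℂ) (p : MvPolynomial (ι ⊕ ι) ℂ) : ℂ :=
  ∫ y : ι → ℂ, eval (conjPair y) p *
    Complex.exp (-∑ i, ∑ j, H i j * y i * (starRingEnd ℂ) (y j))

theorem gaussianIntegral_add {H : Matrix ι ι ℂ} (hH : H.PosDef) (p q : MvPolynomial (ι ⊕ ι) ℂ) :
    gaussianIntegral H (p + q) = gaussianIntegral H p + gaussianIntegral H q := by
  rw [gaussianIntegral, gaussianIntegral, gaussianIntegral,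
    ← integral_add (integrable_polynomial_gaussian hH p) (integrable_polynomial_gaussian hH q)]
  simp only [map_add, add_mul]

theorem gaussianIntegral_C_mul (H : Matrix ι ι ℂ) (a : ℂ) (p : MvPolynomial (ι ⊕ ι) ℂ) :
    gaussianIntegral H (C a * p) = a * gaussianIntegral H p := by
  rw [gaussianIntegral, gaussianIntegral, ← integral_const_mul]
  simp only [map_mul, eval_C, mul_assoc]

theorem eval_quadForm (H : Matrix ι ι ℂ) (y : ι → ℂ) :
    eval (conjPair y) (quadForm H (holVar ι ℂ) (antiVar ι ℂ)) =
      ∑ i, ∑ j, H i j * y i * (starRingEnd ℂ) (y j) := by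
  simp [quadForm, holVar, antiVar, conjPair]

/-- The integrand is a derivative in the real direction `w` of an integrable function, so its
integral vanishes. It is obtained by integrating by parts against the constant function `1`. -/
theorem gaussianIntegral_directional {H : Matrix ι ι ℂ} (hH : H.PosDef) (w : ι → ℂ)
    (p : MvPolynomial (ι ⊕ ι) ℂ) :
    gaussianIntegral H (∑ k, C (conjPair w k) *
      (pderiv k p - p * pderiv k (quadForm H (holVar ι ℂ) (antiVar ι ℂ)))) = 0 := by
  set Q := quadForm H (holVar ι ℂ) (antiVar ι ℂ) with hQ
  set q := ∑ k, C (conjPair w k) * (pderiv k p - p * pderiv k Q) with hq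
  have hderiv : ∀ y : ι → ℂ, HasLineDerivAt ℝ (fun y => eval (conjPair y) p *
      Complex.exp (-∑ i, ∑ j, H i j * y i * (starRingEnd ℂ) (y j)))
      (eval (conjPair y) q * Complex.exp (-∑ i, ∑ j, H i j * y i * (starRingEnd ℂ) (y j))) y w := by
    intro y
    simp only [← eval_quadForm]
    have h1 := hasDerivAt_eval_conjPair p y w
    have h2 := (hasDerivAt_eval_conjPair Q y w).fun_neg.cexp
    have h3 := h1.fun_mul h2
    simp only [zero_smul, add_zero] at h3
    refine HasDerivAt.congr_deriv h3 ?_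
    rw [hq, map_sum]
    simp only [map_mul, map_sub, eval_C, mul_sub, Finset.sum_sub_distrib, sub_mul, ← hQ]
    rw [Finset.sum_congr rfl fun k _ => mul_left_comm (conjPair w k) (eval (conjPair y) p) _,
      ← Finset.mul_sum]
    ring
  have h1 := integrable_polynomial_gaussian hH p
  have h2 := integrable_polynomial_gaussian hH q
  have := integral_bilinear_hasLineDerivAt_right_eq_neg_left_of_integrable
    (μ := (volume : Measure (ι → ℂ))) (B := ContinuousLinearMap.lsmul ℝ ℝ)
    (f := fun _ => (1 : ℝ)) (f' := fun _ => 0) (v := w) (by simp) (by simpa using h2)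
    (by simpa using h1)
    (fun y _ => by simpa [HasLineDerivAt] using hasDerivAt_const (0 : ℝ) (1 : ℝ))
    (fun y _ => hderiv y)
  simpa [gaussianIntegral] using this

/-- Integration by parts for the Gaussian of a positive definite Hermitian matrix. -/
theorem gaussianIntegral_pderiv {H : Matrix ι ι ℂ} (hH : H.PosDef) (k : ι ⊕ ι)
    (p : MvPolynomial (ι ⊕ ι) ℂ) :
    gaussianIntegral H (pderiv k p) =
      gaussianIntegral H (p * pderiv k (quadForm H (holVar ι ℂ) (antiVar ι ℂ))) := by
  set Q := quadForm H (holVar ι ℂ) (antiVar ι ℂ) with hQ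
  have hG0 : gaussianIntegral H 0 = 0 := by simp [gaussianIntegral]
  have hsub : ∀ p q, gaussianIntegral H (p - q) = gaussianIntegral H p - gaussianIntegral H q := by
    intro p q
    have := gaussianIntegral_add hH (p - q) q
    rw [sub_add_cancel] at this
    rw [this]; ring
  -- A real direction couples the derivatives in `yⁱ` and `ȳⁱ`. The choices `c = 1` and `c = √-1`
  -- separate them.
  have hdir : ∀ (i : ι) (c : ℂ), c * gaussianIntegral H (pderiv (Sum.inl i) p - p * pderiv (Sum.inl i) Q) +
      (starRingEnd ℂ) c * gaussianIntegral H (pderiv (Sum.inr i) p - p * pderiv (Sum.inr i) Q) = 0 := by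
    intro i c
    have h := gaussianIntegral_directional hH (Pi.single i c) p
    rw [Fintype.sum_sum_type, gaussianIntegral_add hH,
      Finset.sum_eq_single i (by intro j _ hj; simp [conjPair, hj]) (by simp),
      Finset.sum_eq_single i (by intro j _ hj; simp [conjPair, hj]) (by simp),
      gaussianIntegral_C_mul, gaussianIntegral_C_mul] at h
    simpa [conjPair] using h
  rw [← sub_eq_zero, ← hsub]
  rcases k with i | i
  · have h1 := hdir i 1
    have h2 := hdir i Complex.I
    simp only [map_one, Complex.conj_I] at h1 h2
    linear_combination (1 / 2) * h1 - (Complex.I / 2) * h2 + (1 / 2) * (gaussianIntegral H (pderiv (Sum.inl i) p - p * pderiv (Sum.inl i) Q) - gaussianIntegral H (pderiv (Sum.inr i) p - p * pderiv (Sum.inr i) Q)) * Complex.I_mul_I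
  · have h1 := hdir i 1
    have h2 := hdir i Complex.I
    simp only [map_one, Complex.conj_I] at h1 h2
    linear_combination (1 / 2) * h1 + (Complex.I / 2) * h2 - (1 / 2) * (gaussianIntegral H (pderiv (Sum.inl i) p - p * pderiv (Sum.inl i) Q) - gaussianIntegral H (pderiv (Sum.inr i) p - p * pderiv (Sum.inr i) Q)) * Complex.I_mul_I

end Gaussian

end KahlerQuantization

namespace KahlerQuantization

/-! ### Jacobi's formula and differentiation of Gaussian functionals. -/

section Jacobi

variable {ι A : Type*} [Fintype ι] [DecidableEq ι] [CommRing A] [Algebra ℂ A]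

theorem derivation_prod (D : Derivation ℂ A A) (s : Finset ι) (f : ι → A) :
    D (∏ i ∈ s, f i) = ∑ i ∈ s, (∏ j ∈ s.erase i, f j) * D (f i) := by
  induction s using Finset.induction_on with
  | empty => simp
  | insert a s ha ih =>
    rw [Finset.prod_insert ha, Derivation.leibniz, ih, Finset.sum_insert ha,
      Finset.erase_insert ha, smul_eq_mul, smul_eq_mul, add_comm, Finset.mul_sum]
    congr 1
    refine Finset.sum_congr rfl fun i hi => ?_
    have hia : i ≠ a := fun h => ha (h ▸ hi)
    rw [Finset.erase_insert_of_ne hia.symm, Finset.prod_insert (fun h => ha (Finset.mem_of_mem_erase h)),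
      mul_assoc]

/-- Jacobi's formula for the derivative of a determinant. -/
theorem derivation_det (D : Derivation ℂ A A) (M : Matrix ι ι A) :
    D M.det = ∑ i, ∑ j, M.adjugate j i * D (M i j) := by
  -- By Cramer's rule the inner sum is the determinant with column `j` differentiated, which matches
  -- the Leibniz rule on the permutation expansion.
  have h1 : ∀ j, ∑ i, M.adjugate j i * D (M i j) = (M.updateCol j fun i => D (M i j)).det := by
    intro j
    rw [← Matrix.cramer_apply, Matrix.cramer_eq_adjugate_mulVec]
    rfl
  rw [Finset.sum_comm, Finset.sum_congr rfl fun j _ => h1 j]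
  simp only [Matrix.det_apply]
  rw [map_sum, Finset.sum_comm]
  refine Finset.sum_congr rfl fun σ _ => ?_
  rw [← Finset.smul_sum]
  have h2 : D (Equiv.Perm.sign σ • ∏ i, M (σ i) i) =
      Equiv.Perm.sign σ • D (∏ i, M (σ i) i) := by
    rcases Int.units_eq_one_or (Equiv.Perm.sign σ) with h | h <;> simp [h]
  rw [h2, derivation_prod]
  congr 1
  refine Finset.sum_congr rfl fun j _ => ?_
  rw [← Finset.prod_erase_mul _ _ (Finset.mem_univ j), Matrix.updateCol_self]
  congr 1
  refine Finset.prod_congr rfl fun i hi => ?_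
  rw [Matrix.updateCol_ne (Finset.ne_of_mem_erase hi)]

open MvPolynomial

/-- Differentiation under the integral sign follows from integration by parts and Jacobi's
formula. -/
theorem derivation_gaussian {h hinv : ι → ι → A} {δ : A} (hδ : IsUnit δ)
    (h_mul_hinv : ∀ k i, ∑ j, h k j * hinv i j = if k = i then 1 else 0)
    (hinv_mul_h : ∀ k j, ∑ i, hinv i k * h i j = if k = j then 1 else 0)
    (G : MvPolynomial (ι ⊕ ι) A →ₗ[A] A)
    (hG : ∀ k p, G (pderiv k p) = G (p * pderiv k (quadForm h (holVar ι A) (antiVar ι A))))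
    (hG1 : G (C δ) = 1) (D : Derivation ℂ A A)
    (hD : D δ = δ * ∑ i, ∑ j, hinv i j * D (h i j)) (p : MvPolynomial (ι ⊕ ι) A) :
    D (G p) = G (mapCoeff D p - p * mapCoeff D (quadForm h (holVar ι A) (antiVar ι A))) := by
  set Q := quadForm h (holVar ι A) (antiVar ι A) with hQ
  have hC : ∀ (a : A) (p : MvPolynomial (ι ⊕ ι) A), G (C a * p) = a * G p := fun a p => by
    rw [← smul_eq_C_mul, map_smul, smul_eq_mul]
  -- The defect of the claimed formula. It is linear over `A`, although neither term is, because the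
  -- contributions of `D a` cancel; hence `gaussian_eq` can compare it with `0`.
  let L : MvPolynomial (ι ⊕ ι) A →ₗ[A] A :=
    { toFun := fun p => D (G p) - G (mapCoeff D p - p * mapCoeff D Q)
      map_add' := fun p q => by
        simp only [map_add, map_sub, add_mul]; ring
      map_smul' := fun a p => by
        simp only [RingHom.id_apply, smul_eq_C_mul, hC, Derivation.leibniz, mapCoeff_C, smul_eq_mul,
          map_sub, map_add, mul_assoc]
        rw [mul_comm p (C (D a)), hC]
        ring }
  have hX := X_eq_sum_covMatrix h_mul_hinv hinv_mul_h
  have hL : L = 0 := by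
    refine gaussian_eq Q (covMatrix hinv) hX (fun k p => ?_) (fun _ _ => by simp) ?_
    · change D (G (pderiv k p)) - G (mapCoeff D (pderiv k p) - pderiv k p * mapCoeff D Q) =
        D (G (p * pderiv k Q)) -
          G (mapCoeff D (p * pderiv k Q) - p * pderiv k Q * mapCoeff D Q)
      have h1 := hG k (mapCoeff D p)
      have h2 := hG k (p * mapCoeff D Q)
      rw [hG, mapCoeff_pderiv, Derivation.leibniz, mapCoeff_pderiv]
      rw [Derivation.leibniz] at h2
      simp only [smul_eq_mul, map_sub, map_add] at h1 h2 ⊢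
      rw [mul_comm (pderiv k Q) (mapCoeff D p), mul_comm (pderiv k p) (mapCoeff D Q),
        mul_right_comm p (pderiv k Q)]
      linear_combination h2 - h1
    -- At `1` the claim concerns `G 1`, the inverse of `δ`. The second moments turn `G (D Q)` into
    -- `tr (h⁻¹ D h) * G 1`, and Jacobi's formula says that this trace is `D δ / δ`.
    · have hy : ∀ i j, G (X (Sum.inl i) * X (Sum.inr j)) = hinv i j * G 1 := by
        intro i j
        rw [hX (Sum.inl i), Finset.sum_mul, map_sum, Fintype.sum_sum_type]
        simp only [covMatrix, map_zero, zero_mul, Finset.sum_const_zero, zero_add, mul_assoc, hC]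
        rw [Finset.sum_eq_single j]
        · rw [mul_comm (pderiv _ _), ← hG, pderiv_X_self]
        · intro k _ hk
          rw [mul_comm (pderiv _ _), ← hG, pderiv_X_of_ne (by simpa using hk.symm), map_zero,
            mul_zero]
        · simp
      have h1 : G (mapCoeff D Q) = (∑ i, ∑ j, hinv i j * D (h i j)) * G 1 := by
        rw [hQ, mapCoeff_quadForm _ _ isConstVec_holVar isConstVec_antiVar, quadForm]
        simp only [map_sum, mul_assoc, hC, holVar, antiVar, hy, Finset.sum_mul]
        refine Finset.sum_congr rfl fun i _ => Finset.sum_congr rfl fun j _ => by ring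
      have h2 : δ * G 1 = 1 := by rw [← hC, mul_one, hG1]
      have h3 := congrArg D h2
      rw [Derivation.leibniz, hD, smul_eq_mul, smul_eq_mul, Derivation.map_one_eq_zero] at h3
      change D (G 1) - G (mapCoeff D 1 - 1 * mapCoeff D Q) = 0
      rw [Derivation.map_one_eq_zero, zero_sub, one_mul, map_neg, h1, ← hδ.mul_right_eq_zero]
      linear_combination h3
  exact sub_eq_zero.1 (DFunLike.congr_fun hL p)

end Jacobi

/-! ### Smooth functions on `ℂⁿ` as an instance of the algebraic model. -/

section Obs

variable {n : ℕ}

/-- The directional derivative as a derivation. -/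
def dirDerivation (w : Fin n → ℂ) : Derivation ℂ (Obs n) (Obs n) :=
  have hd : ∀ (f : Obs n) z, DifferentiableAt ℝ f.1 z := fun f z =>
    (contDiff_obs f).differentiable (by simp) z
  Derivation.mk'
    { toFun := dirDeriv w
      map_add' := fun f g => by
        ext z
        exact congrArg (fun L => L w) (fderiv_add (hd f z) (hd g z))
      map_smul' := fun c f => by
        ext z
        exact congrArg (fun L => L w) (fderiv_const_smul (hd f z) c) }
    (fun f g => by
      ext z
      have := congrArg (fun L => L w) (fderiv_mul (hd f z) (hd g z))
      exact this)

theorem dirDeriv_comm (v w : Fin n → ℂ) (f : Obs n) :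
    dirDeriv v (dirDeriv w f) = dirDeriv w (dirDeriv v f) := by
  ext z
  have h1 : ∀ u : Fin n → ℂ, ∀ u', fderiv ℝ (fun z => fderiv ℝ f.1 z u) z u' =
      fderiv ℝ (fderiv ℝ f.1) z u' u := by
    intro u u'
    have hd : DifferentiableAt ℝ (fderiv ℝ f.1) z :=
      ((contDiff_obs f).fderiv_right (m := ∞) le_rfl).differentiable (by simp) z
    rw [fderiv_clm_apply hd (differentiableAt_const u)]
    simp
  have h2 : IsSymmSndFDerivAt ℝ f.1 z :=
    (contDiff_infty.1 (contDiff_obs f) 2).contDiffAt.isSymmSndFDerivAt (by simp)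
  change fderiv ℝ (fun z => fderiv ℝ f.1 z w) z v = fderiv ℝ (fun z => fderiv ℝ f.1 z v) z w
  rw [h1, h1]
  exact h2 v w

/-- The Wirtinger derivative `∂ᵢ` as a derivation. -/
def dzDer (i : Fin n) : Derivation ℂ (Obs n) (Obs n) :=
  (1 / 2 : ℂ) • (dirDerivation (Pi.single i 1) -
    Complex.I • dirDerivation (Pi.single i Complex.I))

/-- The Wirtinger derivative `∂̄ᵢ` as a derivation. -/
def dzbarDer (i : Fin n) : Derivation ℂ (Obs n) (Obs n) :=
  (1 / 2 : ℂ) • (dirDerivation (Pi.single i 1) +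
    Complex.I • dirDerivation (Pi.single i Complex.I))

theorem dirDerivation_comm (v w : Fin n → ℂ) (f : Obs n) :
    dirDerivation v (dirDerivation w f) = dirDerivation w (dirDerivation v f) :=
  dirDeriv_comm v w f

theorem dzDer_comm (i j : Fin n) (f : Obs n) : dzDer i (dzDer j f) = dzDer j (dzDer i f) := by
  simp only [dzDer, Derivation.smul_apply, Derivation.sub_apply, map_sub, Derivation.map_smul,
    dirDerivation_comm (Pi.single i _) (Pi.single j _)]
  module

theorem dzbarDer_comm (i j : Fin n) (f : Obs n) :
    dzbarDer i (dzbarDer j f) = dzbarDer j (dzbarDer i f) := by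
  simp only [dzbarDer, Derivation.smul_apply, Derivation.add_apply, map_add, Derivation.map_smul,
    dirDerivation_comm (Pi.single i _) (Pi.single j _)]
  module

theorem dzDer_dzbarDer_comm (i j : Fin n) (f : Obs n) :
    dzDer i (dzbarDer j f) = dzbarDer j (dzDer i f) := by
  simp only [dzDer, dzbarDer, Derivation.smul_apply, Derivation.add_apply, Derivation.sub_apply,
    map_add, map_sub, Derivation.map_smul, dirDerivation_comm (Pi.single i _) (Pi.single j _)]
  module

theorem conjObs_apply (f : Obs n) (z : Fin n → ℂ) : (conjObs f).1 z = (starRingEnd ℂ) (f.1 z) := rfl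

theorem conjObs_conjObs (f : Obs n) : conjObs (conjObs f) = f := by
  ext z; simp [conjObs_apply]

theorem dirDeriv_conjObs (w : Fin n → ℂ) (f : Obs n) :
    dirDeriv w (conjObs f) = conjObs (dirDeriv w f) := by
  ext z
  change fderiv ℝ (fun z => Complex.conjCLE (f.1 z)) z w = Complex.conjCLE (fderiv ℝ f.1 z w)
  have := Complex.conjCLE.comp_fderiv (f := f.1) (x := z)
  exact congrArg (fun L => L w) this

theorem dz_conjObs (i : Fin n) (f : Obs n) : dz i (conjObs f) = conjObs (dzbar i f) := by
  ext z
  have h1 := congrArg (fun a : Obs n => a.1 z) (dirDeriv_conjObs (Pi.single i 1) f)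
  have h2 := congrArg (fun a : Obs n => a.1 z) (dirDeriv_conjObs (Pi.single i Complex.I) f)
  change (1 / 2 : ℂ) * ((dirDeriv (Pi.single i 1) (conjObs f)).1 z -
    Complex.I * (dirDeriv (Pi.single i Complex.I) (conjObs f)).1 z) =
    (starRingEnd ℂ) ((1 / 2 : ℂ) * ((dirDeriv (Pi.single i 1) f).1 z +
      Complex.I * (dirDeriv (Pi.single i Complex.I) f).1 z))
  rw [h1, h2, conjObs_apply, conjObs_apply]
  simp only [map_mul, map_add, Complex.conj_I, map_div₀, map_one, map_ofNat]
  ring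

theorem dzbar_conjObs (i : Fin n) (f : Obs n) : dzbar i (conjObs f) = conjObs (dz i f) := by
  have := dz_conjObs i (conjObs f)
  rw [conjObs_conjObs] at this
  rw [this, conjObs_conjObs]

theorem KahlerMetric.conjObs_h (g : KahlerMetric n) (i j : Fin n) :
    conjObs (g.h i j) = g.h j i := by
  ext z
  exact (g.posDef z).isHermitian.apply j i

/-- Conjugate the closedness condition, using that `H` is Hermitian. -/
theorem KahlerMetric.closed_bar (g : KahlerMetric n) (i j k : Fin n) :
    dzbar k (g.h i j) = dzbar j (g.h i k) := by
  rw [← g.conjObs_h j i, ← g.conjObs_h k i, dzbar_conjObs, dzbar_conjObs, g.closed]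

theorem KahlerMetric.h_mul_inv (g : KahlerMetric n) (k i : Fin n) :
    ∑ j, g.h k j * g.inv i j = if k = i then 1 else 0 := by
  have := congrFun (congrFun (Matrix.mul_nonsing_inv g.h g.isUnit_det) k) i
  rwa [Matrix.mul_apply, Matrix.one_apply] at this

theorem KahlerMetric.inv_mul_h (g : KahlerMetric n) (k j : Fin n) :
    ∑ i, g.inv i k * g.h i j = if k = j then 1 else 0 := by
  have := congrFun (congrFun (Matrix.nonsing_inv_mul g.h g.isUnit_det) k) j
  rwa [Matrix.mul_apply, Matrix.one_apply] at this

theorem KahlerMetric.derivation_det_h (g : KahlerMetric n) (D : Derivation ℂ (Obs n) (Obs n)) :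
    D g.h.det = g.h.det * ∑ i, ∑ j, g.inv i j * D (g.h i j) := by
  rw [derivation_det]
  simp only [Finset.mul_sum]
  refine Finset.sum_congr rfl fun i _ => Finset.sum_congr rfl fun j _ => ?_
  have : g.h.adjugate j i = g.h.det * g.inv i j := by
    rw [KahlerMetric.inv, Matrix.inv_def, Matrix.smul_apply, smul_eq_mul, ← mul_assoc,
      Ring.mul_inverse_cancel _ g.isUnit_det, one_mul]
  rw [this, mul_assoc]

/-- Evaluation of smooth functions at a point. -/
def evalAt (z : Fin n → ℂ) : Obs n →ₐ[ℂ] ℂ :=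
  (Pi.evalAlgHom ℂ (fun _ => ℂ) z).comp (smoothFunctions n).val

theorem evalAt_apply (z : Fin n → ℂ) (f : Obs n) : evalAt z f = f.1 z := rfl

namespace KahlerMetric

open MvPolynomial

variable (g : KahlerMetric n)

/-- The Gaussian integral of a polynomial with smooth coefficients, as a function. -/
def gaussianFun : MvPolynomial (Fin n ⊕ Fin n) (Obs n) →ₗ[Obs n] ((Fin n → ℂ) → ℂ) where
  toFun p z := ((Real.pi : ℂ) ^ n)⁻¹ * gaussianIntegral (g.h.map fun f => f.1 z)
    (map (evalAt z : Obs n →+* ℂ) p)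
  map_add' p q := by
    funext z
    rw [map_add, gaussianIntegral_add (g.posDef z), mul_add]; rfl
  map_smul' a p := by
    funext z
    rw [smul_eq_C_mul, map_mul, map_C, gaussianIntegral_C_mul, mul_left_comm]; rfl

theorem map_evalAt_quadForm (z : Fin n → ℂ) :
    map (evalAt z : Obs n →+* ℂ) (quadForm g.h (holVar (Fin n) (Obs n)) (antiVar (Fin n) (Obs n))) =
      quadForm (g.h.map fun f => f.1 z) (holVar (Fin n) ℂ) (antiVar (Fin n) ℂ) := by
  simp [quadForm, holVar, antiVar, evalAt_apply]

theorem gaussianFun_pderiv (k : Fin n ⊕ Fin n) (p : MvPolynomial (Fin n ⊕ Fin n) (Obs n)) :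
    g.gaussianFun (pderiv k p) = g.gaussianFun
      (p * pderiv k (quadForm g.h (holVar (Fin n) (Obs n)) (antiVar (Fin n) (Obs n)))) := by
  funext z
  change _ * gaussianIntegral _ _ = _ * gaussianIntegral _ _
  rw [← pderiv_map, map_mul, ← pderiv_map, gaussianIntegral_pderiv (g.posDef z),
    map_evalAt_quadForm]

theorem det_apply (z : Fin n → ℂ) : g.h.det.1 z = (g.h.map fun f => f.1 z).det :=
  RingHom.map_det (evalAt z : Obs n →+* ℂ) g.h

theorem gaussianFun_det : g.gaussianFun (C g.h.det) = 1 := by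
  funext z
  have h1 : gaussianIntegral (g.h.map fun f => f.1 z) 1 =
      (Real.pi : ℂ) ^ n * (g.h.map fun f => f.1 z).det⁻¹ := by
    have := integral_gaussian_posDef (g.posDef z)
    rw [Fintype.card_fin] at this
    simpa [gaussianIntegral] using this
  change ((Real.pi : ℂ) ^ n)⁻¹ * gaussianIntegral _ _ = 1
  have h2 : map (evalAt z : Obs n →+* ℂ) (C g.h.det : MvPolynomial (Fin n ⊕ Fin n) (Obs n)) =
      C (g.h.map fun f => f.1 z).det * 1 := by
    rw [map_C, mul_one, ← det_apply]; rfl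
  rw [h2, gaussianIntegral_C_mul, h1]
  have h3 : (g.h.map fun f => f.1 z).det ≠ 0 := (g.posDef z).det_pos.ne'
  have h4 : (Real.pi : ℂ) ^ n ≠ 0 := pow_ne_zero _ (Complex.ofReal_ne_zero.2 Real.pi_ne_zero)
  field_simp

/-- Smoothness in `z` needs no estimates. The smooth functions form a submodule containing the value
at `1`, which is the inverse of `det H`, so `gaussian_mem` puts all values into it. -/
theorem contDiff_gaussianFun (p : MvPolynomial (Fin n ⊕ Fin n) (Obs n)) :
    ContDiff ℝ ∞ (g.gaussianFun p) := by
  have h1 : g.gaussianFun 1 ∈ LinearMap.range (Algebra.linearMap (Obs n) ((Fin n → ℂ) → ℂ)) := by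
    obtain ⟨u, hu⟩ := g.isUnit_det.exists_left_inv
    refine ⟨u, ?_⟩
    have h2 : (1 : MvPolynomial (Fin n ⊕ Fin n) (Obs n)) = C u * C g.h.det := by
      rw [← C_mul, hu, C_1]
    rw [h2, ← smul_eq_C_mul, map_smul, gaussianFun_det, Algebra.linearMap_apply, Algebra.algebraMap_eq_smul_one]
  obtain ⟨a, ha⟩ := gaussian_mem g.gaussianFun _ _ (X_eq_sum_covMatrix g.h_mul_inv g.inv_mul_h)
    g.gaussianFun_pderiv _ h1 p
  rw [← ha]
  exact contDiff_obs a

/-- The Gaussian functional on polynomials with smooth coefficients. -/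
def gaussianObs : MvPolynomial (Fin n ⊕ Fin n) (Obs n) →ₗ[Obs n] Obs n where
  toFun p := ⟨g.gaussianFun p, mem_smoothFunctions.2 (g.contDiff_gaussianFun p)⟩
  map_add' p q := Subtype.ext (map_add g.gaussianFun p q)
  map_smul' a p := Subtype.ext (map_smul g.gaussianFun a p)

/-- The algebraic data of a Kähler metric. -/
def toFormal : FormalKahler (Fin n) (Obs n) where
  d := dzDer
  dbar := dzbarDer
  d_comm := dzDer_comm
  dbar_comm := dzbarDer_comm
  d_dbar_comm := dzDer_dzbarDer_comm
  h := g.h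
  hinv := g.inv
  closed := g.closed
  closed_bar := g.closed_bar
  h_mul_hinv := g.h_mul_inv
  hinv_mul_h := g.inv_mul_h
  det := g.h.det
  G := g.gaussianObs
  G_pderiv k p := Subtype.ext (g.gaussianFun_pderiv k p)
  d_G _ := derivation_gaussian g.isUnit_det g.h_mul_inv g.inv_mul_h _
    (fun k p => Subtype.ext (g.gaussianFun_pderiv k p)) (Subtype.ext g.gaussianFun_det) _
    (g.derivation_det_h _)
  dbar_G _ := derivation_gaussian g.isUnit_det g.h_mul_inv g.inv_mul_h _
    (fun k p => Subtype.ext (g.gaussianFun_pderiv k p)) (Subtype.ext g.gaussianFun_det) _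
    (g.derivation_det_h _)
  G_det := Subtype.ext g.gaussianFun_det

end KahlerMetric

end Obs

end KahlerQuantization

namespace KahlerQuantization

open MvPolynomial MeasureTheory

namespace FormalKahler

/-! ### Comparison of the algebraic integrand with the concrete one. -/

section Evaluation

variable {ι A : Type*} [Fintype ι] [DecidableEq ι] [CommRing A] [Algebra ℂ A]
  (K : FormalKahler ι A) (e : A →ₐ[ℂ] ℂ) (u : ι ⊕ ι → ℂ)

/-- Evaluation of the formal variables at a vector. -/
def evalVar : MvPolynomial (ι ⊕ ι) A →ₐ[A] A := aeval fun k => algebraMap ℂ A (u k)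

theorem evalVar_C (a : A) : evalVar u (C a) = a := by
  rw [evalVar, aeval_C]; rfl

theorem evalVar_X (k : ι ⊕ ι) : evalVar u (X k) = algebraMap ℂ A (u k) := aeval_X _ _

/-- Evaluation of the formal variables at a vector, and of the coefficients at a point. -/
def evalPoint : MvPolynomial (ι ⊕ ι) A →+* ℂ :=
  (e : A →+* ℂ).comp (evalVar u : MvPolynomial (ι ⊕ ι) A →ₐ[A] A).toRingHom

theorem evalPoint_apply (p : MvPolynomial (ι ⊕ ι) A) : evalPoint e u p = e (evalVar u p) := rfl

theorem evalPoint_smul (c : ℂ) (p : MvPolynomial (ι ⊕ ι) A) :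
    evalPoint e u (c • p) = c * evalPoint e u p := by
  have : evalVar u (c • p) = c • evalVar u p := map_smul ((evalVar u).restrictScalars ℂ) c p
  rw [evalPoint_apply, this, map_smul]; rfl

theorem evalPoint_eq_eval (p : MvPolynomial (ι ⊕ ι) A) :
    evalPoint e u p = eval u (map (e : A →+* ℂ) p) := by
  have : evalPoint e u = (eval u).comp (map (e : A →+* ℂ)) := by
    refine MvPolynomial.ringHom_ext (fun a => ?_) fun k => ?_
    · rw [evalPoint_apply, evalVar_C, RingHom.comp_apply, map_C, eval_C]; rfl
    · rw [evalPoint_apply, evalVar_X, RingHom.comp_apply, map_X, eval_X, AlgHom.commutes]; rfl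
  rw [this]; rfl

/-- The numbers substituted for the variables are killed by `D`, so substitution and differentiation
commute. Derivations along formal variables thereby become derivatives along numerical vectors. -/
theorem evalVar_mapCoeff (D : Derivation ℂ A A) (p : MvPolynomial (ι ⊕ ι) A) :
    evalVar u (mapCoeff D p) = D (evalVar u p) :=
  algHom_mapCoeff (evalVar u) D D (fun _ => rfl)
    (fun k => by rw [evalVar_X]; exact Derivation.map_algebraMap D _) p

/-- The derivative in the direction of a vector of numbers. -/
def dirNum (d : ι → Derivation ℂ A A) (v : ι → ℂ) (f : A) : A := ∑ i, v i • d i f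

theorem evalVar_dirD (d : ι → Derivation ℂ A A) (s : ι → ι ⊕ ι) (p : MvPolynomial (ι ⊕ ι) A) :
    evalVar u (dirD d (fun i => X (s i)) p) = dirNum d (fun i => u (s i)) (evalVar u p) := by
  rw [dirD_apply, map_sum, dirNum]
  refine Finset.sum_congr rfl fun i _ => ?_
  rw [map_mul, evalVar_mapCoeff, evalVar_X, ← Algebra.smul_def]

theorem evalVar_dirD_pow (d : ι → Derivation ℂ A A) (s : ι → ι ⊕ ι) (m : ℕ)
    (p : MvPolynomial (ι ⊕ ι) A) :
    evalVar u (((dirD d fun i => X (s i)).toLinearMap ^ m) p) =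
      (dirNum d fun i => u (s i))^[m] (evalVar u p) := by
  rw [Module.End.pow_apply]
  exact (show Function.Semiconj (evalVar u) _ _ from evalVar_dirD u d s).iterate_right m p

theorem evalPoint_coeff_opSeries_C (c : ℕ → ℂ) (d : ι → Derivation ℂ A A) (s : ι → ι ⊕ ι)
    (p : MvPolynomial (ι ⊕ ι) A) (m : ℕ) :
    evalPoint e u (PowerSeries.coeff m
      (opSeries c (dirD d fun i => X (s i)).toLinearMap (PowerSeries.C p))) =
      c m * e ((dirNum d fun i => u (s i))^[m] (evalVar u p)) := by
  rw [coeff_opSeries_C, evalPoint_smul, evalPoint_apply, evalVar_dirD_pow]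

theorem evalPoint_coeff_opSeries_opSeries (c c' : ℕ → ℂ) (d d' : ι → Derivation ℂ A A)
    (s s' : ι → ι ⊕ ι) (p : MvPolynomial (ι ⊕ ι) A) (m : ℕ) :
    evalPoint e u (PowerSeries.coeff m (opSeries c (dirD d fun i => X (s i)).toLinearMap
        (opSeries c' (dirD d' fun i => X (s' i)).toLinearMap (PowerSeries.C p)))) =
      ∑ pq ∈ Finset.HasAntidiagonal.antidiagonal m, c pq.1 * (c' pq.2 *
        e ((dirNum d fun i => u (s i))^[pq.1]
          ((dirNum d' fun i => u (s' i))^[pq.2] (evalVar u p)))) := by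
  rw [coeff_opSeries, map_sum]
  refine Finset.sum_congr rfl fun pq _ => ?_
  rw [evalPoint_smul, coeff_opSeries_C, map_smul, evalPoint_smul, evalPoint_apply,
    evalVar_dirD_pow, evalVar_dirD_pow]

/-- The value of the Hermitian form on a vector of numbers. -/
def quadNum : A := ∑ i, ∑ j, (u (Sum.inl i) * u (Sum.inr j)) • K.h i j

theorem evalVar_quadForm :
    evalVar u (quadForm K.h (holVar ι A) (antiVar ι A)) = K.quadNum u := by
  simp only [quadForm, map_sum, quadNum]
  refine Finset.sum_congr rfl fun i _ => Finset.sum_congr rfl fun j _ => ?_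
  rw [map_mul, map_mul, evalVar_C, holVar, antiVar, evalVar_X, evalVar_X, mul_assoc, ← map_mul,
    mul_comm, ← Algebra.smul_def]

/-- The expansion of the Calabi function at a vector of numbers. -/
def calabiNum : PowerSeries ℂ :=
  PowerSeries.mk fun m => -∑ pq ∈ Finset.HasAntidiagonal.antidiagonal m,
    e ((dirNum K.d fun i => u (Sum.inl i))^[pq.1]
      ((dirNum K.dbar fun i => u (Sum.inr i))^[pq.2] (K.quadNum u))) /
      (((pq.1 + 1).factorial : ℂ) * ((pq.2 + 1).factorial : ℂ))

/-- The integrand of the formal integral at a vector of numbers. -/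
def integrandNum (f₁ f₂ : A) : PowerSeries ℂ :=
  (PowerSeries.mk fun m => e ((dirNum K.dbar fun i => u (Sum.inr i))^[m] f₁) / (m.factorial : ℂ)) *
  (PowerSeries.mk fun m => e ((dirNum K.d fun i => u (Sum.inl i))^[m] f₂) / (m.factorial : ℂ)) *
  formalExp (K.calabiNum e u) *
  PowerSeries.mk fun m => ∑ pq ∈ Finset.HasAntidiagonal.antidiagonal m,
    e ((dirNum K.d fun i => u (Sum.inl i))^[pq.1]
      ((dirNum K.dbar fun i => u (Sum.inr i))^[pq.2] K.det)) /
        ((pq.1.factorial : ℂ) * (pq.2.factorial : ℂ))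

theorem map_calabi_evalPoint :
    PowerSeries.map (evalPoint e u) (K.calabi (holVar ι A) (antiVar ι A)) = -K.calabiNum e u := by
  ext m
  rw [PowerSeries.coeff_map, calabiNum, map_neg, PowerSeries.coeff_mk, neg_neg]
  refine (evalPoint_coeff_opSeries_opSeries e u _ _ _ _ Sum.inl Sum.inr _ m).trans
    (Finset.sum_congr rfl fun pq _ => ?_)
  rw [← mul_assoc, ← mul_inv, div_eq_inv_mul, evalVar_quadForm]

theorem constantCoeff_calabiNum :
    PowerSeries.constantCoeff (K.calabiNum e u) = -e (K.quadNum u) := by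
  rw [← PowerSeries.coeff_zero_eq_constantCoeff_apply, calabiNum, PowerSeries.coeff_mk]
  simp

/-- The constant term of the exponent is minus the Hermitian form. It splits off as the Gaussian
factor, and the rest is an algebraic exponential with polynomial coefficients. -/
theorem formalExp_calabiNum :
    formalExp (K.calabiNum e u) = PowerSeries.C (Complex.exp (-e (K.quadNum u))) *
      PowerSeries.map (evalPoint e u) (fexp (PowerSeries.C
        (quadForm K.h (holVar ι A) (antiVar ι A)) - K.calabi (holVar ι A) (antiVar ι A))) := by
  rw [formalExp, constantCoeff_calabiNum, subst_exp_eq_fexp, map_fexp, map_sub,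
    map_calabi_evalPoint, PowerSeries.map_C, evalPoint_apply, evalVar_quadForm, map_neg]
  · congr 2
    ring
  · rw [map_sub, constantCoeff_calabiNum]; simp

theorem map_shiftBar_evalPoint (f₁ : A) :
    PowerSeries.map (evalPoint e u) (K.shiftBar (antiVar ι A) (PowerSeries.C (C f₁))) =
    PowerSeries.mk fun m =>
      e ((dirNum K.dbar fun i => u (Sum.inr i))^[m] f₁) / (m.factorial : ℂ) := by
  ext m
  rw [PowerSeries.coeff_map, PowerSeries.coeff_mk, div_eq_inv_mul]
  exact (evalPoint_coeff_opSeries_C e u _ _ Sum.inr _ m).trans (by rw [evalVar_C])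

theorem map_shift_evalPoint (f₂ : A) :
    PowerSeries.map (evalPoint e u) (K.shift (holVar ι A) (PowerSeries.C (C f₂))) =
    PowerSeries.mk fun m =>
      e ((dirNum K.d fun i => u (Sum.inl i))^[m] f₂) / (m.factorial : ℂ) := by
  ext m
  rw [PowerSeries.coeff_map, PowerSeries.coeff_mk, div_eq_inv_mul]
  exact (evalPoint_coeff_opSeries_C e u _ _ Sum.inl _ m).trans (by rw [evalVar_C])

theorem map_shift_shiftBar_evalPoint :
    PowerSeries.map (evalPoint e u) (K.shift (holVar ι A) (K.shiftBar (antiVar ι A)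
    (PowerSeries.C (C K.det)))) =
    PowerSeries.mk fun m => ∑ pq ∈ Finset.HasAntidiagonal.antidiagonal m,
      e ((dirNum K.d fun i => u (Sum.inl i))^[pq.1]
        ((dirNum K.dbar fun i => u (Sum.inr i))^[pq.2] K.det)) /
          ((pq.1.factorial : ℂ) * (pq.2.factorial : ℂ)) := by
  ext m
  rw [PowerSeries.coeff_map, PowerSeries.coeff_mk]
  refine (evalPoint_coeff_opSeries_opSeries e u _ _ _ _ Sum.inl Sum.inr _ m).trans
    (Finset.sum_congr rfl fun pq _ => ?_)
  rw [evalVar_C, ← mul_assoc, ← mul_inv, div_eq_inv_mul]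

/-- The formal integrand is the product of the Gaussian and of the algebraic integrand. -/
theorem integrandNum_eq (f₁ f₂ : A) :
    K.integrandNum e u f₁ f₂ = PowerSeries.C (Complex.exp (-e (K.quadNum u))) *
      PowerSeries.map (evalPoint e u) (K.weight (holVar ι A) (antiVar ι A)
        (PowerSeries.C (C f₁)) (PowerSeries.C (C f₂))) := by
  rw [integrandNum, formalExp_calabiNum, weight, map_mul, map_mul, map_mul,
    map_shiftBar_evalPoint, map_shift_evalPoint, map_shift_shiftBar_evalPoint]
  ac_rfl

theorem coeff_integrandNum (f₁ f₂ : A) (m : ℕ) :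
    PowerSeries.coeff m (K.integrandNum e u f₁ f₂) = eval u (map (e : A →+* ℂ)
      (PowerSeries.coeff m (K.weight (holVar ι A) (antiVar ι A)
        (PowerSeries.map C (PowerSeries.C f₁)) (PowerSeries.map C (PowerSeries.C f₂))))) *
      Complex.exp (-∑ i, ∑ j, e (K.h i j) * u (Sum.inl i) * u (Sum.inr j)) := by
  have hq : e (K.quadNum u) = ∑ i, ∑ j, e (K.h i j) * u (Sum.inl i) * u (Sum.inr j) := by
    simp only [quadNum, map_sum, map_smul, smul_eq_mul]
    exact Finset.sum_congr rfl fun i _ => Finset.sum_congr rfl fun j _ => by ring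
  rw [integrandNum_eq, PowerSeries.coeff_C_mul, PowerSeries.coeff_map, evalPoint_eq_eval, hq,
    mul_comm, PowerSeries.map_C, PowerSeries.map_C]

end Evaluation

end FormalKahler

namespace KahlerMetric

variable {n : ℕ} (g : KahlerMetric n)

/-- Holds by unfolding: at `conjPair y` the numerical directional derivatives are `hol y` and
`antihol y`. -/
theorem integrand_eq_integrandNum (f₁ f₂ : Obs n) (z y : Fin n → ℂ) :
    g.integrand f₁ f₂ z y = g.toFormal.integrandNum (evalAt z) (conjPair y) f₁ f₂ := rfl

theorem coeff_integrand (f₁ f₂ : Obs n) (z y : Fin n → ℂ) (m : ℕ) :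
    PowerSeries.coeff m (g.integrand f₁ f₂ z y) = eval (conjPair y) (map (evalAt z : Obs n →+* ℂ)
      (PowerSeries.coeff m (g.toFormal.weight (holVar (Fin n) (Obs n)) (antiVar (Fin n) (Obs n))
        (PowerSeries.map C (PowerSeries.C f₁)) (PowerSeries.map C (PowerSeries.C f₂))))) *
      Complex.exp (-∑ i, ∑ j, (g.h.map fun f => f.1 z) i j * y i * (starRingEnd ℂ) (y j)) :=
  g.toFormal.coeff_integrandNum (evalAt z) (conjPair y) f₁ f₂ m

theorem integrable_coeff_integrand (f₁ f₂ : Obs n) (m : ℕ) (z : Fin n → ℂ) :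
    Integrable fun y : Fin n → ℂ => PowerSeries.coeff m (g.integrand f₁ f₂ z y) := by
  simp only [coeff_integrand]
  exact integrable_polynomial_gaussian (g.posDef z) _

/-- The bridge between analysis and algebra: once the Gaussian is factored out, the integral of each
coefficient is by definition the functional `G`. -/
theorem laplaceCoeff_eq (f₁ f₂ : Obs n) (m : ℕ) (z : Fin n → ℂ) :
    g.laplaceCoeff f₁ f₂ m z = (PowerSeries.coeff m
      (g.toFormal.formalIntegral (PowerSeries.C f₁) (PowerSeries.C f₂))).1 z := by
  rw [laplaceCoeff, FormalKahler.formalIntegral]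
  simp only [coeff_integrand]
  refine Eq.trans ?_ (congrArg (fun a : Obs n => a.1 z) (coeff_coeffMap _ _ _).symm)
  rfl

end KahlerMetric

end KahlerQuantization

namespace KahlerQuantization

open MvPolynomial MeasureTheory

namespace FormalKahler

/-! ### Parity and conjugation symmetry of the integrand. -/

section Symmetry

variable {ι A : Type*} [Fintype ι] [DecidableEq ι] [CommRing A] [Algebra ℂ A]
  (K : FormalKahler ι A) (e : A →ₐ[ℂ] ℂ) (u : ι ⊕ ι → ℂ)

theorem dirNum_smul (d : ι → Derivation ℂ A A) (v : ι → ℂ) (c : ℂ) (f : A) :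
    dirNum d v (c • f) = c • dirNum d v f := by
  simp only [dirNum, Derivation.map_smul, Finset.smul_sum, smul_comm c]

theorem dirNum_iterate_smul (d : ι → Derivation ℂ A A) (v : ι → ℂ) (m : ℕ) (c : ℂ) (f : A) :
    (dirNum d v)^[m] (c • f) = c • (dirNum d v)^[m] f :=
  (show Function.Semiconj (fun f : A => c • f) (dirNum d v) (dirNum d v) from
    fun f => (dirNum_smul d v c f).symm).iterate_right m f |>.symm

theorem dirNum_neg_iterate (d : ι → Derivation ℂ A A) (v : ι → ℂ) (m : ℕ) (f : A) :
    (dirNum d fun i => -v i)^[m] f = (-1 : ℂ) ^ m • (dirNum d v)^[m] f := by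
  induction m with
  | zero => simp
  | succ m ih =>
    rw [Function.iterate_succ_apply', Function.iterate_succ_apply', ih, dirNum_smul, pow_succ,
      mul_smul]
    simp [dirNum]

theorem formalExp_eq (S : PowerSeries ℂ) :
    formalExp S = PowerSeries.C (Complex.exp (PowerSeries.constantCoeff S)) *
      fexp (S - PowerSeries.C (PowerSeries.constantCoeff S)) := by
  rw [formalExp, subst_exp_eq_fexp]
  simp

theorem rescale_formalExp (a : ℂ) (S : PowerSeries ℂ) :
    PowerSeries.rescale a (formalExp S) = formalExp (PowerSeries.rescale a S) := by
  have hC : ∀ c : ℂ, PowerSeries.rescale a (PowerSeries.C c) = PowerSeries.C c := fun c => by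
    ext m
    rw [PowerSeries.coeff_rescale, PowerSeries.coeff_C]
    split_ifs with h <;> simp [h]
  have h0 : PowerSeries.constantCoeff (PowerSeries.rescale a S) = PowerSeries.constantCoeff S := by
    rw [← PowerSeries.coeff_zero_eq_constantCoeff_apply, PowerSeries.coeff_rescale]; simp
  rw [formalExp_eq, formalExp_eq, map_mul, rescale_fexp, map_sub, hC, hC, h0]

theorem map_conj_formalExp (S : PowerSeries ℂ) :
    PowerSeries.map (starRingEnd ℂ) (formalExp S) =
      formalExp (PowerSeries.map (starRingEnd ℂ) S) := by
  have h0 : PowerSeries.constantCoeff (PowerSeries.map (starRingEnd ℂ) S) =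
      (starRingEnd ℂ) (PowerSeries.constantCoeff S) := by
    rw [← PowerSeries.coeff_zero_eq_constantCoeff_apply, PowerSeries.coeff_map]; simp
  rw [formalExp_eq, formalExp_eq, map_mul, map_fexp, map_sub, PowerSeries.map_C, PowerSeries.map_C,
    h0, Complex.exp_conj]

theorem rescale_mk (a : ℂ) (c : ℕ → ℂ) :
    PowerSeries.rescale a (PowerSeries.mk c) = PowerSeries.mk fun m => a ^ m * c m := by
  ext m; rw [PowerSeries.coeff_rescale, PowerSeries.coeff_mk, PowerSeries.coeff_mk]

theorem quadNum_neg : K.quadNum (fun k => -u k) = K.quadNum u := by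
  simp [quadNum]

theorem calabiNum_neg :
    K.calabiNum e (fun k => -u k) = PowerSeries.rescale (-1 : ℂ) (K.calabiNum e u) := by
  simp only [calabiNum, rescale_mk, quadNum_neg, dirNum_neg_iterate, dirNum_iterate_smul, map_smul,
    smul_eq_mul]
  congr 1
  funext m
  rw [mul_neg, Finset.mul_sum]
  congr 1
  refine Finset.sum_congr rfl fun pq hpq => ?_
  rw [← Finset.HasAntidiagonal.mem_antidiagonal.1 hpq, pow_add, mul_div_assoc, mul_div_assoc]
  ring

/-- The integrand is invariant under simultaneous reversal of the variables and of `ε`. -/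
theorem integrandNum_neg (f₁ f₂ : A) :
    K.integrandNum e (fun k => -u k) f₁ f₂ =
      PowerSeries.rescale (-1 : ℂ) (K.integrandNum e u f₁ f₂) := by
  rw [integrandNum, integrandNum, map_mul, map_mul, map_mul, rescale_formalExp, ← calabiNum_neg]
  simp only [rescale_mk, dirNum_neg_iterate, dirNum_iterate_smul, map_smul, smul_eq_mul,
    mul_div_assoc]
  congr 2
  funext m
  rw [Finset.mul_sum]
  refine Finset.sum_congr rfl fun pq hpq => ?_
  rw [← Finset.HasAntidiagonal.mem_antidiagonal.1 hpq, pow_add]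
  ring

theorem dirNum_comm {d d' : ι → Derivation ℂ A A} (h : ∀ i j a, d i (d' j a) = d' j (d i a))
    (v w : ι → ℂ) : Function.Commute (dirNum d v) (dirNum d' w) := by
  intro f
  simp only [dirNum, map_sum, Derivation.map_smul, h, Finset.smul_sum]
  rw [Finset.sum_comm]
  simp only [smul_comm (v _) (w _)]

variable {K e u} {σ : A →+ A} (hσ : ∀ (c : ℂ) a, σ (c • a) = (starRingEnd ℂ) c • σ a)
  (hd : ∀ i a, σ (K.d i a) = K.dbar i (σ a)) (hdbar : ∀ i a, σ (K.dbar i a) = K.d i (σ a))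
  (he : ∀ a, e (σ a) = (starRingEnd ℂ) (e a)) (hh : ∀ i j, σ (K.h i j) = K.h j i)
  (hdet : σ K.det = K.det) (hu : ∀ i, u (Sum.inr i) = (starRingEnd ℂ) (u (Sum.inl i)))
include hσ hd hdbar he hu

theorem conj_dirNum_d (m : ℕ) (f : A) :
    σ ((dirNum K.d fun i => u (Sum.inl i))^[m] f) =
      (dirNum K.dbar fun i => u (Sum.inr i))^[m] (σ f) :=
  (show Function.Semiconj σ (dirNum K.d fun i => u (Sum.inl i))
    (dirNum K.dbar fun i => u (Sum.inr i)) from fun f => by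
      simp only [dirNum, map_sum, hσ, hd, hu]).iterate_right m f

theorem conj_dirNum_dbar (m : ℕ) (f : A) :
    σ ((dirNum K.dbar fun i => u (Sum.inr i))^[m] f) =
      (dirNum K.d fun i => u (Sum.inl i))^[m] (σ f) :=
  (show Function.Semiconj σ (dirNum K.dbar fun i => u (Sum.inr i))
    (dirNum K.d fun i => u (Sum.inl i)) from fun f => by
      simp only [dirNum, map_sum, hσ, hdbar, hu, Complex.conj_conj]).iterate_right m f

/-- Conjugation exchanges the two kinds of derivatives. For a real function the orders `p` and `q`
are swapped, so sums over an antidiagonal with symmetric weights are real. -/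
theorem conj_dirNum_mixed (p q : ℕ) {a : A} (ha : σ a = a) :
    (starRingEnd ℂ) (e ((dirNum K.d fun i => u (Sum.inl i))^[p]
      ((dirNum K.dbar fun i => u (Sum.inr i))^[q] a))) =
    e ((dirNum K.d fun i => u (Sum.inl i))^[q]
      ((dirNum K.dbar fun i => u (Sum.inr i))^[p] a)) := by
  rw [← he, conj_dirNum_d hσ hd hdbar he hu, conj_dirNum_dbar hσ hd hdbar he hu, ha]
  exact congrArg e ((dirNum_comm K.d_dbar_comm _ _).iterate_iterate q p a).symm

include hh

theorem conj_quadNum : σ (K.quadNum u) = K.quadNum u := by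
  simp only [quadNum, map_sum, hσ, hh, map_mul, hu, Complex.conj_conj]
  rw [Finset.sum_comm]
  simp only [mul_comm]

theorem conj_calabiNum : PowerSeries.map (starRingEnd ℂ) (K.calabiNum e u) = K.calabiNum e u := by
  ext m
  rw [PowerSeries.coeff_map, calabiNum, PowerSeries.coeff_mk, map_neg, map_sum,
    ← Finset.Nat.sum_antidiagonal_swap]
  congr 1
  refine Finset.sum_congr rfl fun pq _ => ?_
  rw [map_div₀, map_mul, map_natCast, map_natCast, Prod.fst_swap, Prod.snd_swap,
    conj_dirNum_mixed hσ hd hdbar he hu _ _ (conj_quadNum hσ hd hdbar he hh hu), mul_comm]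

include hdet

/-- Conjugation of the integrand exchanges its two arguments. -/
theorem conj_integrandNum (f₁ f₂ : A) :
    PowerSeries.map (starRingEnd ℂ) (K.integrandNum e u f₁ f₂) =
      K.integrandNum e u (σ f₂) (σ f₁) := by
  have hmk : ∀ c : ℕ → ℂ, PowerSeries.map (starRingEnd ℂ) (PowerSeries.mk c) =
      PowerSeries.mk fun m => (starRingEnd ℂ) (c m) := fun c => by ext m; simp
  rw [integrandNum, integrandNum, map_mul, map_mul, map_mul, map_conj_formalExp,
    conj_calabiNum hσ hd hdbar he hh hu, mul_comm (PowerSeries.mk _) (PowerSeries.mk _)]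
  simp only [hmk, map_div₀, map_natCast, map_sum, map_mul,
    conj_dirNum_mixed hσ hd hdbar he hu _ _ hdet]
  simp only [← he, conj_dirNum_d hσ hd hdbar he hu, conj_dirNum_dbar hσ hd hdbar he hu]
  congr 2
  funext m
  rw [← Finset.Nat.sum_antidiagonal_swap]
  refine Finset.sum_congr rfl fun pq _ => ?_
  rw [Prod.fst_swap, Prod.snd_swap, mul_comm (pq.1.factorial : ℂ)]

end Symmetry

end FormalKahler

namespace KahlerMetric

variable {n : ℕ} (g : KahlerMetric n)

/-- Reversal of `y` acts on the integrand like reversal of `ε`, so the odd coefficients are odd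
functions of `y`, while Lebesgue measure is invariant. -/
theorem laplaceCoeff_odd (f₁ f₂ : Obs n) (k : ℕ) (z : Fin n → ℂ) :
    g.laplaceCoeff f₁ f₂ (2 * k + 1) z = 0 := by
  have h1 : ∀ y : Fin n → ℂ, PowerSeries.coeff (2 * k + 1) (g.integrand f₁ f₂ z (-y)) =
      -PowerSeries.coeff (2 * k + 1) (g.integrand f₁ f₂ z y) := by
    intro y
    have hy : conjPair (-y) = fun k => -conjPair y k := by
      funext k; cases k <;> simp [conjPair]
    rw [integrand_eq_integrandNum, integrand_eq_integrandNum, hy, FormalKahler.integrandNum_neg,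
      PowerSeries.coeff_rescale, (show Odd (2 * k + 1) from ⟨k, rfl⟩).neg_one_pow]
    ring
  have h2 := integral_neg_eq_self
    (fun y : Fin n → ℂ => PowerSeries.coeff (2 * k + 1) (g.integrand f₁ f₂ z y)) volume
  simp only [h1, integral_neg] at h2
  rw [laplaceCoeff, neg_eq_self.1 h2, mul_zero]

/-- Pointwise conjugation as an additive map. -/
def conjHom (n : ℕ) : Obs n →+ Obs n where
  toFun := conjObs
  map_zero' := by ext z; exact map_zero (starRingEnd ℂ)
  map_add' f f' := by ext z; exact map_add (starRingEnd ℂ) (f.1 z) (f'.1 z)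

theorem conjObs_det : conjObs g.h.det = g.h.det := by
  ext z
  rw [conjObs_apply, det_apply]
  exact (Matrix.det_conjTranspose _).symm.trans (congrArg Matrix.det (g.posDef z).isHermitian.eq)

theorem conj_integrand (f₁ f₂ : Obs n) (z y : Fin n → ℂ) :
    PowerSeries.map (starRingEnd ℂ) (g.integrand f₁ f₂ z y) =
      g.integrand (conjObs f₂) (conjObs f₁) z y :=
  FormalKahler.conj_integrandNum (K := g.toFormal) (e := evalAt z) (u := conjPair y)
    (σ := conjHom n) (fun c a => Subtype.ext (funext fun z => map_mul (starRingEnd ℂ) c (a.1 z)))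
    (fun i a => (dzbar_conjObs i a).symm) (fun i a => (dz_conjObs i a).symm) (fun _ => rfl)
    g.conjObs_h g.conjObs_det (fun _ => rfl) f₁ f₂

theorem laplaceCoeff_conj (f₁ f₂ : Obs n) (m : ℕ) (z : Fin n → ℂ) :
    g.laplaceCoeff (conjObs f₂) (conjObs f₁) m z = (starRingEnd ℂ) (g.laplaceCoeff f₁ f₂ m z) := by
  rw [laplaceCoeff, laplaceCoeff, map_mul, map_inv₀, map_pow, Complex.conj_ofReal, ← integral_conj]
  simp only [← conj_integrand, PowerSeries.coeff_map]

end KahlerMetric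

end KahlerQuantization

namespace KahlerQuantization

/-! ### Products on power series: reduction to constants, and the change of parameter `ħ = ε²`. -/

section Biadditive

open PowerSeries

variable {A : Type*} [CommRing A]

/-- Biadditive products of power series that are linear over the formal parameter. -/
structure IsFormalProduct (P : PowerSeries A → PowerSeries A → PowerSeries A) : Prop where
  add_left : ∀ F F' G, P (F + F') G = P F G + P F' G
  add_right : ∀ F G G', P F (G + G') = P F G + P F G'
  X_mul_left : ∀ F G, P (X * F) G = X * P F G
  X_mul_right : ∀ F G, P F (X * G) = X * P F G

namespace IsFormalProduct

variable {P P' : PowerSeries A → PowerSeries A → PowerSeries A}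

/-- Apply `ext_of_X_mul` in each argument separately. -/
theorem ext_C (hP : IsFormalProduct P) (hP' : IsFormalProduct P')
    (h : ∀ a b, P (C a) (C b) = P' (C a) (C b)) (F G : PowerSeries A) : P F G = P' F G := by
  have h1 : ∀ a, P (C a) G = P' (C a) G := fun a =>
    DFunLike.congr_fun (ext_of_X_mul (Θ₁ := AddMonoidHom.mk' (P (C a)) (hP.add_right _))
      (Θ₂ := AddMonoidHom.mk' (P' (C a)) (hP'.add_right _))
      (hP.X_mul_right _) (hP'.X_mul_right _) (h a)) G
  exact DFunLike.congr_fun (ext_of_X_mul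
    (Θ₁ := AddMonoidHom.mk' (fun F => P F G) fun F F' => hP.add_left F F' G)
    (Θ₂ := AddMonoidHom.mk' (fun F => P' F G) fun F F' => hP'.add_left F F' G)
    (fun F => hP.X_mul_left F G) (fun F => hP'.X_mul_left F G) h1) F

/-- It suffices to check associativity on constants. -/
theorem assoc (hP : IsFormalProduct P)
    (h : ∀ a b c, P (P (C a) (C b)) (C c) = P (C a) (P (C b) (C c))) (F G H : PowerSeries A) :
    P (P F G) H = P F (P G H) := by
  have h1 : ∀ c F G, P (P F G) (C c) = P F (P G (C c)) := fun c =>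
    ext_C (P := fun F G => P (P F G) (C c)) (P' := fun F G => P F (P G (C c)))
      ⟨fun _ _ _ => by rw [hP.add_left, hP.add_left], fun _ _ _ => by rw [hP.add_right, hP.add_left],
        fun _ _ => by rw [hP.X_mul_left, hP.X_mul_left],
        fun _ _ => by rw [hP.X_mul_right, hP.X_mul_left]⟩
      ⟨fun _ _ _ => by rw [hP.add_left], fun _ _ _ => by rw [hP.add_left, hP.add_right],
        fun _ _ => by rw [hP.X_mul_left], fun _ _ => by rw [hP.X_mul_left, hP.X_mul_right]⟩
      fun a b => h a b c
  exact DFunLike.congr_fun (ext_of_X_mul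
    (Θ₁ := AddMonoidHom.mk' (P (P F G)) (hP.add_right _))
    (Θ₂ := AddMonoidHom.mk' (fun H => P F (P G H)) fun H H' => by
      rw [hP.add_right, hP.add_right])
    (hP.X_mul_right _) (fun H => by
      simp only [AddMonoidHom.mk'_apply]; rw [hP.X_mul_right, hP.X_mul_right]) (h1 · F G)) H

variable [Algebra ℂ A]

theorem C_smul (c : ℂ) (F : PowerSeries A) : (C c : PowerSeries ℂ) • F = c • F := by
  have : (C c : PowerSeries ℂ) • F = PowerSeries.map (algebraMap ℂ A) (C c) * F :=
    Algebra.smul_def _ _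
  rw [this, map_C]
  ext m
  rw [coeff_C_mul, coeff_smul, Algebra.smul_def]

theorem X_mul_smul (s : PowerSeries ℂ) (F : PowerSeries A) : (X * s) • F = X * s • F := by
  have h : ∀ s : PowerSeries ℂ, s • F = PowerSeries.map (algebraMap ℂ A) s * F :=
    fun s => Algebra.smul_def _ _
  rw [h, h, map_mul, map_X, mul_assoc]

theorem smul_C (c : ℂ) (a : A) : c • (C a : PowerSeries A) = C (c • a) := by
  ext m
  rw [coeff_smul, coeff_C, coeff_C]
  split_ifs <;> simp

theorem X_mul_smul_comm (c : ℂ) (F : PowerSeries A) : c • (X * F) = X * c • F :=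
  (mul_smul_comm _ _ _).symm

/-- Complex scalars are first pulled out of arbitrary series by `ext_C`. With `F` and `G` fixed,
both sides are then additive in `s` and commute with `X`, so `ext_of_X_mul` applies once more. -/
theorem smul_left (hP : IsFormalProduct P)
    (h : ∀ (c : ℂ) a b, P (C (c • a)) (C b) = c • P (C a) (C b)) (s : PowerSeries ℂ)
    (F G : PowerSeries A) : P (s • F) G = s • P F G := by
  have h1 : ∀ (c : ℂ) F G, P (c • F) G = c • P F G := fun c =>
    ext_C (P := fun F G => P (c • F) G) (P' := fun F G => c • P F G)
      ⟨fun _ _ _ => by rw [smul_add, hP.add_left], fun _ _ _ => by rw [hP.add_right],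
        fun _ _ => by rw [X_mul_smul_comm, hP.X_mul_left], fun _ _ => by rw [hP.X_mul_right]⟩
      ⟨fun _ _ _ => by rw [hP.add_left, smul_add], fun _ _ _ => by rw [hP.add_right, smul_add],
        fun _ _ => by rw [hP.X_mul_left, X_mul_smul_comm],
        fun _ _ => by rw [hP.X_mul_right, X_mul_smul_comm]⟩
      fun a b => by rw [smul_C, h]
  exact DFunLike.congr_fun (ext_of_X_mul
    (Θ₁ := AddMonoidHom.mk' (fun s : PowerSeries ℂ => P (s • F) G) fun s t => by
      rw [add_smul, hP.add_left])
    (Θ₂ := AddMonoidHom.mk' (fun s : PowerSeries ℂ => s • P F G) fun s t => add_smul _ _ _)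
    (fun s => by simp only [AddMonoidHom.mk'_apply]; rw [X_mul_smul, hP.X_mul_left])
    (fun s => by simp only [AddMonoidHom.mk'_apply]; rw [X_mul_smul])
    (fun c => by simp only [AddMonoidHom.mk'_apply]; rw [C_smul, C_smul, h1])) s

theorem flip (hP : IsFormalProduct P) : IsFormalProduct fun F G => P G F :=
  ⟨fun _ _ _ => hP.add_right _ _ _, fun _ _ _ => hP.add_left _ _ _, fun _ _ => hP.X_mul_right _ _,
    fun _ _ => hP.X_mul_left _ _⟩

end IsFormalProduct

/-- The part of a power series with exponents congruent to `r` modulo `2`. -/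
def parityPart (r : ℕ) (F : PowerSeries A) : PowerSeries A :=
  PowerSeries.mk fun k => coeff (2 * k + r) F

theorem coeff_parityPart (r k : ℕ) (F : PowerSeries A) :
    coeff k (parityPart r F) = coeff (2 * k + r) F := coeff_mk _ _

theorem parityPart_add (r : ℕ) (F G : PowerSeries A) :
    parityPart r (F + G) = parityPart r F + parityPart r G := by
  ext k; simp only [coeff_parityPart, map_add]

theorem parityPart_X_sq_mul {r : ℕ} (hr : r < 2) (F : PowerSeries A) :
    parityPart r (X ^ 2 * F) = X * parityPart r F := by
  ext k
  cases k with
  | zero =>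
    rw [coeff_parityPart, coeff_X_pow_mul', if_neg (by omega)]
    simp
  | succ k =>
    rw [coeff_parityPart, coeff_succ_X_mul, coeff_parityPart,
      show 2 * (k + 1) + r = (2 * k + r) + 2 by ring, coeff_X_pow_mul]

/-- The substitution `ħ = ε²`. -/
def sqSubst (F : PowerSeries A) : PowerSeries A := expand 2 two_ne_zero F

theorem sqSubst_add (F G : PowerSeries A) : sqSubst (F + G) = sqSubst F + sqSubst G :=
  map_add _ _ _

theorem sqSubst_X_mul (F : PowerSeries A) : sqSubst (X * F) = X ^ 2 * sqSubst F := by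
  rw [sqSubst, map_mul, expand_X]; rfl

theorem sqSubst_C (a : A) : sqSubst (C a) = C a := expand_C _ _ _

theorem sqSubst_parityPart {F : PowerSeries A} (h : parityPart 1 F = 0) :
    sqSubst (parityPart 0 F) = F := by
  ext m
  rcases Nat.even_or_odd' m with ⟨k, rfl | rfl⟩
  · rw [sqSubst, coeff_expand_mul, coeff_parityPart, add_zero]
  · rw [sqSubst, coeff_expand_of_not_dvd _ _ _ (by omega), ← coeff_parityPart, h, map_zero]

/-- The product in `ħ = ε²` that is induced by a product in `ε`. -/
def evenProduct (P : PowerSeries A → PowerSeries A → PowerSeries A) (F G : PowerSeries A) :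
    PowerSeries A := parityPart 0 (P (sqSubst F) (sqSubst G))

namespace IsFormalProduct

variable {P : PowerSeries A → PowerSeries A → PowerSeries A} (hP : IsFormalProduct P)
include hP

theorem parityPart_sqSubst {r : ℕ} (hr : r < 2) :
    IsFormalProduct fun F G => parityPart r (P (sqSubst F) (sqSubst G)) where
  add_left _ _ _ := by rw [sqSubst_add, hP.add_left, parityPart_add]
  add_right _ _ _ := by rw [sqSubst_add, hP.add_right, parityPart_add]
  X_mul_left _ _ := by
    rw [sqSubst_X_mul, pow_two, mul_assoc, hP.X_mul_left, hP.X_mul_left, ← mul_assoc, ← pow_two,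
      parityPart_X_sq_mul hr]
  X_mul_right _ _ := by
    rw [sqSubst_X_mul, pow_two, mul_assoc, hP.X_mul_right, hP.X_mul_right, ← mul_assoc, ← pow_two,
      parityPart_X_sq_mul hr]

theorem evenProduct : IsFormalProduct (evenProduct P) := hP.parityPart_sqSubst two_pos

/-- The odd part of the product of two even series is itself an `IsFormalProduct` in `ħ`. It
vanishes on constants, hence everywhere by `ext_C`, and the even part loses no information. -/
theorem sqSubst_evenProduct (h : ∀ a b k, coeff (2 * k + 1) (P (C a) (C b)) = 0)
    (F G : PowerSeries A) :
    sqSubst (KahlerQuantization.evenProduct P F G) = P (sqSubst F) (sqSubst G) := by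
  refine sqSubst_parityPart (ext_C (hP.parityPart_sqSubst one_lt_two)
    (P' := fun _ _ => 0) ⟨?_, ?_, ?_, ?_⟩ (fun a b => ?_) F G)
  any_goals intros; simp
  ext k
  rw [coeff_parityPart, sqSubst_C, sqSubst_C, h, map_zero]

theorem evenProduct_assoc (h : ∀ a b k, coeff (2 * k + 1) (P (C a) (C b)) = 0)
    (hassoc : ∀ a b c, P (P (C a) (C b)) (C c) = P (C a) (P (C b) (C c))) (F G H : PowerSeries A) :
    KahlerQuantization.evenProduct P (KahlerQuantization.evenProduct P F G) H =
      KahlerQuantization.evenProduct P F (KahlerQuantization.evenProduct P G H) := by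
  rw [KahlerQuantization.evenProduct, hP.sqSubst_evenProduct h, hP.assoc hassoc,
    ← hP.sqSubst_evenProduct h]
  rfl

theorem coeff_evenProduct_C (a b : A) (k : ℕ) :
    coeff k (KahlerQuantization.evenProduct P (C a) (C b)) = coeff (2 * k) (P (C a) (C b)) := by
  rw [KahlerQuantization.evenProduct, coeff_parityPart, sqSubst_C, sqSubst_C, add_zero]

end IsFormalProduct

end Biadditive

namespace FormalKahler

open MvPolynomial

variable {ι A : Type*} [Fintype ι] [DecidableEq ι] [CommRing A] [Algebra ℂ A]
  (K : FormalKahler ι A)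

theorem isFormalProduct_formalIntegral : IsFormalProduct K.formalIntegral where
  add_left _ _ _ := by simp only [formalIntegral, weight, map_add, add_mul]
  add_right _ _ _ := by simp only [formalIntegral, weight, map_add, add_mul, mul_add]
  X_mul_left F G := by
    rw [formalIntegral, formalIntegral, ← coeffMap_X_mul, weight, weight, map_mul (PowerSeries.map _),
      PowerSeries.map_X, shiftBar, tau_X_mul]
    simp only [mul_assoc]
  X_mul_right F G := by
    rw [formalIntegral, formalIntegral, ← coeffMap_X_mul, weight, weight, map_mul (PowerSeries.map _),
      PowerSeries.map_X, shift, tau_X_mul, mul_left_comm (K.shiftBar _ _)]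
    simp only [mul_assoc]

theorem C_smul_eq (c : ℂ) (a : A) :
    (C (c • a) : MvPolynomial (ι ⊕ ι) A) = c • C a := by
  classical
  ext m
  rw [coeff_smul, coeff_C, coeff_C]
  split_ifs <;> simp

theorem formalIntegral_smul_left (c : ℂ) (a b : A) :
    K.formalIntegral (PowerSeries.C (c • a)) (PowerSeries.C b) =
      c • K.formalIntegral (PowerSeries.C a) (PowerSeries.C b) := by
  rw [formalIntegral, formalIntegral, weight, weight, PowerSeries.map_C, PowerSeries.map_C,
    PowerSeries.map_C, C_smul_eq, ← IsFormalProduct.smul_C, map_smul]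
  simp only [smul_mul_assoc, map_smul]

theorem formalIntegral_smul_right (c : ℂ) (a b : A) :
    K.formalIntegral (PowerSeries.C a) (PowerSeries.C (c • b)) =
      c • K.formalIntegral (PowerSeries.C a) (PowerSeries.C b) := by
  rw [formalIntegral, formalIntegral, weight, weight, PowerSeries.map_C, PowerSeries.map_C,
    PowerSeries.map_C, C_smul_eq, ← IsFormalProduct.smul_C, map_smul]
  simp only [smul_mul_assoc, mul_smul_comm, map_smul]

end FormalKahler

end KahlerQuantization

namespace KahlerQuantization

/-! ### Coefficients of the formal integral as bidifferential operators. -/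

section Bidifferential

open MvPolynomial

variable {κ A : Type*} [CommRing A]

/-- The module of bidifferential operators that are generated by a family of operators. -/
def bidiffOps (D : κ → A → A) : Submodule A (A → A → A) :=
  Submodule.span A (Set.range fun (w : List κ × List κ) f₁ f₂ => w.1.foldr D f₁ * w.2.foldr D f₂)

theorem exists_finset_of_mem_bidiffOps {D : κ → A → A} {T : A → A → A} (hT : T ∈ bidiffOps D) :
    ∃ (s : Finset (List κ × List κ)) (a : List κ × List κ → A), ∀ f₁ f₂ : A,
      T f₁ f₂ = ∑ w ∈ s, a w * w.1.foldr D f₁ * w.2.foldr D f₂ := by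
  obtain ⟨c, rfl⟩ := Finsupp.mem_span_range_iff_exists_finsupp.1 hT
  refine ⟨c.support, c, fun f₁ f₂ => ?_⟩
  rw [Finsupp.sum, Finset.sum_apply, Finset.sum_apply]
  exact Finset.sum_congr rfl fun w _ => (mul_assoc _ _ _).symm

theorem foldr_mul_mem_bidiffOps (D : κ → A → A) (a : A) (w₁ w₂ : List κ) :
    (fun f₁ f₂ => a * (w₁.foldr D f₁ * w₂.foldr D f₂)) ∈ bidiffOps D :=
  (bidiffOps D).smul_mem a (Submodule.subset_span ⟨(w₁, w₂), rfl⟩)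

end Bidifferential

namespace FormalKahler

open MvPolynomial

variable {ι A : Type*} [Fintype ι] [DecidableEq ι] [CommRing A] [Algebra ℂ A]
  (K : FormalKahler ι A)

theorem dirD_X_mul {κ : Type*} (d : ι → Derivation ℂ A A) (v : ι → MvPolynomial κ A) (k : κ)
    (p : MvPolynomial κ A) : dirD d v (X k * p) = X k * dirD d v p := by
  have h : dirD d v (X k) = 0 := dirD_constVec d v (isConstVec_X id) k
  rw [Derivation.leibniz, h, smul_zero, add_zero, smul_eq_mul]

theorem dirD_pow_X_mul {κ : Type*} (d : ι → Derivation ℂ A A) (v : ι → MvPolynomial κ A) (k : κ)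
    (m : ℕ) (p : MvPolynomial κ A) :
    ((dirD d v).toLinearMap ^ m) (X k * p) = X k * ((dirD d v).toLinearMap ^ m) p := by
  rw [Module.End.pow_apply, Module.End.pow_apply]
  exact ((show Function.Semiconj (fun p => X k * p) (dirD d v) (dirD d v) from
    fun p => (dirD_X_mul d v k p).symm).iterate_right m p).symm

theorem dirD_C {κ : Type*} (d : ι → Derivation ℂ A A) (s : ι → κ) (f : A) :
    dirD d (fun i => X (s i)) (C f) = ∑ i, (X (s i) * C (d i f) : MvPolynomial κ A) := by
  rw [dirD_apply]; simp only [mapCoeff_C]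

/-- The variables are constants for the derivation, so the factor created by the first derivative
can be pulled to the front. -/
theorem dirD_pow_succ_C {κ : Type*} (d : ι → Derivation ℂ A A) (s : ι → κ) (m : ℕ) (f : A) :
    ((dirD d fun i => (X (s i) : MvPolynomial κ A)).toLinearMap ^ (m + 1)) (C f) =
      ∑ i, X (s i) * ((dirD d fun i => (X (s i) : MvPolynomial κ A)).toLinearMap ^ m)
        (C (d i f)) := by
  rw [pow_succ, Module.End.mul_apply]
  refine (congrArg _ (dirD_C d s f)).trans ?_
  rw [map_sum]
  exact Finset.sum_congr rfl fun i _ => dirD_pow_X_mul d _ _ m _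

/-- The operators that generate the bidifferential operators. -/
def partialOp : ι ⊕ ι → A → A := Sum.elim (fun i f => K.d i f) fun i f => K.dbar i f

theorem G_mul_C_mul_C_mem (p : MvPolynomial (ι ⊕ ι) A) (w₁ w₂ : List (ι ⊕ ι)) :
    (fun f₁ f₂ => K.G (p * (C (w₁.foldr K.partialOp f₁) * C (w₂.foldr K.partialOp f₂)))) ∈
      bidiffOps K.partialOp := by
  convert foldr_mul_mem_bidiffOps K.partialOp (K.G p) w₁ w₂ using 3 with f₁ f₂
  rw [← C_mul, mul_comm, ← smul_eq_C_mul, map_smul, smul_eq_mul, mul_comm]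

/-- Each induction step moves one derivative into a list and its formal variable into `p`. When no
derivatives are left, the functions are coefficients and come out of `G`. -/
theorem G_mul_pow_mem (a b : ℕ) (p : MvPolynomial (ι ⊕ ι) A) (w₁ w₂ : List (ι ⊕ ι)) :
    (fun f₁ f₂ => K.G (p *
      (((dirD K.dbar (antiVar ι A)).toLinearMap ^ a) (C (w₁.foldr K.partialOp f₁)) *
        ((dirD K.d (holVar ι A)).toLinearMap ^ b) (C (w₂.foldr K.partialOp f₂))))) ∈
      bidiffOps K.partialOp := by
  induction a generalizing p w₁ with
  | zero =>
    induction b generalizing p w₂ with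
    | zero => exact K.G_mul_C_mul_C_mem p w₁ w₂
    | succ b ih =>
      have h := (bidiffOps K.partialOp).sum_mem fun i (_ : i ∈ Finset.univ) =>
        ih (p := p * X (Sum.inl i)) (w₂ := Sum.inl i :: w₂)
      convert h using 1
      funext f₁ f₂
      rw [Finset.sum_apply, Finset.sum_apply, ← map_sum]
      refine congrArg K.G ?_
      refine (congrArg (fun q => p * (_ * q)) (dirD_pow_succ_C K.d Sum.inl b _)).trans ?_
      rw [Finset.mul_sum, Finset.mul_sum]
      refine Finset.sum_congr rfl fun i _ => ?_
      rw [mul_left_comm _ (X (Sum.inl i)), ← mul_assoc p]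
      rfl
  | succ a ih =>
    have h := (bidiffOps K.partialOp).sum_mem fun i (_ : i ∈ Finset.univ) =>
      ih (p := p * X (Sum.inr i)) (w₁ := Sum.inr i :: w₁)
    convert h using 1
    funext f₁ f₂
    rw [Finset.sum_apply, Finset.sum_apply, ← map_sum]
    refine congrArg K.G ?_
    refine (congrArg (fun q => p * (q * _)) (dirD_pow_succ_C K.dbar Sum.inr a _)).trans ?_
    rw [Finset.sum_mul, Finset.mul_sum]
    refine Finset.sum_congr rfl fun i _ => ?_
    rw [mul_assoc (X (Sum.inr i)), ← mul_assoc p]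
    rfl

/-- The part of the integrand that does not depend on the two functions. -/
def amplitude : PowerSeries (MvPolynomial (ι ⊕ ι) A) :=
  fexp (PowerSeries.C K.Q - K.calabi (holVar ι A) (antiVar ι A)) *
    K.shift (holVar ι A) (K.shiftBar (antiVar ι A) (PowerSeries.C (C K.det)))

theorem formalIntegral_C (f₁ f₂ : A) :
    K.formalIntegral (PowerSeries.C f₁) (PowerSeries.C f₂) = coeffMap (K.G.restrictScalars ℂ)
      (K.shiftBar (antiVar ι A) (PowerSeries.C (C f₁)) *
        K.shift (holVar ι A) (PowerSeries.C (C f₂)) * K.amplitude) := by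
  rw [formalIntegral, PowerSeries.map_C, PowerSeries.map_C, weight, amplitude, mul_assoc]

/-- The coefficients of the formal integral are bidifferential operators. -/
theorem coeff_formalIntegral_mem (m : ℕ) :
    (fun f₁ f₂ => PowerSeries.coeff m
      (K.formalIntegral (PowerSeries.C f₁) (PowerSeries.C f₂))) ∈ bidiffOps K.partialOp := by
  have h := (bidiffOps K.partialOp).sum_mem
    fun (r : ℕ × ℕ) (_ : r ∈ Finset.HasAntidiagonal.antidiagonal m) =>
    (bidiffOps K.partialOp).sum_mem
      fun (s : ℕ × ℕ) (_ : s ∈ Finset.HasAntidiagonal.antidiagonal r.1) =>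
      K.G_mul_pow_mem s.1 s.2 (((s.1.factorial : ℂ)⁻¹ * (s.2.factorial : ℂ)⁻¹) •
        PowerSeries.coeff r.2 K.amplitude) [] []
  convert h using 1
  funext f₁ f₂
  simp only [Finset.sum_apply]
  rw [formalIntegral_C, coeff_coeffMap, PowerSeries.coeff_mul, map_sum]
  refine Finset.sum_congr rfl fun r _ => ?_
  rw [PowerSeries.coeff_mul, Finset.sum_mul, map_sum]
  refine Finset.sum_congr rfl fun s _ => ?_
  refine congrArg K.G ?_
  rw [shiftBar, shift, tau, tau, coeff_opSeries_C, coeff_opSeries_C, mul_comm, smul_mul_smul_comm,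
    mul_smul_comm, smul_mul_assoc]
  rfl

end FormalKahler

end KahlerQuantization

/-! ### The coefficients of order zero and two in `ε`. -/

namespace KahlerQuantization

theorem coeff_one_fexp {R : Type*} [CommRing R] [Algebra ℂ R] (F : PowerSeries R) :
    PowerSeries.coeff 1 (fexp F) = PowerSeries.coeff 1 F := by
  have h := congrArg (PowerSeries.coeff 0) (derivative_fexp F)
  rw [coeff_zero_mul', PowerSeries.coeff_derivative, PowerSeries.coeff_derivative, coeff_zero_fexp]
    at h
  simpa using h

theorem coeff_one_opSeries {R : Type*} [CommRing R] [Algebra ℂ R] (c : ℕ → ℂ) (T : R →ₗ[ℂ] R)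
    (F : PowerSeries R) : PowerSeries.coeff 1 (opSeries c T F) =
      c 0 • PowerSeries.coeff 1 F + c 1 • T (PowerSeries.coeff 0 F) := by
  rw [coeff_opSeries, Finset.Nat.antidiagonal_succ]
  simp

namespace FormalKahler

open MvPolynomial

variable {ι A : Type*} [Fintype ι] [DecidableEq ι] [CommRing A] [Algebra ℂ A]
  (K : FormalKahler ι A)

theorem G_C_mul (a : A) (p : MvPolynomial (ι ⊕ ι) A) : K.G (C a * p) = a * K.G p := by
  rw [← smul_eq_C_mul, map_smul, smul_eq_mul]

theorem G_X_mul_X_mul_C (k l : ι ⊕ ι) (a : A) :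
    K.G (X k * (X l * C a)) = K.cov k l * K.G (C a) := by
  rw [G_X_mul, Finset.sum_eq_single l]
  · rw [Derivation.leibniz, pderiv_C, smul_zero, zero_add, pderiv_X_self, smul_eq_mul, mul_one]
  · intro m _ hm
    rw [Derivation.leibniz, pderiv_C, smul_zero, zero_add, pderiv_X_of_ne hm.symm, smul_zero,
      map_zero, mul_zero]
  · simp

theorem coeff_zero_shift (v : ι → MvPolynomial (ι ⊕ ι) A) (f : A) :
    PowerSeries.coeff 0 (K.shift v (PowerSeries.C (C f))) = C f := by
  rw [shift, coeff_zero_tau, PowerSeries.coeff_zero_C]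

theorem coeff_zero_shiftBar (v : ι → MvPolynomial (ι ⊕ ι) A) (f : A) :
    PowerSeries.coeff 0 (K.shiftBar v (PowerSeries.C (C f))) = C f := by
  rw [shiftBar, coeff_zero_tau, PowerSeries.coeff_zero_C]

theorem coeff_one_shift (f : A) :
    PowerSeries.coeff 1 (K.shift (holVar ι A) (PowerSeries.C (C f))) =
      ∑ i, X (Sum.inl i) * C (K.d i f) := by
  rw [shift, tau, coeff_opSeries_C, Nat.factorial_one, Nat.cast_one, inv_one, one_smul, pow_one]
  exact dirD_C K.d Sum.inl f

theorem coeff_one_shiftBar (f : A) :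
    PowerSeries.coeff 1 (K.shiftBar (antiVar ι A) (PowerSeries.C (C f))) =
      ∑ i, X (Sum.inr i) * C (K.dbar i f) := by
  rw [shiftBar, tau, coeff_opSeries_C, Nat.factorial_one, Nat.cast_one, inv_one, one_smul, pow_one]
  exact dirD_C K.dbar Sum.inr f

/-- The covariance only pairs `y` with `ȳ`. Hence the second derivatives of one function, purely
holomorphic or purely antiholomorphic, do not contribute. -/
theorem G_dirD_sq {d : ι → Derivation ℂ A A} {s : ι → ι ⊕ ι} (hs : ∀ i j, K.cov (s i) (s j) = 0)
    (a f : A) :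
    K.G (C a * ((dirD d fun i => (X (s i) : MvPolynomial (ι ⊕ ι) A)).toLinearMap ^ 2) (C f)) =
      0 := by
  rw [G_C_mul, dirD_pow_succ_C, map_sum, Finset.sum_eq_zero, mul_zero]
  intro i _
  rw [pow_one]
  refine (congrArg (fun q => K.G (X (s i) * q)) (dirD_C d s (d i f))).trans ?_
  rw [Finset.mul_sum, map_sum]
  refine Finset.sum_eq_zero fun j _ => ?_
  rw [G_X_mul_X_mul_C, hs, zero_mul]

theorem G_coeff_two_shift (a f : A) :
    K.G (C a * PowerSeries.coeff 2 (K.shift (holVar ι A) (PowerSeries.C (C f)))) = 0 := by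
  have h := K.G_dirD_sq (d := K.d) (s := Sum.inl) (fun _ _ => rfl) a f
  rw [shift, tau, coeff_opSeries_C, mul_smul_comm]
  refine (map_smul (K.G.restrictScalars ℂ) _ _).trans ?_
  exact (congrArg _ h).trans (smul_zero _)

theorem G_coeff_two_shiftBar (a f : A) :
    K.G (C a * PowerSeries.coeff 2 (K.shiftBar (antiVar ι A) (PowerSeries.C (C f)))) = 0 := by
  have h := K.G_dirD_sq (d := K.dbar) (s := Sum.inr) (fun _ _ => rfl) a f
  rw [shiftBar, tau, coeff_opSeries_C, mul_smul_comm]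
  refine (map_smul (K.G.restrictScalars ℂ) _ _).trans ?_
  exact (congrArg _ h).trans (smul_zero _)

theorem coeff_zero_amplitude : PowerSeries.coeff 0 K.amplitude = C K.det := by
  rw [amplitude, coeff_zero_mul', coeff_zero_fexp, one_mul, shift, coeff_zero_tau,
    coeff_zero_shiftBar]

/-- The factor `1 / 2` is the weight `1 / ((p + 1)! (q + 1)!)` of the Calabi expansion at `p + q =
1`. -/
theorem coeff_one_amplitude :
    PowerSeries.coeff 1 K.amplitude =
      (∑ i, X (Sum.inl i) * C (K.d i K.det) + ∑ i, X (Sum.inr i) * C (K.dbar i K.det)) -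
        C (algebraMap ℂ A (1 / 2) * K.det) * (∑ i, X (Sum.inl i) * mapCoeff (K.d i) K.Q +
          ∑ i, X (Sum.inr i) * mapCoeff (K.dbar i) K.Q) := by
  have h1 : PowerSeries.coeff 1 (K.shift (holVar ι A)
      (K.shiftBar (antiVar ι A) (PowerSeries.C (C K.det)))) =
      ∑ i, X (Sum.inr i) * C (K.dbar i K.det) + ∑ i, X (Sum.inl i) * C (K.d i K.det) := by
    rw [shift, tau, coeff_one_opSeries, coeff_one_shiftBar, coeff_zero_shiftBar]
    simp only [Nat.factorial_zero, Nat.factorial_one, Nat.cast_one, inv_one, one_smul]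
    exact congrArg _ (dirD_C K.d Sum.inl _)
  have h2 : PowerSeries.coeff 1 (K.calabi (holVar ι A) (antiVar ι A)) =
      (1 / 2 : ℂ) • (∑ i, X (Sum.inr i) * mapCoeff (K.dbar i) K.Q) +
        (1 / 2 : ℂ) • (∑ i, X (Sum.inl i) * mapCoeff (K.d i) K.Q) := by
    have e1 : (((0 + 1).factorial : ℕ) : ℂ)⁻¹ = 1 := by norm_num
    have e2 : (((1 + 1).factorial : ℕ) : ℂ)⁻¹ = 1 / 2 := by norm_num
    rw [calabi, jop, jop, coeff_one_opSeries, coeff_opSeries_C, coeff_zero_opSeries]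
    simp only [e1, e2, pow_one, one_smul, PowerSeries.coeff_zero_C]
    exact congrArg₂ (· + ·) (congrArg _ (dirD_apply _ _ _)) (congrArg _ (dirD_apply _ _ _))
  have h3 : ∀ F H : PowerSeries (MvPolynomial (ι ⊕ ι) A), PowerSeries.coeff 1 (F * H) =
      PowerSeries.coeff 0 F * PowerSeries.coeff 1 H +
        PowerSeries.coeff 1 F * PowerSeries.coeff 0 H := fun F H => by
    rw [PowerSeries.coeff_mul, Finset.Nat.antidiagonal_succ]; simp
  have h4 : PowerSeries.coeff 1 (PowerSeries.C K.Q) = 0 := PowerSeries.coeff_C_of_ne_zero one_ne_zero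
  rw [amplitude, h3, coeff_zero_fexp, one_mul, coeff_one_fexp, h1, map_sub, h2, h4, shift,
    coeff_zero_tau, coeff_zero_shiftBar, zero_sub, ← smul_add, neg_mul, Algebra.smul_def,
    MvPolynomial.algebraMap_apply, C_mul, add_comm (∑ i, X (Sum.inr i) * mapCoeff _ _),
    add_comm (∑ i, X (Sum.inr i) * C _), sub_eq_add_neg, mul_right_comm]

theorem pderiv_sum_X_mul (k : ι ⊕ ι) (q : ι ⊕ ι → MvPolynomial (ι ⊕ ι) A) :
    pderiv k (∑ i, X (Sum.inl i) * q (Sum.inl i) + ∑ i, X (Sum.inr i) * q (Sum.inr i)) =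
      q k + (∑ i, X (Sum.inl i) * pderiv k (q (Sum.inl i)) +
        ∑ i, X (Sum.inr i) * pderiv k (q (Sum.inr i))) := by
  have h := Fintype.sum_sum_type fun l => X l * q l
  have h' := Fintype.sum_sum_type fun l => X l * pderiv k (q l)
  rw [← h, ← h', map_sum]
  simp only [Derivation.leibniz, smul_eq_mul, Finset.sum_add_distrib]
  rw [add_comm]
  congr 1
  rw [Finset.sum_eq_single k]
  · rw [pderiv_X_self, mul_one]
  · intro l _ hl
    rw [pderiv_X_of_ne hl, mul_zero]
  · simp

/-- By `hQ`, the two contributions of the cubic part agree under `G` and use up the factor `1 / 2`.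
What is left is `D det * G 1 - det * G (D Q)`, which is `D (G (det)) = D 1 = 0`. -/
theorem G_pderiv_coeff_one_amplitude {k : ι ⊕ ι} {D : Derivation ℂ A A}
    (hD : ∀ p, D (K.G p) = K.G (mapCoeff D p - p * mapCoeff D K.Q))
    (hk : Sum.elim (fun i => C (K.d i K.det)) (fun i => C (K.dbar i K.det)) k =
      (C (D K.det) : MvPolynomial (ι ⊕ ι) A))
    (hkQ : Sum.elim (fun i => mapCoeff (K.d i) K.Q) (fun i => mapCoeff (K.dbar i) K.Q) k =
      mapCoeff D K.Q)
    (hQ : K.G (∑ i, X (Sum.inl i) * pderiv k (mapCoeff (K.d i) K.Q) +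
      ∑ i, X (Sum.inr i) * pderiv k (mapCoeff (K.dbar i) K.Q)) = K.G (mapCoeff D K.Q)) :
    K.G (pderiv k (PowerSeries.coeff 1 K.amplitude)) = 0 := by
  have h1 := pderiv_sum_X_mul k
    (Sum.elim (fun i => C (K.d i K.det)) fun i => C (K.dbar i K.det))
  have h2 := pderiv_sum_X_mul k
    (Sum.elim (fun i => mapCoeff (K.d i) K.Q) fun i => mapCoeff (K.dbar i) K.Q)
  rw [hk] at h1
  rw [hkQ] at h2
  simp only [Sum.elim_inl, Sum.elim_inr] at h1 h2
  simp only [pderiv_C, mul_zero, Finset.sum_const_zero, add_zero] at h1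
  have h3 : algebraMap ℂ A (1 / 2) + algebraMap ℂ A (1 / 2) = 1 := by
    rw [← map_add]; norm_num
  have h4 := hD (C K.det)
  rw [K.G_det, Derivation.map_one_eq_zero, mapCoeff_C, map_sub, G_C_mul] at h4
  rw [coeff_one_amplitude, (pderiv (R := A) k).map_sub, h1, Derivation.leibniz, pderiv_C, smul_zero,
    add_zero, h2, smul_eq_mul, map_sub, G_C_mul, map_add, hQ]
  linear_combination -h4 - K.det * K.G (mapCoeff D K.Q) * h3

theorem G_X_mul_coeff_one_amplitude (k : ι ⊕ ι) :
    K.G (X k * PowerSeries.coeff 1 K.amplitude) = 0 := by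
  have hX2 : ∀ k l a, K.cov k l = 0 → K.G (X k * (C a * X l)) = 0 := fun k l a h => by
    rw [mul_comm (C a), G_X_mul_X_mul_C, h, zero_mul]
  have hQ : ∀ D : Derivation ℂ A A, mapCoeff D K.Q =
      quadForm (fun i j => D (K.h i j)) (holVar ι A) (antiVar ι A) :=
    fun D => mapCoeff_quadForm D _ isConstVec_holVar isConstVec_antiVar
  rw [G_X_mul]
  refine Finset.sum_eq_zero fun l _ => ?_
  suffices h : K.G (pderiv l (PowerSeries.coeff 1 K.amplitude)) = 0 by rw [h, mul_zero]
  rcases l with j | j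
  · refine K.G_pderiv_coeff_one_amplitude (K.d_G j) rfl rfl ?_
    -- The terms with two antiholomorphic variables have covariance zero. In the mixed terms
    -- closedness interchanges the differentiation index with the row index and recovers the
    -- derivative of `Q`.
    simp only [hQ, pderiv_inl_quadForm, antiVar, Finset.mul_sum, map_add, map_sum]
    rw [Finset.sum_eq_zero (s := Finset.univ) (f := fun i => ∑ l, K.G (X (Sum.inr i) * _))
      fun i _ => Finset.sum_eq_zero fun l _ => hX2 _ _ _ rfl, add_zero, quadForm, map_sum]
    refine Finset.sum_congr rfl fun i _ => ?_
    rw [map_sum]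
    refine Finset.sum_congr rfl fun l _ => congrArg K.G ?_
    rw [K.closed j l i, holVar, mul_left_comm, mul_assoc]
    rfl
  · refine K.G_pderiv_coeff_one_amplitude (K.dbar_G j) rfl rfl ?_
    simp only [hQ, pderiv_inr_quadForm, holVar, Finset.mul_sum, map_add, map_sum]
    rw [Finset.sum_eq_zero (s := Finset.univ) (f := fun i => ∑ l, K.G (X (Sum.inl i) * _))
      fun i _ => Finset.sum_eq_zero fun l _ => hX2 _ _ _ rfl, zero_add, quadForm, map_sum,
      Finset.sum_comm]
    refine Finset.sum_congr rfl fun i _ => ?_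
    rw [map_sum]
    refine Finset.sum_congr rfl fun l _ => congrArg K.G ?_
    rw [K.closed_bar i j l, antiVar, mul_comm (X (Sum.inr l))]
    rfl

theorem coeff_zero_formalIntegral (f₁ f₂ : A) :
    PowerSeries.coeff 0 (K.formalIntegral (PowerSeries.C f₁) (PowerSeries.C f₂)) = f₁ * f₂ := by
  rw [formalIntegral_C, coeff_coeffMap, coeff_zero_mul', coeff_zero_mul', coeff_zero_shiftBar,
    coeff_zero_shift, coeff_zero_amplitude, mul_assoc]
  refine (K.G_C_mul _ _).trans ?_
  rw [G_C_mul, K.G_det, mul_one]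

/-- The second coefficient of the formal integral. -/
theorem coeff_two_formalIntegral (f₁ f₂ : A) :
    PowerSeries.coeff 2 (K.formalIntegral (PowerSeries.C f₁) (PowerSeries.C f₂)) =
      f₁ * f₂ * K.G (PowerSeries.coeff 2 K.amplitude) +
        ∑ i, ∑ j, K.hinv i j * (K.d i f₂ * K.dbar j f₁) := by
  have h2 : ∀ F H V : PowerSeries (MvPolynomial (ι ⊕ ι) A), PowerSeries.coeff 2 (F * H * V) =
      PowerSeries.coeff 0 F * (PowerSeries.coeff 0 H * PowerSeries.coeff 2 V) +
      PowerSeries.coeff 0 F * (PowerSeries.coeff 1 H * PowerSeries.coeff 1 V) +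
      PowerSeries.coeff 0 H * (PowerSeries.coeff 1 F * PowerSeries.coeff 1 V) +
      PowerSeries.coeff 0 F * (PowerSeries.coeff 0 V * PowerSeries.coeff 2 H) +
      PowerSeries.coeff 0 H * (PowerSeries.coeff 0 V * PowerSeries.coeff 2 F) +
      PowerSeries.coeff 0 V * (PowerSeries.coeff 1 H * PowerSeries.coeff 1 F) := fun F H V => by
    have a2 : Finset.HasAntidiagonal.antidiagonal 2 = {(0, 2), (1, 1), (2, 0)} := rfl
    have a1 : Finset.HasAntidiagonal.antidiagonal 1 = {(0, 1), (1, 0)} := rfl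
    have a0 : Finset.HasAntidiagonal.antidiagonal 0 = {(0, 0)} := rfl
    simp only [PowerSeries.coeff_mul, a0, a1, a2, Finset.sum_insert, Finset.sum_singleton,
      Finset.mem_insert, Finset.mem_singleton, Prod.mk.injEq, zero_ne_one, one_ne_zero,
      OfNat.zero_ne_ofNat, OfNat.one_ne_ofNat, OfNat.ofNat_ne_one, OfNat.ofNat_ne_zero, and_self,
      or_self, not_false_eq_true]
    ring
  have h3 : ∀ s : ι → ι ⊕ ι, ∀ a : ι → A,
      K.G ((∑ i, X (s i) * C (a i)) * PowerSeries.coeff 1 K.amplitude) = 0 := fun s a => by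
    rw [Finset.sum_mul, map_sum]
    refine Finset.sum_eq_zero fun i _ => ?_
    rw [mul_right_comm, mul_comm, G_C_mul, G_X_mul_coeff_one_amplitude, mul_zero]
  have h4 : K.G (C K.det * ((∑ i, X (Sum.inl i) * C (K.d i f₂)) *
      ∑ j, X (Sum.inr j) * C (K.dbar j f₁))) =
      ∑ i, ∑ j, K.hinv i j * (K.d i f₂ * K.dbar j f₁) := by
    rw [Finset.sum_mul_sum, Finset.mul_sum, map_sum]
    refine Finset.sum_congr rfl fun i _ => ?_
    rw [Finset.mul_sum, map_sum]
    refine Finset.sum_congr rfl fun j _ => ?_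
    have : (C K.det * (X (Sum.inl i) * C (K.d i f₂) * (X (Sum.inr j) * C (K.dbar j f₁))) :
        MvPolynomial (ι ⊕ ι) A) =
        C (K.d i f₂ * K.dbar j f₁) * (X (Sum.inl i) * (X (Sum.inr j) * C K.det)) := by
      rw [C_mul]; ring
    rw [this, G_C_mul, G_X_mul_X_mul_C, K.G_det, mul_one, mul_comm]
    rfl
  rw [formalIntegral_C, coeff_coeffMap, h2, coeff_zero_shift, coeff_zero_shiftBar, coeff_one_shift,
    coeff_one_shiftBar, coeff_zero_amplitude, LinearMap.restrictScalars_apply]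
  simp only [map_add]
  -- Terms with one first derivative vanish by `h3` and those with a second derivative by
  -- covariance. The undifferentiated term and the mixed term `h4` survive.
  rw [h4, G_C_mul, G_C_mul, G_C_mul _ f₁, h3, G_C_mul _ f₂, h3, ← mul_assoc (C f₁), ← C_mul,
    G_coeff_two_shift, ← mul_assoc (C f₂), ← C_mul, G_coeff_two_shiftBar]
  ring

end FormalKahler

end KahlerQuantization

namespace KahlerQuantization

/-! ### The product on formal power series in `ħ`. -/

section Product

open PowerSeries

theorem isFormalProduct_of_bilinear {A : Type*} [CommRing A] [Algebra ℂ A]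
    (B : PowerSeries A →ₗ[PowerSeries ℂ] PowerSeries A →ₗ[PowerSeries ℂ] PowerSeries A) :
    IsFormalProduct fun F G => B F G := by
  have hX : ∀ F : PowerSeries A, X * F = (X : PowerSeries ℂ) • F := fun F => by
    rw [← mul_one (X : PowerSeries ℂ), IsFormalProduct.X_mul_smul, one_smul]
  exact ⟨fun _ _ _ => by rw [map_add, LinearMap.add_apply], fun _ _ _ => map_add _ _ _,
    fun _ _ => by rw [hX, map_smul, LinearMap.smul_apply, ← hX],
    fun _ _ => by rw [hX, map_smul, ← hX]⟩

/-- A product that is linear over the complex numbers on constants is linear over the formal power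
series. -/
def IsFormalProduct.toLinear {A : Type*} [CommRing A] [Algebra ℂ A]
    {P : PowerSeries A → PowerSeries A → PowerSeries A} (hP : IsFormalProduct P)
    (hl : ∀ (c : ℂ) a b, P (C (c • a)) (C b) = c • P (C a) (C b))
    (hr : ∀ (c : ℂ) a b, P (C a) (C (c • b)) = c • P (C a) (C b)) :
    PowerSeries A →ₗ[PowerSeries ℂ] PowerSeries A →ₗ[PowerSeries ℂ] PowerSeries A :=
  LinearMap.mk₂ (PowerSeries ℂ) P hP.add_left (fun s F G => hP.smul_left hl s F G) hP.add_right
    fun s F G => hP.flip.smul_left (fun c a b => hr c b a) s G F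

theorem parityPart_smul {A : Type*} [CommRing A] [Algebra ℂ A] (r : ℕ) (c : ℂ)
    (F : PowerSeries A) : parityPart r (c • F) = c • parityPart r F := by
  ext k
  rw [coeff_parityPart, coeff_smul, coeff_smul, coeff_parityPart]

namespace FormalKahler

variable {ι A : Type*} [Fintype ι] [DecidableEq ι] [CommRing A] [Algebra ℂ A]
  (K : FormalKahler ι A)

/-- The product that is defined by the formal integral. -/
def product : PowerSeries A →ₗ[PowerSeries ℂ] PowerSeries A →ₗ[PowerSeries ℂ] PowerSeries A :=
  K.isFormalProduct_formalIntegral.evenProduct.toLinear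
    (fun c a b => by
      simp only [evenProduct, sqSubst_C]
      rw [formalIntegral_smul_left, parityPart_smul])
    (fun c a b => by
      simp only [evenProduct, sqSubst_C]
      rw [formalIntegral_smul_right, parityPart_smul])

theorem coeff_product_C (a b : A) (k : ℕ) :
    coeff k (K.product (C a) (C b)) = coeff (2 * k) (K.formalIntegral (C a) (C b)) :=
  K.isFormalProduct_formalIntegral.coeff_evenProduct_C a b k

theorem product_assoc (h : ∀ a b k, coeff (2 * k + 1) (K.formalIntegral (C a) (C b)) = 0)
    (F G H : PowerSeries A) : K.product (K.product F G) H = K.product F (K.product G H) :=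
  K.isFormalProduct_formalIntegral.evenProduct_assoc h K.formalIntegral_assoc F G H

theorem X_dvd_product_sub (a b : A) : X ∣ K.product (C a) (C b) - C (a * b) := by
  rw [X_dvd_iff, ← coeff_zero_eq_constantCoeff_apply, map_sub, coeff_product_C, mul_zero,
    coeff_zero_formalIntegral, coeff_zero_C, sub_self]

/-- Order `ħ` corresponds to order `ε²`. There the undifferentiated term is symmetric in `a` and
`b`, so only the mixed first derivatives survive in the commutator. -/
theorem X_sq_dvd_commutator (a b c : A)
    (hc : c = ∑ i, ∑ j, K.hinv i j * (K.d i b * K.dbar j a) -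
      ∑ i, ∑ j, K.hinv i j * (K.d i a * K.dbar j b)) :
    X ^ 2 ∣ K.product (C a) (C b) - K.product (C b) (C a) - X * C c := by
  rw [X_pow_dvd_iff]
  intro m hm
  rw [map_sub, map_sub, coeff_product_C, coeff_product_C]
  interval_cases m
  · rw [mul_zero, coeff_zero_formalIntegral, coeff_zero_formalIntegral, mul_comm b, sub_self,
      zero_sub, coeff_zero_X_mul, neg_zero]
  · rw [mul_one, coeff_two_formalIntegral, coeff_two_formalIntegral, hc,
      show (1 : ℕ) = 0 + 1 from rfl, coeff_succ_X_mul, coeff_zero_C]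
    ring

end FormalKahler

end Product

/-! ### Existence, uniqueness and the properties of the product of a Kähler metric. -/

namespace KahlerMetric

variable {n : ℕ} (g : KahlerMetric n)

theorem coeff_odd_formalIntegral (a b : Obs n) (k : ℕ) :
    PowerSeries.coeff (2 * k + 1)
      (g.toFormal.formalIntegral (PowerSeries.C a) (PowerSeries.C b)) = 0 := by
  refine Subtype.ext (funext fun z => ?_)
  exact (g.laplaceCoeff_eq a b (2 * k + 1) z).symm.trans (g.laplaceCoeff_odd a b k z)

/-- The product of a Kähler metric. -/
def bullet : FormalProduct n := g.toFormal.product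

theorem isBullet_bullet : IsBullet g g.bullet where
  integrable := g.integrable_coeff_integrand
  odd := g.laplaceCoeff_odd
  even f₁ f₂ k z := (congrArg (fun a : Obs n => a.1 z) (g.toFormal.coeff_product_C f₁ f₂ k)).trans
    (g.laplaceCoeff_eq f₁ f₂ (2 * k) z).symm

/-- The Laplace coefficients prescribe the product on constants, and `ext_C` extends the equality to
all series. -/
theorem eq_bullet {B : FormalProduct n} (hB : IsBullet g B) : B = g.bullet := by
  refine LinearMap.ext fun F => LinearMap.ext fun G => ?_
  refine (isFormalProduct_of_bilinear B).ext_C (isFormalProduct_of_bilinear g.bullet)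
    (fun a b => PowerSeries.ext fun k => Subtype.ext (funext fun z => ?_)) F G
  exact (hB.even a b k z).trans (g.isBullet_bullet.even a b k z).symm

theorem isBidifferential_cochain (k : ℕ) : IsBidifferential (cochain g.bullet k) := by
  obtain ⟨s, a, h⟩ := exists_finset_of_mem_bidiffOps (g.toFormal.coeff_formalIntegral_mem (2 * k))
  have hD : g.toFormal.partialOp = partialDeriv := by
    funext i; cases i <;> rfl
  rw [hD] at h
  exact ⟨s, a, fun f₁ f₂ => (g.toFormal.coeff_product_C f₁ f₂ k).trans (h f₁ f₂)⟩

/-- The two prefactors multiply to `-1`. This puts the antiholomorphic derivative on `f₁` in the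
positive term, as in the formal integral. -/
theorem poisson_eq (f₁ f₂ : Obs n) : (1 / (2 * Complex.I)) • g.poisson f₁ f₂ =
    ∑ i, ∑ j, g.inv i j * (dz i f₂ * dzbar j f₁) -
      ∑ i, ∑ j, g.inv i j * (dz i f₁ * dzbar j f₂) := by
  have hI : (1 / (2 * Complex.I)) * (2 / Complex.I) = -1 := by
    rw [div_mul_div_comm, one_mul, mul_assoc, Complex.I_mul_I]; norm_num
  rw [poisson, smul_smul, hI, neg_one_smul, ← Finset.sum_sub_distrib, ← Finset.sum_neg_distrib]
  refine Finset.sum_congr rfl fun i _ => ?_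
  rw [← Finset.sum_sub_distrib, ← Finset.sum_neg_distrib]
  refine Finset.sum_congr rfl fun j _ => ?_
  ring

theorem isDeformationQuantization_bullet : IsDeformationQuantization g g.bullet where
  assoc := g.toFormal.product_assoc g.coeff_odd_formalIntegral
  bidifferential := g.isBidifferential_cochain
  classical := g.toFormal.X_dvd_product_sub
  correspondence f₁ f₂ := g.toFormal.X_sq_dvd_commutator f₁ f₂ _ (g.poisson_eq f₁ f₂)

theorem conjSeries_add (F G : PowerSeries (Obs n)) :
    conjSeries (F + G) = conjSeries F + conjSeries G := by
  ext1 k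
  simp only [conjSeries, PowerSeries.coeff_mk, map_add]
  exact map_add (conjHom n) _ _

theorem conjSeries_X_mul (F : PowerSeries (Obs n)) :
    conjSeries (PowerSeries.X * F) = PowerSeries.X * conjSeries F := by
  ext1 k
  cases k with
  | zero =>
    rw [conjSeries, PowerSeries.coeff_mk, PowerSeries.coeff_zero_X_mul,
      PowerSeries.coeff_zero_X_mul]
    exact map_zero (conjHom n)
  | succ k =>
    rw [conjSeries, PowerSeries.coeff_mk, PowerSeries.coeff_succ_X_mul,
      PowerSeries.coeff_succ_X_mul, conjSeries, PowerSeries.coeff_mk]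

theorem conjSeries_C (a : Obs n) : conjSeries (PowerSeries.C a) = PowerSeries.C (conjObs a) := by
  ext1 k
  rw [conjSeries, PowerSeries.coeff_mk, PowerSeries.coeff_C, PowerSeries.coeff_C]
  split_ifs
  · rfl
  · exact map_zero (conjHom n)

/-- Conjugation is additive and fixes `ħ`, so both sides are determined by constants. There the
claim is the conjugation symmetry of the Laplace coefficients. -/
theorem conjSeries_bullet (F G : PowerSeries (Obs n)) :
    conjSeries (g.bullet F G) = g.bullet (conjSeries G) (conjSeries F) := by
  have hB := isFormalProduct_of_bilinear g.bullet
  refine IsFormalProduct.ext_C (P := fun F G => conjSeries (g.bullet F G))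
    (P' := fun F G => g.bullet (conjSeries G) (conjSeries F))
    ⟨fun _ _ _ => ?_, fun _ _ _ => ?_, fun _ _ => ?_, fun _ _ => ?_⟩
    ⟨fun _ _ _ => ?_, fun _ _ _ => ?_, fun _ _ => ?_, fun _ _ => ?_⟩ (fun a b => ?_) F G
  · rw [hB.add_left, conjSeries_add]
  · rw [hB.add_right, conjSeries_add]
  · rw [hB.X_mul_left, conjSeries_X_mul]
  · rw [hB.X_mul_right, conjSeries_X_mul]
  · rw [conjSeries_add, hB.add_right]
  · rw [conjSeries_add, hB.add_left]
  · rw [conjSeries_X_mul, hB.X_mul_right]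
  · rw [conjSeries_X_mul, hB.X_mul_left]
  · rw [conjSeries_C, conjSeries_C]
    refine PowerSeries.ext fun k => Subtype.ext (funext fun z => ?_)
    rw [conjSeries, PowerSeries.coeff_mk, conjObs_apply]
    have h := g.isBullet_bullet.even
    exact (congrArg (starRingEnd ℂ) (h a b k z)).trans
      ((g.laplaceCoeff_conj a b (2 * k) z).symm.trans (h (conjObs b) (conjObs a) k z).symm)

end KahlerMetric

end KahlerQuantization

end

theorem corollary3p8 (n : ℕ) (g : KahlerQuantization.KahlerMetric n) :
    (∃! B : KahlerQuantization.FormalProduct n, KahlerQuantization.IsBullet g B) ∧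
    ∀ B : KahlerQuantization.FormalProduct n, KahlerQuantization.IsBullet g B →
      KahlerQuantization.IsDeformationQuantization g B ∧
      ∀ F₁ F₂ : PowerSeries (KahlerQuantization.Obs n),
        KahlerQuantization.conjSeries (B F₁ F₂) =
          B (KahlerQuantization.conjSeries F₂) (KahlerQuantization.conjSeries F₁) := by
  refine ⟨⟨g.bullet, g.isBullet_bullet, fun B hB => g.eq_bullet hB⟩, fun B hB => ?_⟩
  obtain rfl := g.eq_bullet hB
  exact ⟨g.isDeformationQuantization_bullet, g.conjSeries_bullet⟩
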